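/- Let $B$ be a connected, compact, oriented $2$-orbifold, i.e. a Hausdorff, second countable diffeological space locally diffeomorphic to quotients $\mathbb B^2/\Gamma$ of the open disc by finite rotation groups $\Gamma\subset \mathrm{SO}(2)$, with an orientation of the surface of regular points. Let $x_1,\dots,x_n$ be its singular points and $m_1,\dots,m_n$ their orders ($x_k$ has order $m$ if there is a chart $\mathbb B^2/\Gamma\to D\subset B$ with $[0]\mapsto x_k$ and $|\Gamma|=m$). For an oriented circle orbibundle $\zeta:M\to B$ the Euler number $e(M)\in\mathbb Q$ is defined as follows. Choose a regular point $x_0$ and positively oriented smooth open discs $D_i$ centred at $x_0,x_1,\dots,x_n$, with disjoint closures, and a continuous section $\sigma$ of $\zeta$ over $B'=B\setminus\bigsqcup_i D_i$. Let $s$ be a positively oriented fibre over a regular point of $\overline D_i$, and write $\sigma|_{\partial D_i}=q_i\,s$ in $H_1(\zeta^{-1}(\overline D_i);\mathbb Q)$ with $q_i\in\mathbb Q$; then $e(M)=\sum_{i=0}^n q_i$ (so that, with the boundary orientation, $\sigma|_{\partial B'}=-e(M)\,s$). Let $TB$ be the tangent orbibundle, which over a chart $\mathbb B^2/\Gamma$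 is $(\mathbb B^2\times\mathbb R^2)/\Gamma$ with $\Gamma$ acting by rotations and their differentials. The Euler characteristic $\chi(B)$ is the Euler number of $TB$, that is, of the circle orbibundle $\mathbb S(TB)=TB^{\times}/\mathbb R_{>0}\to B$, where $TB^\times$ is the complement of the zero section. Let $\tilde B$ be the oriented smooth surface obtained from $B$ by removing discs around the singular points and gluing regular discs in their place. Then $\chi(B)$ and $\chi(\tilde B)$ are well defined (the choices above exist and the value does not depend on them), and $$\chi(B)=\chi(\tilde B)+\sum_{k=1}^n\Bigl(-1+\frac1{m_k}\Bigr).$$ -/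

import Mathlib

open Metric Set Diffeology
open scoped ContDiff

noncomputable section

/-- The standard diffeology on `ℂ = ℝ²`: the plots are the smooth maps `ℝⁿ → ℂ`. -/
instance : DiffeologicalSpace ℂ := NormedSpace.toDiffeology ℂ

/-- Smoothness of `f` restricted to the subset `s`, where `s` carries the subspace diffeology
(the plots of `s` are the plots of `X` with values in `s`). -/
def DSmoothOn {X Y : Type*} [DiffeologicalSpace X] [DiffeologicalSpace Y]
    (f : X → Y) (s : Set X) : Prop :=
  ∀ (n : ℕ) (p : EuclideanSpace ℝ (Fin n) → X), IsPlot p → (∀ t, p t ∈ s) → IsPlot (f ∘ p)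

/-! ### Oriented 2-orbifolds as diffeological spaces -/

/-- An orbifold chart of order `m` on a diffeological space `B`: a diffeomorphism from the cone
`𝔹/Γ` onto an open subset `D` of `B`, where `𝔹 ⊂ ℂ` is an open disc centred at `0` and
`Γ = {ξ | ξ ^ m = 1}` is the finite rotation group of order `m`.
It is given by the composition `𝔹 → 𝔹/Γ → D`. That the induced map `𝔹/Γ → D` is a diffeomorphism
(quotient diffeology on the left, subspace diffeology on the right) says that its fibres are the
orbits of `Γ`, that it is smooth and that every plot of `D` lifts locally to a smooth map into `𝔹`.
The disc is normalised to have radius `2`; the unit disc inside it will play the role of a smaller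
disc with smooth boundary. The values of `toFun` outside the disc of radius `2` are irrelevant. -/
structure OrbifoldChart (B : Type*) [TopologicalSpace B] [DiffeologicalSpace B] where
  toFun : ℂ → B
  order : ℕ
  order_pos : 0 < order
  isOpen_image : IsOpen (toFun '' ball 0 2)
  fibres : ∀ z ∈ ball (0 : ℂ) 2, ∀ w ∈ ball (0 : ℂ) 2,
    (toFun z = toFun w ↔ ∃ ξ : ℂ, ξ ^ order = 1 ∧ w = ξ * z)
  smooth : DSmoothOn toFun (ball 0 2)
  lift : ∀ (n : ℕ) (q : EuclideanSpace ℝ (Fin n) → B), IsPlot q →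
    (∀ t, q t ∈ toFun '' ball 0 2) → ∀ t, ∃ (U : Set (EuclideanSpace ℝ (Fin n)))
      (p : EuclideanSpace ℝ (Fin n) → ℂ), IsOpen U ∧ t ∈ U ∧ ContDiffOn ℝ ∞ p U ∧
        ∀ s ∈ U, p s ∈ ball 0 2 ∧ toFun (p s) = q s

namespace OrbifoldChart

variable {B : Type*} [TopologicalSpace B] [DiffeologicalSpace B]

instance : CoeFun (OrbifoldChart B) (fun _ => ℂ → B) := ⟨toFun⟩

/-- The domain `D` of `B` covered by the chart. -/
def image (c : OrbifoldChart B) : Set B := c '' ball 0 2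

/-- The point at which the chart is centred. -/
def center (c : OrbifoldChart B) : B := c 0

/-- The smaller smooth open disc around the centre, the image of the open unit disc. -/
def openDisc (c : OrbifoldChart B) : Set B := c '' ball 0 1

/-- The closure of `openDisc`, the image of the closed unit disc. -/
def closedDisc (c : OrbifoldChart B) : Set B := c '' closedBall 0 1

end OrbifoldChart

/-- A (locally orientable) `2`-orbifold: a Hausdorff and second countable diffeological space
(with its D-topology) which is locally diffeomorphic to quotients of discs by finite groups of
rotations. -/
class IsTwoOrbifold (B : Type*) [TopologicalSpace B] [DiffeologicalSpace B] : Prop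
    extends IsDTopologyCompatible B, T2Space B, SecondCountableTopology B where
  exists_chart : ∀ x : B, ∃ c : OrbifoldChart B, x ∈ c.image

/-- The point `x` has order `m`: there is an orbifold chart of order `m` centred at `x`. -/
def HasOrder {B : Type*} [TopologicalSpace B] [DiffeologicalSpace B] (x : B) (m : ℕ) : Prop :=
  ∃ c : OrbifoldChart B, c.center = x ∧ c.order = m

/-- The set of singular points: those at which some chart with nontrivial group is centred. -/
def singularSet (B : Type*) [TopologicalSpace B] [DiffeologicalSpace B] : Set B :=
  {x | ∃ c : OrbifoldChart B, c.center = x ∧ c.order ≠ 1}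

/-- Near the point `z` of the domain of the chart `a`, the map `F` is represented in the charts
`a` and `b` by the local diffeomorphism `h`. -/
def IsLocalRep {X Y : Type*} [TopologicalSpace X] [DiffeologicalSpace X]
    [TopologicalSpace Y] [DiffeologicalSpace Y] (F : X → Y)
    (a : OrbifoldChart X) (b : OrbifoldChart Y) (h : ℂ → ℂ) (z : ℂ) : Prop :=
  (∃ U : Set ℂ, IsOpen U ∧ z ∈ U ∧ U ⊆ ball 0 2 ∧ ContDiffOn ℝ ∞ h U ∧
    ∀ w ∈ U, h w ∈ ball 0 2 ∧ b (h w) = F (a w)) ∧ (fderiv ℝ h z).det ≠ 0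

/-- `h` is near `z` a change of charts from `a` to `b`. -/
def IsTransition {B : Type*} [TopologicalSpace B] [DiffeologicalSpace B]
    (a b : OrbifoldChart B) (h : ℂ → ℂ) (z : ℂ) : Prop :=
  IsLocalRep (id : B → B) a b h z

/-- An orientation of a `2`-orbifold: an oriented atlas of the surface of its regular points. -/
structure OrbifoldOrientation (B : Type*) [TopologicalSpace B] [DiffeologicalSpace B] where
  atlas : Set (OrbifoldChart B)
  order_eq_one : ∀ a ∈ atlas, a.order = 1
  covers : ∀ x ∉ singularSet B, ∃ a ∈ atlas, x ∈ a.image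
  compatible : ∀ a ∈ atlas, ∀ b ∈ atlas, ∀ h z, IsTransition a b h z → 0 < (fderiv ℝ h z).det

/-- An orbifold chart (of any order) is positive if it agrees with the orientation. -/
def OrbifoldOrientation.IsPositive {B : Type*} [TopologicalSpace B] [DiffeologicalSpace B]
    (o : OrbifoldOrientation B) (c : OrbifoldChart B) : Prop :=
  ∀ a ∈ o.atlas, ∀ h z, IsTransition a c h z → 0 < (fderiv ℝ h z).det

/-! ### The tangent bundle and its circle bundle -/

section Tangent

variable (B : Type*) [TopologicalSpace B] [DiffeologicalSpace B]

/-- Tangent vectors in charts: a chart, a point of its domain and a vector of `ℂ = ℝ²`. The set of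
charts is regarded as a discrete index set. -/
abbrev PreTangent : Type _ := Σ _ : OrbifoldChart B, ball (0 : ℂ) 2 × ℂ

variable {B}

/-- Two tangent vectors in charts are identified if the differential of a change of charts
takes the one to the other. -/
def TangentRel (p q : PreTangent B) : Prop :=
  ∃ h : ℂ → ℂ, IsTransition p.1 q.1 h p.2.1 ∧ h p.2.1 = q.2.1 ∧ fderiv ℝ h p.2.1 p.2.2 = q.2.2

variable (B)

/-- The tangent orbibundle `TB`. Over the image of a chart with group `Γ` it is
`(𝔹 × ℝ²)/Γ`, where `Γ` acts by the differentials of the rotations. -/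
def TangentOrbibundle : Type _ := Quot (TangentRel (B := B))

instance : TopologicalSpace (TangentOrbibundle B) :=
  inferInstanceAs (TopologicalSpace (Quot (TangentRel (B := B))))

variable {B}

namespace TangentOrbibundle

/-- The class of the vector `v` at the point `z` of the domain of the chart `c`. -/
def mk (c : OrbifoldChart B) (z : ball (0 : ℂ) 2) (v : ℂ) : TangentOrbibundle B :=
  Quot.mk _ ⟨c, z, v⟩

/-- The projection `TB → B`. -/
def proj : TangentOrbibundle B → B :=
  Quot.lift (fun p => p.1 p.2.1) (by
    rintro p q ⟨h, ⟨⟨U, -, hz, -, -, hU⟩, -⟩, hq, -⟩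
    have := (hU _ hz).2
    rw [hq] at this
    exact this.symm)

/-- The vectors of the zero section. -/
def IsZero : TangentOrbibundle B → Prop :=
  Quot.lift (fun p => p.2.2 = 0) (by
    rintro p q ⟨h, ⟨-, hdet⟩, -, hv⟩
    have hinj : Function.Injective (fderiv ℝ h p.2.1) :=
      (LinearEquiv.ofIsUnitDet (v := Module.finBasis ℝ ℂ) (v' := Module.finBasis ℝ ℂ)
        (f := (fderiv ℝ h p.2.1 : ℂ →ₗ[ℝ] ℂ)) (by
          rw [LinearMap.det_toMatrix]; exact isUnit_iff_ne_zero.2 hdet)).injective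
    refine propext ?_
    rw [← hv]
    exact (map_eq_zero_iff _ hinj).symm)

end TangentOrbibundle

/-- The complement of the zero section in `TB`. -/
abbrev NonzeroTangent (B : Type*) [TopologicalSpace B] [DiffeologicalSpace B] : Type _ :=
  {ξ : TangentOrbibundle B // ¬ ξ.IsZero}

/-- Two nonzero tangent vectors are identified if they differ by a positive factor. -/
def PositiveMultiple (ξ η : NonzeroTangent B) : Prop :=
  ∃ (c : OrbifoldChart B) (z : ball (0 : ℂ) 2) (v : ℂ) (t : ℝ), 0 < t ∧
    ξ.1 = TangentOrbibundle.mk c z v ∧ η.1 = TangentOrbibundle.mk c z (t * v)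

variable (B)

/-- The circle orbibundle `𝕊(TB) = TB^× / ℝ_{>0}`. -/
def SphereTangent : Type _ := Quot (PositiveMultiple (B := B))

instance : TopologicalSpace (SphereTangent B) :=
  inferInstanceAs (TopologicalSpace (Quot (PositiveMultiple (B := B))))

variable {B}

namespace SphereTangent

/-- The projection `𝕊(TB) → B`. -/
def proj : SphereTangent B → B :=
  Quot.lift (fun ξ => ξ.1.proj) (by
    rintro ξ η ⟨c, z, v, t, -, hξ, hη⟩
    rw [hξ, hη]
    rfl)

/-- The direction `v` at the point `z` of the domain of the chart `c`. -/
def ray (c : OrbifoldChart B) (z : ball (0 : ℂ) 2) (v : Circle) : SphereTangent B :=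
  Quot.mk _ ⟨TangentOrbibundle.mk c z v, v.coe_ne_zero⟩

/-- The fibres of `𝕊(TB)` over regular points, parameterised once in the positive direction given
by the orientation. -/
def IsPositiveFibre (o : OrbifoldOrientation B) (s : Circle → SphereTangent B) : Prop :=
  ∃ (c : OrbifoldChart B) (z : ball (0 : ℂ) 2), o.IsPositive c ∧ c z ∉ singularSet B ∧
    ∀ v, s v = ray c z v

end SphereTangent

end Tangent

/-! ### The Euler number -/

section Euler

open CategoryTheory

universe u

/-- The map `H₁(𝕊¹; ℚ) → H₁(X; ℚ)` induced by a loop in `X` on singular homology. As `H₁(𝕊¹; ℚ)`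
is a line spanned by the fundamental class, this map carries the same information as the
homology class of the loop. -/
def loopClass {X : Type u} [TopologicalSpace X] (f : C(Circle, X)) :
    ((AlgebraicTopology.singularHomologyFunctor (ModuleCat.{u} ℚ) 1).obj
      (ModuleCat.of ℚ (ULift.{u} ℚ))).obj (TopCat.of (ULift.{u} Circle)) ⟶
    ((AlgebraicTopology.singularHomologyFunctor (ModuleCat.{u} ℚ) 1).obj
      (ModuleCat.of ℚ (ULift.{u} ℚ))).obj (TopCat.of X) :=
  ((AlgebraicTopology.singularHomologyFunctor (ModuleCat.{u} ℚ) 1).obj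
    (ModuleCat.of ℚ (ULift.{u} ℚ))).map
      (TopCat.ofHom (f.comp ⟨ULift.down, continuous_uliftDown⟩))

variable {B M : Type u} [TopologicalSpace B] [DiffeologicalSpace B] [TopologicalSpace M]

/-- Let `D̄` be the closed disc of the chart `c` and let `σ` be a section of `ζ : M → B` over `∂D̄`.
The number `q` is the coefficient in `σ|_{∂D̄} = q s` in `H₁(ζ⁻¹(D̄); ℚ)`, where `s` is a fibre over
a regular point. The loop `σ|_{∂D̄}` is parameterised by
`∂D̄ ≅ 𝕊¹/Γ ≅ 𝕊¹`, `c(w) ↦ [w] ↦ w ^ m`, with `m` the order of `c`. -/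
def IsLocalIndex (ζ : M → B) (IsFibre : (Circle → M) → Prop) (c : OrbifoldChart B)
    (σ : B → M) (q : ℚ) : Prop :=
  ∃ ℓ s : C(Circle, ζ ⁻¹' c.closedDisc),
    (∀ w : Circle, (ℓ (w ^ c.order) : M) = σ (c w)) ∧
    IsFibre (fun w => (s w : M)) ∧
    loopClass ℓ = q • loopClass s

/-- The choices entering the Euler number of a circle orbibundle `ζ : M → B`, where `IsFibre` singles
out the positively parameterised fibres over regular points: positively oriented smooth discs around
a regular point and around each of the singular points, with disjoint closures; a
section `σ` over the complement `B'` of the open discs; and its coefficients along the boundaries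
of the discs. -/
structure EulerData (o : OrbifoldOrientation B) (ζ : M → B)
    (IsFibre : (Circle → M) → Prop) where
  n : ℕ
  disc : Fin (n + 1) → OrbifoldChart B
  positive : ∀ i, o.IsPositive (disc i)
  regular : (disc 0).center ∉ singularSet B
  singular : range (fun k : Fin n => (disc k.succ).center) = singularSet B
  disjoint : ∀ i j, i ≠ j → Disjoint (disc i).closedDisc (disc j).closedDisc
  σ : B → M
  continuousOn : ContinuousOn σ (⋃ i, (disc i).openDisc)ᶜ
  isSection : ∀ x ∈ (⋃ i, (disc i).openDisc)ᶜ, ζ (σ x) = x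
  index : Fin (n + 1) → ℚ
  isLocalIndex : ∀ i, IsLocalIndex ζ IsFibre (disc i) σ (index i)

/-- The Euler number of the circle orbibundle `ζ : M → B` is well defined and equal to `e`, i.e.
`σ|_{∂B'} = - ∑ σ|_{∂Dᵢ} = - e s` for all choices, and choices exist. -/
def HasEulerNumber (o : OrbifoldOrientation B) (ζ : M → B) (IsFibre : (Circle → M) → Prop)
    (e : ℚ) : Prop :=
  Nonempty (EulerData o ζ IsFibre) ∧ ∀ d : EulerData o ζ IsFibre, ∑ i, d.index i = e

/-- The Euler characteristic of the oriented `2`-orbifold `B`, that is the Euler number of its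
tangent orbibundle `TB` (equivalently of `𝕊(TB)`), is well defined and equal to `e`. -/
def HasEulerCharacteristic (o : OrbifoldOrientation B) (e : ℚ) : Prop :=
  HasEulerNumber o (SphereTangent.proj (B := B)) (SphereTangent.IsPositiveFibre o) e

end Euler

/-! ### The underlying smooth surface -/

/-- The oriented surface `S` is obtained from the oriented `2`-orbifold `B` by removing discs around
the singular points and gluing regular ones: there are disjoint positive charts `c k` centred at
the singular points of `B`, disjoint positive regular charts `d k` on `S`, and
an orientation preserving diffeomorphism `F` (with inverse `G`) between the complements of the
closed discs of these charts. The collars `{1 < |z| < 2}/Γ` and `{1 < |w| < 2}` are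
glued by the diffeomorphism `[z] ↦ w = z ^ m / |z| ^ (m - 1)`, with `m` the order of `c k`. -/
def IsUnderlyingSurface {B S : Type*} [TopologicalSpace B] [DiffeologicalSpace B]
    [TopologicalSpace S] [DiffeologicalSpace S]
    (oB : OrbifoldOrientation B) (oS : OrbifoldOrientation S) : Prop :=
  ∃ (n : ℕ) (c : Fin n → OrbifoldChart B) (d : Fin n → OrbifoldChart S) (F : B → S) (G : S → B),
    (∀ k, oB.IsPositive (c k)) ∧
    (∀ k, oS.IsPositive (d k) ∧ (d k).order = 1) ∧
    range (fun k => (c k).center) = singularSet B ∧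
    (∀ i j, i ≠ j → Disjoint (c i).image (c j).image) ∧
    (∀ i j, i ≠ j → Disjoint (d i).image (d j).image) ∧
    MapsTo F (⋃ k, (c k).closedDisc)ᶜ (⋃ k, (d k).closedDisc)ᶜ ∧
    MapsTo G (⋃ k, (d k).closedDisc)ᶜ (⋃ k, (c k).closedDisc)ᶜ ∧
    InvOn G F (⋃ k, (c k).closedDisc)ᶜ (⋃ k, (d k).closedDisc)ᶜ ∧
    DSmoothOn F (⋃ k, (c k).closedDisc)ᶜ ∧
    DSmoothOn G (⋃ k, (d k).closedDisc)ᶜ ∧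
    (∀ a ∈ oB.atlas, ∀ b ∈ oS.atlas, ∀ h z, a z ∉ ⋃ k, (c k).closedDisc →
      IsLocalRep F a b h z → 0 < (fderiv ℝ h z).det) ∧
    (∀ k (z : ℂ), 1 < ‖z‖ → ‖z‖ < 2 →
      F (c k z) = d k (z ^ (c k).order / (‖z‖ : ℂ) ^ ((c k).order - 1)))

end

/-! Everything rests on a Poincaré–Hopf theorem for orbifolds. Let σ be a section of 𝕊(TB) with
finitely many singularities, the cone points being counted among them. In a positive chart of order
m centred at p it is given by a circle-valued function v on a punctured disc; if v winds K times
around 0, the index of σ at p is K/m (`HasIdx`, independent of the chart by `HasIdx.unique`). The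
sum of the indices is the Euler characteristic (`hasEulerCharacteristic_sum_idx`). This has three
ingredients.

Homology: the preimage of a closed disc contracts radially to the fibre 𝕊¹/Γ over its centre, in
which the section along the boundary has degree K and a regular fibre has degree m. So the
coefficient q in the definition is K/m (`index_eq_of_isLocalIndex`, `isLocalIndex_of_degree`). For
this, degrees are read off from H₁ of the circle (`rationalH1_map_of_degree`,
`rationalH1_circle_id_ne_zero`).

Independence: a change of the section inside one disc preserves the sum of the indices, because the
total winding is seen near the boundary (`sum_idx_eq_of_disc`). On a compact orbifold any two
sections are joined by changes in finitely many discs (`sum_idx_eq`).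

Existence: a section extends over a regular disc up to finitely many punctures, by smooth
approximation and Sard's theorem, and connectedness allows the regular singularities to be gathered
in one point (`exists_section`).

For the comparison, take σ on B singular only at a regular point x₀ and at the cone points, push it
to S by the gluing diffeomorphism and extend it over the glued discs constantly along rays. The
index at x₀ is unchanged. In polar coordinates the gluing map is r w ↦ r w^m, with differential
diag(1, m) in the polar frames, which is homotopic to the identity on directions. Relative to the
radial direction, v winds K - 1 times; this number survives, and the radial direction of the target
turns m times as w goes around once. If L is the new index, then m L = m + K - 1, that is L = K/m +
1 - 1/m (`IsDiffeoOn.hasIdx_glued`). Summing over the cone points gives the formula. -/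

noncomputable section

set_option linter.unusedSectionVars false

section

/-! ### Circle-valued functions up to exponentials -/

/-- The direction `z / |z|` of a complex number (with `dir 0 = 1`). -/
def dir (z : ℂ) : Circle := Circle.exp z.arg

theorem norm_mul_dir (z : ℂ) : (‖z‖ : ℂ) * (dir z : ℂ) = z := by
  simp [dir, Circle.coe_exp, Complex.norm_mul_exp_arg_mul_I]

theorem coe_dir {z : ℂ} (hz : z ≠ 0) : (dir z : ℂ) = z / ‖z‖ := by
  rw [eq_div_iff (by simpa using hz), mul_comm, norm_mul_dir]

theorem dir_ofReal_mul {t : ℝ} (ht : 0 < t) (z : ℂ) : dir (t * z) = dir z := by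
  simp [dir, Complex.arg_real_mul z ht]

theorem dir_coe (v : Circle) : dir (v : ℂ) = v := by
  simp [dir]

theorem dir_ofReal_mul_coe {t : ℝ} (ht : 0 < t) (v : Circle) : dir (t * (v : ℂ)) = v := by
  rw [dir_ofReal_mul ht, dir_coe]

theorem dir_mul {z w : ℂ} (hz : z ≠ 0) (hw : w ≠ 0) : dir (z * w) = dir z * dir w := by
  ext
  rw [Circle.coe_mul, coe_dir hz, coe_dir hw, coe_dir (mul_ne_zero hz hw), norm_mul]
  push_cast
  field_simp

theorem dir_coe_mul (v : Circle) (z : ℂ) (hz : z ≠ 0) : dir (v * z) = v * dir z := by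
  rw [dir_mul v.coe_ne_zero hz, dir_coe]

theorem continuousAt_dir {z : ℂ} (hz : z ≠ 0) : ContinuousAt dir z := by
  refine (Topology.IsInducing.continuousAt_iff (g := ((↑) : Circle → ℂ)) ⟨rfl⟩).2 ?_
  have : ContinuousAt (fun w : ℂ => w / (‖w‖ : ℂ)) z := by
    refine continuousAt_id.div ?_ (by simpa using hz)
    exact (Complex.continuous_ofReal.comp continuous_norm).continuousAt
  refine this.congr ?_
  filter_upwards [isOpen_ne.mem_nhds hz] with w hw
  exact (coe_dir hw).symm

theorem continuousOn_dir : ContinuousOn dir {0}ᶜ :=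
  fun _ hz => (continuousAt_dir hz).continuousWithinAt

/-- `F` has a continuous logarithm on `s`. -/
def ExpOn {X : Type*} [TopologicalSpace X] (F : X → Circle) (s : Set X) : Prop :=
  ∃ g : X → ℝ, ContinuousOn g s ∧ ∀ x ∈ s, F x = Circle.exp (g x)

namespace ExpOn

variable {X Y : Type*} [TopologicalSpace X] [TopologicalSpace Y] {F G : X → Circle} {s t : Set X}

theorem mono (h : ExpOn F s) (hts : t ⊆ s) : ExpOn F t := by
  obtain ⟨g, hg, h⟩ := h
  exact ⟨g, hg.mono hts, fun x hx => h x (hts hx)⟩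

theorem congr (h : ExpOn F s) (hG : ∀ x ∈ s, G x = F x) : ExpOn G s := by
  obtain ⟨g, hg, h⟩ := h
  exact ⟨g, hg, fun x hx => (hG x hx).trans (h x hx)⟩

theorem mul (hF : ExpOn F s) (hG : ExpOn G s) : ExpOn (fun x => F x * G x) s := by
  obtain ⟨f, hf, hF⟩ := hF
  obtain ⟨g, hg, hG⟩ := hG
  exact ⟨fun x => f x + g x, hf.add hg, fun x hx => by
    beta_reduce
    rw [hF x hx, hG x hx, Circle.exp_add]⟩

theorem inv (hF : ExpOn F s) : ExpOn (fun x => (F x)⁻¹) s := by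
  obtain ⟨f, hf, hF⟩ := hF
  exact ⟨fun x => -f x, hf.neg, fun x hx => by
    beta_reduce
    rw [hF x hx, Circle.exp_neg]⟩

theorem zpow (hF : ExpOn F s) (k : ℤ) : ExpOn (fun x => F x ^ k) s := by
  obtain ⟨f, hf, hF⟩ := hF
  exact ⟨fun x => k * f x, continuousOn_const.mul hf, fun x hx => by
    beta_reduce
    rw [hF x hx, ← Circle.exp_zsmul, zsmul_eq_mul]⟩

theorem const (c : Circle) (s : Set X) : ExpOn (fun _ : X => c) s :=
  ⟨fun _ => (c : ℂ).arg, continuousOn_const, fun _ _ => (Circle.exp_arg c).symm⟩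

theorem prod {ι : Type*} {F : ι → X → Circle} (Q : Finset ι) (h : ∀ i ∈ Q, ExpOn (F i) s) :
    ExpOn (fun x => ∏ i ∈ Q, F i x) s := by
  classical
  induction Q using Finset.induction_on with
  | empty => simpa using const 1 s
  | insert a Q ha ih =>
    simp only [Finset.prod_insert ha]
    exact (h a (Finset.mem_insert_self a Q)).mul
      (ih fun i hi => h i (Finset.mem_insert_of_mem hi))

theorem comp {u : Set Y} {f : Y → X} (h : ExpOn F s) (hf : ContinuousOn f u)
    (hm : MapsTo f u s) : ExpOn (fun y => F (f y)) u := by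
  obtain ⟨g, hg, h⟩ := h
  exact ⟨fun y => g (f y), hg.comp hf hm, fun y hy => h _ (hm hy)⟩

theorem continuousOn (h : ExpOn F s) : ContinuousOn F s := by
  obtain ⟨g, hg, h⟩ := h
  exact (Circle.exp.continuous.comp_continuousOn hg).congr h

end ExpOn

theorem arg_continuousOn_re_pos {X : Type*} [TopologicalSpace X] {f : X → ℂ} {s : Set X}
    (hf : ContinuousOn f s) (h : ∀ x ∈ s, 0 < (f x).re) :
    ContinuousOn (fun x => (f x).arg) s := fun x hx =>
  (Complex.continuousAt_arg (Or.inl (h x hx))).comp_continuousWithinAt (hf x hx)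

/-- The quotient `f / a` stays at distance less than 1 from 1, hence in the right half-plane, where
`Complex.arg` is continuous. -/
theorem expOn_dir_of_near {X : Type*} [TopologicalSpace X] {f : X → ℂ} {s : Set X}
    (hf : ContinuousOn f s) (a : ℂ) (h : ∀ x ∈ s, ‖f x - a‖ < ‖a‖) :
    ExpOn (fun x => dir (f x)) s := by
  rcases s.eq_empty_or_nonempty with rfl | ⟨x₀, hx₀⟩
  · exact ⟨fun _ => 0, continuousOn_empty _, fun x hx => hx.elim⟩
  have ha : a ≠ 0 := fun h0 => by
    have := h x₀ hx₀
    rw [h0, norm_zero] at this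
    exact (norm_nonneg _).not_gt this
  have hre : ∀ x ∈ s, 0 < (f x / a).re := by
    intro x hx
    have h1 : ‖f x / a - 1‖ < 1 := by
      rw [div_sub_one ha, norm_div, div_lt_one (norm_pos_iff.2 ha)]
      exact h x hx
    have h2 := (abs_le.1 (Complex.abs_re_le_norm (f x / a - 1))).1
    simp only [Complex.sub_re, Complex.one_re] at h2
    linarith
  refine ⟨fun x => a.arg + (f x / a).arg, continuousOn_const.add
    (arg_continuousOn_re_pos (hf.div_const a) hre), fun x hx => ?_⟩
  have h0 : f x / a ≠ 0 := fun h0 => by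
    have := hre x hx
    rw [h0] at this
    simp at this
  rw [Circle.exp_add]
  change _ = dir a * dir (f x / a)
  rw [← dir_mul ha h0, mul_div_cancel₀ _ ha]

/-- The exponential ℝ → 𝕊¹ is a covering map, and a nonempty convex open set is contractible and
locally path connected, so maps to the circle lift. -/
theorem expOn_of_convex {E : Type*} [NormedAddCommGroup E] [NormedSpace ℝ E] {s : Set E}
    (hs : Convex ℝ s) (ho : IsOpen s) {F : E → Circle} (hF : ContinuousOn F s) : ExpOn F s := by
  classical
  rcases s.eq_empty_or_nonempty with rfl | ⟨x₀, hx₀⟩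
  · exact ⟨fun _ => 0, continuousOn_empty _, fun x hx => hx.elim⟩
  have := hs.contractibleSpace ⟨x₀, hx₀⟩
  have : LocallyPathConnectedSpace s := ho.locallyPathConnectedSpace
  obtain ⟨g, ⟨-, hg⟩, -⟩ := Circle.isCoveringMap_exp.existsUnique_continuousMap_lifts
    (⟨s.domRestrict F, hF.domRestrict⟩ : C(s, Circle)) ⟨x₀, hx₀⟩ ((F x₀ : ℂ).arg) (Circle.exp_arg (F x₀))
  refine ⟨fun x => if hx : x ∈ s then g ⟨x, hx⟩ else 0, ?_, fun x hx => ?_⟩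
  · rw [continuousOn_iff_continuous_domRestrict]
    refine g.continuous.congr fun x => ?_
    simp
  · have := congrFun hg ⟨x, hx⟩
    simp only [hx, dif_pos]
    exact this.symm

theorem expOn_ball_of_continuousOn {p : ℂ} {r : ℝ} {F : ℂ → Circle}
    (hF : ContinuousOn F (ball p r)) : ExpOn F (ball p r) :=
  expOn_of_convex (convex_ball p r) isOpen_ball hF

theorem IsPreconnected.exists_int_of_exp_eq_one {X : Type*} [TopologicalSpace X] {s : Set X}
    (hs : IsPreconnected s) {g : X → ℝ} (hg : ContinuousOn g s)
    (h : ∀ x ∈ s, Circle.exp (g x) = 1) : ∃ k : ℤ, ∀ x ∈ s, g x = 2 * Real.pi * k := by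
  rcases s.eq_empty_or_nonempty with rfl | ⟨x₀, hx₀⟩
  · exact ⟨0, fun x hx => hx.elim⟩
  have hk : ∀ x ∈ s, ∃ k : ℤ, g x = 2 * Real.pi * k := by
    intro x hx
    obtain ⟨k, hk⟩ := Circle.exp_eq_one.1 (h x hx)
    exact ⟨k, by rw [hk]; ring⟩
  obtain ⟨k₀, hk₀⟩ := hk x₀ hx₀
  refine ⟨k₀, fun x hx => ?_⟩
  have hc : ContinuousOn (fun x => g x / (2 * Real.pi)) s := hg.div_const _
  have hm : MapsTo (fun x => g x / (2 * Real.pi)) s (range ((↑) : ℤ → ℝ)) := by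
    intro y hy
    obtain ⟨k, hk⟩ := hk y hy
    exact ⟨k, by simp only [hk]; field_simp⟩
  have hd : DiscreteTopology (range ((↑) : ℤ → ℝ)) :=
    Int.isClosedEmbedding_coe_real.isEmbedding.toHomeomorph.symm.isEmbedding.discreteTopology
  have := hs.constant_of_mapsTo ⟨hd⟩ hc hm hx hx₀
  rw [← hk₀]
  have hpi := Real.pi_pos
  field_simp at this
  exact this

/-- The exponent `K` in `dir z ^ K = exp (i g)` on a circle vanishes. -/
theorem eq_zero_of_expOn_sphere {r : ℝ} (hr : 0 < r) {K : ℤ}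
    (h : ExpOn (fun z => dir z ^ K) (sphere 0 r)) : K = 0 := by
  obtain ⟨g, hg, h⟩ := h
  let γ : ℝ → ℂ := fun t => r * (Circle.exp t : ℂ)
  have hγ : Continuous γ := continuous_const.mul (continuous_subtype_val.comp Circle.exp.continuous)
  have hm : ∀ t, γ t ∈ sphere (0 : ℂ) r := fun t => by simp [γ, abs_of_pos hr]
  -- The difference of two logarithms of the same function on the line has values in 2πℤ and is
  -- constant, yet over one turn it changes by -2πK.
  have hc : Continuous (fun t => g (γ t) - K * t) :=
    (hg.comp_continuous hγ hm).sub (continuous_const.mul continuous_id)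
  have h1 : ∀ t, Circle.exp (g (γ t) - K * t) = 1 := fun t => by
    rw [Circle.exp_sub, ← h _ (hm t)]
    simp only [γ]
    rw [dir_ofReal_mul_coe hr, ← zsmul_eq_mul, Circle.exp_zsmul,
      div_self']
  obtain ⟨k, hk⟩ := isPreconnected_univ.exists_int_of_exp_eq_one hc.continuousOn (fun t _ => h1 t)
  have h0 := hk 0 trivial
  have h2 := hk (2 * Real.pi) trivial
  have : γ (2 * Real.pi) = γ 0 := by simp [γ]
  rw [this, ← h0] at h2
  have hpi := Real.pi_pos
  have : (K : ℝ) * (2 * Real.pi) = 0 := by linarith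
  rcases mul_eq_zero.1 this with h | h
  · exact_mod_cast h
  · linarith

/-- A circle-valued function on a punctured disc is a power of `dir` up to an exponential. -/
theorem exists_expOn_punctured {R : ℝ} (hR : 0 < R) {F : ℂ → Circle}
    (hF : ContinuousOn F (ball 0 R \ {0})) :
    ∃ K : ℤ, ExpOn (fun z => F z * dir z ^ (-K)) (ball 0 R \ {0}) := by
  -- Under `Complex.exp` this half-plane is the universal cover of the punctured disc, so `F` has a
  -- logarithm `G` on it.
  let H : Set ℂ := {ζ | ζ.re < Real.log R}
  have hHc : Convex ℝ H := convex_halfSpace_re_lt _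
  have hHo : IsOpen H := isOpen_lt Complex.continuous_re continuous_const
  have hexp : ∀ ζ ∈ H, Complex.exp ζ ∈ ball (0 : ℂ) R \ {0} := by
    intro ζ hζ
    refine ⟨?_, Complex.exp_ne_zero ζ⟩
    rw [mem_ball_zero_iff, Complex.norm_exp, ← Real.lt_log_iff_exp_lt hR]
    exact hζ
  obtain ⟨G, hG, hFG⟩ := expOn_of_convex hHc hHo
    (hF.comp Complex.continuous_exp.continuousOn hexp)
  have hshift : ∀ n : ℤ, ∀ ζ ∈ H, ζ + n * (2 * Real.pi * Complex.I) ∈ H := by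
    intro n ζ hζ
    simpa [H] using hζ
  have hHs : ∀ ζ ∈ H, ζ + 2 * Real.pi * Complex.I ∈ H := fun ζ hζ => by simpa using hshift 1 ζ hζ
  have hc : ContinuousOn (fun ζ => G (ζ + 2 * Real.pi * Complex.I) - G ζ) H :=
    (hG.comp (by fun_prop) hHs).sub hG
  -- `K` is the monodromy of `G` under the deck transformation by 2πi. Subtracting `K * ζ.im` gives
  -- a periodic function `L`, which descends to the punctured disc.
  obtain ⟨K, hK⟩ := hHc.isPreconnected.exists_int_of_exp_eq_one hc (fun ζ hζ => by
    have h1 := hFG _ (hHs ζ hζ)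
    have h2 := hFG ζ hζ
    simp only [Function.comp_apply, Complex.exp_add, Complex.exp_two_pi_mul_I, mul_one] at h1 h2
    rw [Circle.exp_sub, ← h1, ← h2, div_self'])
  let L : ℂ → ℝ := fun ζ => G ζ - K * ζ.im
  have hL : ContinuousOn L H := hG.sub (by fun_prop)
  have hper1 : ∀ ζ ∈ H, L (ζ + 2 * Real.pi * Complex.I) = L ζ := by
    intro ζ hζ
    have := hK ζ hζ
    simp only [L, Complex.add_im, Complex.mul_im]
    simp
    linarith
  have hpern : ∀ n : ℕ, ∀ ζ ∈ H, L (ζ + n * (2 * Real.pi * Complex.I)) = L ζ := by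
    intro n
    induction n with
    | zero => intro ζ _; simp
    | succ n ih =>
      intro ζ hζ
      have h1 := hper1 (ζ + n * (2 * Real.pi * Complex.I)) (by exact_mod_cast hshift n ζ hζ)
      rw [← ih ζ hζ, ← h1]
      congr 1
      push_cast
      ring
  have hper : ∀ n : ℤ, ∀ ζ ∈ H, L (ζ + n * (2 * Real.pi * Complex.I)) = L ζ := by
    intro n ζ hζ
    obtain ⟨k, rfl | rfl⟩ := n.eq_nat_or_neg
    · simpa using hpern k ζ hζ
    · rw [← hpern k _ (hshift (-k) ζ hζ)]
      congr 1
      push_cast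
      ring
  have hlog : ∀ z ∈ ball (0 : ℂ) R \ {0}, Complex.log z ∈ H := by
    rintro z ⟨hz, hz0⟩
    change (Complex.log z).re < _
    rw [Complex.log_re]
    exact Real.log_lt_log (norm_pos_iff.2 hz0) (by simpa using hz)
  refine ⟨K, fun z => L (Complex.log z), ?_, fun z hz => ?_⟩
  · rintro z₀ ⟨hz₀, hz₀0⟩
    have hz₀0 : z₀ ≠ 0 := hz₀0
    -- `Complex.log` jumps across its slit. Near `z₀` the branch log(z/z₀) + log z₀ is continuous
    -- and differs from it by a multiple of 2πi, which the periodic `L` does not see.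
    have hcont : ContinuousWithinAt (fun z => L (Complex.log (z / z₀) + Complex.log z₀))
        (ball 0 R \ {0}) z₀ := by
      refine ContinuousAt.continuousWithinAt ?_
      refine ContinuousAt.comp (g := L) (f := fun z => Complex.log (z / z₀) + Complex.log z₀) ?_ ?_
      · refine hL.continuousAt (hHo.mem_nhds ?_)
        simpa [div_self hz₀0] using hlog z₀ ⟨hz₀, hz₀0⟩
      · refine ContinuousAt.add ?_ continuousAt_const
        refine ContinuousAt.clog (by fun_prop) ?_
        rw [div_self hz₀0]
        exact Complex.one_mem_slitPlane
    refine hcont.congr (fun z hz => ?_) ?_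
    · have hz0 : z ≠ 0 := hz.2
      have : Complex.exp (Complex.log z) = Complex.exp (Complex.log (z / z₀) + Complex.log z₀) := by
        rw [Complex.exp_add, Complex.exp_log hz0, Complex.exp_log (div_ne_zero hz0 hz₀0),
          Complex.exp_log hz₀0, div_mul_cancel₀ _ hz₀0]
      obtain ⟨n, hn⟩ := Complex.exp_eq_exp_iff_exists_int.1 this.symm
      rw [hn, hper n _ (hlog z hz)]
    · simp [div_self hz₀0]
  · have := hFG _ (hlog z hz)
    rw [Function.comp_apply, Complex.exp_log hz.2] at this
    beta_reduce
    rw [this]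
    simp only [L, Circle.exp_sub, Complex.log_im, dir, zpow_neg]
    rw [div_eq_mul_inv, ← zsmul_eq_mul, Circle.exp_zsmul]

/-- `F` winds `K` times around the point `p`. -/
def HasDegAt (F : ℂ → Circle) (p : ℂ) (K : ℤ) : Prop :=
  ∃ ε > 0, ExpOn (fun z => F z * dir (z - p) ^ (-K)) (ball p ε \ {p})

theorem sphere_subset_punctured {r ε : ℝ} (hr : 0 < r) (h : r < ε) :
    sphere (0 : ℂ) r ⊆ ball 0 ε \ {0} := by
  intro z hz
  rw [mem_sphere_zero_iff_norm] at hz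
  refine ⟨by simpa [hz] using h, ?_⟩
  rintro rfl
  simp at hz
  exact hr.ne hz

theorem expOn_dir_zpow_eq_zero {ε : ℝ} (hε : 0 < ε) {p : ℂ} {K : ℤ}
    (h : ExpOn (fun z => dir (z - p) ^ K) (ball p ε \ {p})) : K = 0 := by
  refine eq_zero_of_expOn_sphere (r := ε / 2) (by positivity) ?_
  have := h.comp (f := fun z => z + p) (u := ball 0 ε \ {0}) (by fun_prop) (by
    rintro z ⟨hz, hz0⟩
    refine ⟨by simpa using hz, ?_⟩
    simpa using hz0)
  simp only [add_sub_cancel_right] at this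
  exact this.mono (sphere_subset_punctured (by positivity) (by linarith))

namespace HasDegAt

variable {F G : ℂ → Circle} {p : ℂ} {K L : ℤ}

theorem unique (hK : HasDegAt F p K) (hL : HasDegAt F p L) : K = L := by
  obtain ⟨ε, hε, h⟩ := hK
  obtain ⟨δ, hδ, h'⟩ := hL
  have hs1 : ball p (min ε δ) \ {p} ⊆ ball p ε \ {p} :=
    sdiff_subset_sdiff_left (ball_subset_ball (min_le_left _ _))
  have hs2 : ball p (min ε δ) \ {p} ⊆ ball p δ \ {p} :=
    sdiff_subset_sdiff_left (ball_subset_ball (min_le_right _ _))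
  have := expOn_dir_zpow_eq_zero (K := K - L) (lt_min hε hδ)
    (((h'.mono hs2).mul (h.mono hs1).inv).congr fun z _ => by
      rw [zpow_sub, zpow_neg, zpow_neg, mul_inv, inv_inv, mul_mul_mul_comm, mul_inv_cancel, one_mul,
        mul_comm])
  linarith

end HasDegAt

theorem exists_hasDegAt {F : ℂ → Circle} {p : ℂ} {ε : ℝ} (hε : 0 < ε)
    (hF : ContinuousOn F (ball p ε \ {p})) :
    ∃ K : ℤ, ExpOn (fun z => F z * dir (z - p) ^ (-K)) (ball p ε \ {p}) := by
  obtain ⟨K, hK⟩ := exists_expOn_punctured hε (F := fun z => F (z + p))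
    (hF.comp (by fun_prop) (by
      rintro z ⟨hz, hz0⟩
      exact ⟨by simpa using hz, by simpa using hz0⟩))
  refine ⟨K, (hK.comp (f := fun z => z - p) (u := ball p ε \ {p}) (by fun_prop) ?_).congr ?_⟩
  · rintro z ⟨hz, hz0⟩
    exact ⟨by simpa [dist_eq_norm] using hz, by simpa [sub_eq_zero] using hz0⟩
  · intro z _
    simp

theorem hasDegAt_zero_of_continuousOn {F : ℂ → Circle} {p : ℂ} {ε : ℝ} (hε : 0 < ε)
    (hF : ContinuousOn F (ball p ε)) : HasDegAt F p 0 :=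
  ⟨ε, hε, ((expOn_ball_of_continuousOn hF).mono sdiff_subset).congr (by simp)⟩

/-- A continuous map from the circle to itself is a power up to an exponential. -/
theorem Circle.exists_degree (f : Circle → Circle) (hf : Continuous f) :
    ∃ K : ℤ, ∃ g : Circle → ℝ, Continuous g ∧ ∀ w, f w = w ^ K * Circle.exp (g w) := by
  -- The map is extended to a punctured disc so as to be constant along rays.
  obtain ⟨K, g, hg, h⟩ := exists_expOn_punctured (R := 2) (by norm_num) (F := fun z => f (dir z))
    (hf.comp_continuousOn (continuousOn_dir.mono fun z hz => hz.2))
  have hm : ∀ w : Circle, (w : ℂ) ∈ ball (0 : ℂ) 2 \ {0} := fun w => ⟨by simp [Circle.norm_coe], w.coe_ne_zero⟩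
  refine ⟨K, fun w => g w, hg.comp_continuous continuous_subtype_val hm, fun w => ?_⟩
  have := h w (hm w)
  simp only [dir_coe] at this
  rw [← this, mul_comm (f w), zpow_neg, mul_inv_cancel_left]

theorem Circle.degree_eq_zero {K : ℤ} {g : Circle → ℝ} (hg : Continuous g)
    (h : ∀ w : Circle, w ^ K = Circle.exp (g w)) : K = 0 := by
  refine eq_zero_of_expOn_sphere (r := 1) one_pos ⟨fun z => g (dir z), ?_, fun z _ => h (dir z)⟩
  exact hg.comp_continuousOn (continuousOn_dir.mono fun z hz => by
    rintro rfl
    simp at hz)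

/-- A circle-valued function on a disc with finitely many punctures is a product of powers of the
directions from the punctures, up to an exponential. -/
theorem exists_expOn_finite_punctures {R : ℝ} (Q : Finset ℂ) : ∀ {F : ℂ → Circle},
    ContinuousOn F (ball 0 R \ Q) → ∃ d : ℂ → ℤ,
      ExpOn (fun w => F w * ∏ q ∈ Q, dir (w - q) ^ (-d q)) (ball 0 R \ Q) := by
  classical
  induction Q using Finset.induction_on with
  | empty =>
    intro F hF
    refine ⟨0, ?_⟩
    simp only [Finset.coe_empty, sdiff_empty] at hF ⊢
    simpa using expOn_ball_of_continuousOn hF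
  | insert q Q hq ih =>
    intro F hF
    by_cases hqR : q ∈ ball (0 : ℂ) R
    swap
    · have hs : ball (0 : ℂ) R \ ↑(insert q Q) = ball 0 R \ ↑Q := by
        ext z
        simp only [Finset.coe_insert, mem_sdiff, mem_insert_iff, not_or]
        constructor
        · rintro ⟨h1, -, h2⟩
          exact ⟨h1, h2⟩
        · rintro ⟨h1, h2⟩
          exact ⟨h1, by rintro rfl; exact hqR h1, h2⟩
      rw [hs] at hF ⊢
      obtain ⟨d, hd⟩ := ih hF
      -- A point outside of the disc is no puncture; the exponent 0 makes its factor trivial.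
      refine ⟨Function.update d q 0, hd.congr fun z _ => ?_⟩
      rw [Finset.prod_insert hq]
      simp only [Function.update_self, neg_zero, zpow_zero, one_mul]
      congr 1
      refine Finset.prod_congr rfl fun i hi => ?_
      rw [Function.update_of_ne (by rintro rfl; exact hq hi)]
    have ho : IsOpen (ball (0 : ℂ) R \ ↑Q) := isOpen_ball.sdiff Q.finite_toSet.isClosed
    obtain ⟨ε, hε, hεs⟩ := Metric.isOpen_iff.1 ho q ⟨hqR, by simpa using hq⟩
    have hsub : ball q ε \ {q} ⊆ ball 0 R \ ↑(insert q Q) := by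
      rintro z ⟨hz, hzq⟩
      have := hεs hz
      refine ⟨this.1, ?_⟩
      simp only [Finset.coe_insert, mem_insert_iff, not_or]
      exact ⟨hzq, this.2⟩
    obtain ⟨K, g₀, hg₀, hF₀⟩ := exists_hasDegAt hε (hF.mono hsub)
    -- The cutoff is 1 within ε/2 of `q` and 0 beyond 3ε/4. Dividing `F` by dir(z - q)^K exp(φ g₀)
    -- makes it constant near `q`, which removes this puncture, and changes the winding at no other
    -- one.
    let φ : ℂ → ℝ := fun z => max 0 (min 1 (3 - 4 * ‖z - q‖ / ε))
    have hφ : Continuous φ := by fun_prop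
    let g₁ : ℂ → ℝ := fun z => φ z * g₀ z
    have hg₁ : ∀ z ≠ q, ContinuousAt g₁ z := by
      intro z hz
      by_cases hzε : ‖z - q‖ < ε
      · refine hφ.continuousAt.mul (hg₀.continuousAt ?_)
        exact (isOpen_ball.sdiff isClosed_singleton).mem_nhds
          ⟨by simpa [dist_eq_norm] using hzε, hz⟩
      · have : ∀ᶠ w in nhds z, g₁ w = 0 := by
          have ho : IsOpen {w : ℂ | 3 * ε / 4 < ‖w - q‖} :=
            isOpen_lt continuous_const (by fun_prop)
          filter_upwards [ho.mem_nhds (show 3 * ε / 4 < ‖z - q‖ by linarith [not_lt.1 hzε])] with w hw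
          have hw' : 3 - 4 * ‖w - q‖ / ε ≤ 0 := by
            rw [sub_nonpos, le_div_iff₀ hε]
            have : 3 * ε / 4 < ‖w - q‖ := hw
            linarith
          have : φ w = 0 := by
            simp only [φ]
            rw [min_eq_right (by linarith), max_eq_left hw']
          simp [g₁, this]
        exact (continuousAt_const (y := (0 : ℝ))).congr (this.mono fun w hw => hw.symm)
    let F₁ : ℂ → Circle := fun z =>
      if z = q then 1 else F z * dir (z - q) ^ (-K) * Circle.exp (-g₁ z)
    have hF₁ : ContinuousOn F₁ (ball 0 R \ ↑Q) := by
      intro z hz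
      refine ContinuousAt.continuousWithinAt ?_
      by_cases hzq : z = q
      · subst hzq
        have : ∀ᶠ w in nhds z, F₁ w = 1 := by
          filter_upwards [ball_mem_nhds z (half_pos hε)] with w hw
          by_cases hwz : w = z
          · simp [F₁, hwz]
          · have hw1 : ‖w - z‖ < ε / 2 := by simpa [dist_eq_norm] using hw
            have h1 := hF₀ w ⟨ball_subset_ball (by linarith) hw, hwz⟩
            have hφ1 : φ w = 1 := by
              simp only [φ]
              have : 1 ≤ 3 - 4 * ‖w - z‖ / ε := by
                have : 4 * ‖w - z‖ / ε ≤ 2 := by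
                  rw [div_le_iff₀ hε]
                  linarith
                linarith
              rw [min_eq_left this, max_eq_right zero_le_one]
            simp only [F₁, hwz, if_false, g₁, hφ1, one_mul]
            simp only [h1]
            rw [Circle.exp_neg, mul_inv_cancel]
        exact (continuousAt_const (y := (1 : Circle))).congr (this.mono fun w hw => hw.symm)
      · have hzm : z ∈ ball (0 : ℂ) R \ ↑(insert q Q) := by
          refine ⟨hz.1, ?_⟩
          simp only [Finset.coe_insert, mem_insert_iff, not_or]
          exact ⟨hzq, hz.2⟩
        have hFz : ContinuousAt F z := hF.continuousAt
          ((isOpen_ball.sdiff (insert q Q).finite_toSet.isClosed).mem_nhds hzm)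
        have hd : ContinuousAt (fun z => dir (z - q)) z :=
          ContinuousAt.comp (g := dir) (f := fun z => z - q)
            (continuousAt_dir (sub_ne_zero.2 hzq)) (by fun_prop)
        have : ContinuousAt (fun z => F z * dir (z - q) ^ (-K) * Circle.exp (-g₁ z)) z :=
          (hFz.mul (hd.zpow (-K))).mul
            (Circle.exp.continuous.continuousAt.comp (hg₁ z hzq).neg)
        refine this.congr ?_
        filter_upwards [isOpen_ne.mem_nhds hzq] with w hw
        have hw : w ≠ q := hw
        simp [F₁, hw]
    obtain ⟨d, hd⟩ := ih hF₁
    refine ⟨Function.update d q K, ?_⟩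
    have hsub2 : ball (0 : ℂ) R \ ↑(insert q Q) ⊆ ball 0 R \ ↑Q :=
      sdiff_subset_sdiff_right (by simp)
    have hg₁E : ExpOn (fun z => Circle.exp (g₁ z)) (ball (0 : ℂ) R \ ↑(insert q Q)) :=
      ⟨g₁, fun z hz => (hg₁ z (by
        rintro rfl
        exact hz.2 (by simp))).continuousWithinAt, fun _ _ => rfl⟩
    refine ((hd.mono hsub2).mul hg₁E).congr fun z hz => ?_
    have hzq : z ≠ q := by
      rintro rfl
      exact hz.2 (by simp)
    rw [Finset.prod_insert hq]
    simp only [Function.update_self, F₁, hzq, if_false]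
    rw [Finset.prod_congr rfl (fun i hi => by
      rw [Function.update_of_ne (a := i) (a' := q) (by rintro rfl; exact hq hi)])]
    rw [Circle.exp_neg]
    apply Circle.ext
    simp only [Circle.coe_mul, Circle.coe_inv]
    field_simp

/-- On a circle that encloses `q` the quotient (z - q)/z = 1 - q/z is at distance less than 1 from
1. Seen from such a circle every puncture winds like the origin. -/
theorem expOn_dir_sub_div_dir {r : ℝ} {q : ℂ} (hq : ‖q‖ < r) :
    ExpOn (fun z => dir (z - q) * (dir z)⁻¹) (sphere 0 r) := by
  have hr : 0 < r := (norm_nonneg q).trans_lt hq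
  have h0 : ∀ z ∈ sphere (0 : ℂ) r, z ≠ 0 := by
    rintro z hz rfl
    simp at hz
    exact hr.ne hz
  refine (expOn_dir_of_near (f := fun z => 1 - q / z) (s := sphere 0 r) ?_ 1 ?_).congr ?_
  · exact continuousOn_const.sub (continuousOn_const.div continuousOn_id h0)
  · intro z hz
    have hz' := hz
    rw [mem_sphere_zero_iff_norm] at hz'
    simp only [sub_sub_cancel_left, norm_neg, norm_div, hz', norm_one]
    exact (div_lt_one hr).2 hq
  · intro z hz
    have hz' := hz
    rw [mem_sphere_zero_iff_norm] at hz'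
    have hzq : z - q ≠ 0 := by
      intro h
      rw [sub_eq_zero] at h
      rw [h] at hz'
      linarith
    have : z - q = z * (1 - q / z) := by
      field_simp [h0 z hz]
    have h2 : 1 - q / z ≠ 0 := fun h => hzq (by rw [this, h, mul_zero])
    rw [this, dir_mul (h0 z hz) h2, mul_comm (dir z), mul_inv_cancel_right]

/-- If two circle-valued functions on a finitely punctured disc agree near the boundary, then they
have the same total degree. -/
theorem sum_degrees_eq {R ρ : ℝ} (hρ : ρ < R) (hR : 0 < R) {Q : Finset ℂ}
    (hQ : ∀ q ∈ Q, q ∈ ball (0 : ℂ) R) {F F' : ℂ → Circle} {d d' : ℂ → ℤ}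
    (hF : ∀ q ∈ Q, HasDegAt F q (d q)) (hF' : ∀ q ∈ Q, HasDegAt F' q (d' q))
    (hFc : ContinuousOn F (ball 0 R \ Q)) (hFc' : ContinuousOn F' (ball 0 R \ Q))
    (h : ∀ w ∈ ball (0 : ℂ) R, ρ ≤ ‖w‖ → w ∉ Q → F w = F' w) : ∑ q ∈ Q, d q = ∑ q ∈ Q, d' q := by
  classical
  -- The exponents of `exists_expOn_finite_punctures` must be the local degrees: near one puncture
  -- the factors of all others have logarithms.
  have key : ∀ {F : ℂ → Circle} {d : ℂ → ℤ}, (∀ q ∈ Q, HasDegAt F q (d q)) →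
      ContinuousOn F (ball 0 R \ Q) →
      ExpOn (fun w => F w * ∏ q ∈ Q, dir (w - q) ^ (-d q)) (ball 0 R \ Q) := by
    intro F d hF hFc
    obtain ⟨e, he⟩ := exists_expOn_finite_punctures Q hFc
    suffices ∀ q ∈ Q, d q = e q by
      refine he.congr fun w _ => ?_
      congr 1
      exact Finset.prod_congr rfl fun q hq => by rw [this q hq]
    intro q hq
    refine (hF q hq).unique ?_
    have ho : IsOpen (ball (0 : ℂ) R \ ↑(Q.erase q)) :=
      isOpen_ball.sdiff (Q.erase q).finite_toSet.isClosed
    obtain ⟨ε, hε, hεs⟩ := Metric.isOpen_iff.1 ho q ⟨hQ q hq, by simp⟩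
    have hsub : ball q ε \ {q} ⊆ ball 0 R \ ↑Q := by
      rintro z ⟨hz, hzq⟩
      have := hεs hz
      exact ⟨this.1, fun hzQ => this.2 (Finset.mem_coe.2 (Finset.mem_erase.2 ⟨hzq, hzQ⟩))⟩
    refine ⟨ε, hε, ?_⟩
    have h2 : ExpOn (fun w => ∏ x ∈ Q.erase q, dir (w - x) ^ (-e x)) (ball q ε) := by
      refine ExpOn.prod _ fun x hx => ExpOn.zpow (F := fun w => dir (w - x)) ?_ _
      refine expOn_ball_of_continuousOn fun z hz => ContinuousAt.continuousWithinAt ?_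
      refine ContinuousAt.comp (g := dir) (f := fun z => z - x) (continuousAt_dir ?_) (by fun_prop)
      rw [sub_ne_zero]
      rintro rfl
      exact (hεs hz).2 hx
    refine ((he.mono hsub).mul (h2.mono sdiff_subset).inv).congr fun z _ => ?_
    rw [← Finset.mul_prod_erase _ _ hq, ← mul_assoc, mul_inv_cancel_right]
  have h1 := key hF hFc
  have h2 := key hF' hFc'
  -- A circle beyond all punctures on which the two functions agree.
  obtain ⟨r, hr1, hr2⟩ : ∃ r, (ρ < r ∧ 0 < r ∧ ∀ q ∈ Q, ‖q‖ < r) ∧ r < R := by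
    rcases Q.eq_empty_or_nonempty with rfl | hne
    · obtain ⟨r, hr, hr'⟩ := exists_between (max_lt hρ hR)
      exact ⟨r, ⟨(le_max_left _ _).trans_lt hr, (le_max_right _ _).trans_lt hr, by simp⟩, hr'⟩
    · have hsup : Q.sup' hne norm < R := by
        rw [Finset.sup'_lt_iff]
        intro q hq
        simpa using hQ q hq
      obtain ⟨r, hr, hr'⟩ := exists_between (max_lt (max_lt hρ hR) hsup)
      refine ⟨r, ⟨?_, ?_, fun q hq => ?_⟩, hr'⟩
      · exact ((le_max_left _ _).trans (le_max_left _ _)).trans_lt hr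
      · exact ((le_max_right _ _).trans (le_max_left _ _)).trans_lt hr
      · exact ((Finset.le_sup' norm hq).trans (le_max_right _ _)).trans_lt hr
  obtain ⟨hρr, hr0, hQr⟩ := hr1
  have hsub : sphere (0 : ℂ) r ⊆ ball 0 R \ ↑Q := by
    intro z hz
    rw [mem_sphere_zero_iff_norm] at hz
    refine ⟨by simpa [hz] using hr2, fun hzQ => ?_⟩
    have := hQr z hzQ
    linarith
  -- On this circle the product of the directions from the punctures is a power of `dir w` up to an
  -- exponential, with the total degree as exponent. Comparing both functions gives a power of `dir
  -- w` with a logarithm.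
  have key2 : ∀ d : ℂ → ℤ, ExpOn (fun w => (∏ q ∈ Q, dir (w - q) ^ (-d q)) * dir w ^ (∑ q ∈ Q, d q))
      (sphere 0 r) := by
    intro d
    refine (ExpOn.prod Q fun q hq => (expOn_dir_sub_div_dir (hQr q hq)).zpow (-d q)).congr ?_
    intro w _
    simp only [mul_zpow, Finset.prod_mul_distrib, inv_zpow', neg_neg]
    congr 1
    clear * -
    induction Q using Finset.induction_on with
    | empty => simp
    | insert a Q ha ih => rw [Finset.sum_insert ha, Finset.prod_insert ha, zpow_add, ih]
  have := eq_zero_of_expOn_sphere (K := ∑ q ∈ Q, d q - ∑ q ∈ Q, d' q) hr0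
    ((((key2 d).mul (key2 d').inv).mul ((h1.mono hsub).inv.mul (h2.mono hsub))).congr fun w hw => by
      have hw' := hw
      rw [mem_sphere_zero_iff_norm] at hw'
      rw [h w (hsub hw).1 (by rw [hw']; exact hρr.le) (hsub hw).2, zpow_sub]
      apply Circle.ext
      simp only [Circle.coe_mul, Circle.coe_inv]
      field_simp)
  linarith

end

section

/-! ### Extension of circle-valued functions in the plane -/

theorem ContinuousLinearMap.injective_of_det_ne_zero {L : ℂ →L[ℝ] ℂ} (h : L.det ≠ 0) :
    Function.Injective L :=
  (LinearEquiv.ofIsUnitDet (v := Module.finBasis ℝ ℂ) (v' := Module.finBasis ℝ ℂ)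
    (f := (L : ℂ →ₗ[ℝ] ℂ)) (by
      rw [LinearMap.det_toMatrix]; exact isUnit_iff_ne_zero.2 h)).injective

/-- The pasting lemma. A point of `s` outside of one closed piece is not in the closure of that
piece, so the piece imposes no condition there. -/
theorem ContinuousOn.of_isClosed_cover {X Y : Type*} [TopologicalSpace X] [TopologicalSpace Y]
    {f : X → Y} {s t₁ t₂ : Set X} (h₁ : IsClosed t₁) (h₂ : IsClosed t₂) (hs : s ⊆ t₁ ∪ t₂)
    (hf₁ : ContinuousOn f (t₁ ∩ s)) (hf₂ : ContinuousOn f (t₂ ∩ s)) : ContinuousOn f s := by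
  have key : ∀ {t : Set X}, IsClosed t → ContinuousOn f (t ∩ s) → ∀ x ∈ s,
      ContinuousWithinAt f (t ∩ s) x := by
    intro t ht hf x hx
    by_cases hxt : x ∈ t
    · exact hf x ⟨hxt, hx⟩
    · exact continuousWithinAt_of_notMem_closure fun hcl =>
        hxt (ht.closure_subset_iff.2 inter_subset_left hcl)
  intro x hx
  refine ((key h₁ hf₁ x hx).union (key h₂ hf₂ x hx)).mono fun y hy => ?_
  rcases hs hy with h | h
  · exact Or.inl ⟨h, hy⟩
  · exact Or.inr ⟨h, hy⟩

open scoped Manifold in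
/-- A continuous map on the plane can be approximated on the plane by smooth maps with
finitely many zeros on bounded sets. -/
theorem exists_contDiff_approx_finite_zeros (F : C(ℂ, ℂ)) (R : ℝ) {δ : ℝ} (hδ : 0 < δ) :
    ∃ g : ℂ → ℂ, Continuous g ∧ (∀ z, ‖g z - F z‖ < δ) ∧ (closedBall 0 R ∩ {z | g z = 0}).Finite := by
  obtain ⟨g, hg⟩ := exists_contMDiffMap_forall_mem_convex_of_local_const (n := ⊤) 𝓘(ℝ, ℂ)
    (t := fun z => ball (F z) (δ / 2)) (fun z => convex_ball _ _) (fun z => by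
      refine ⟨F z, ?_⟩
      filter_upwards [F.continuous.continuousAt (ball_mem_nhds (F z) (half_pos hδ))] with w hw
      rw [mem_ball_comm]
      exact hw)
  have hgs : ContDiff ℝ ∞ g := contMDiff_iff_contDiff.1 g.contMDiff
  have hgd : Differentiable ℝ g := hgs.differentiable (by simp)
  -- Sard's theorem: the critical values of `g` form a null set, so arbitrarily small `c` are
  -- regular values. The zeros of `g - c` are then nondegenerate, hence isolated, hence finite in
  -- number on a compact disc.
  let S : Set ℂ := {z | (fderiv ℝ g z).det = 0}
  have h0 : MeasureTheory.volume (g '' S) = 0 :=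
    MeasureTheory.addHaar_image_eq_zero_of_det_fderivWithin_eq_zero _ (f' := fderiv ℝ g)
      (fun z _ => (hgd z).hasFDerivAt.hasFDerivWithinAt) (fun z hz => hz)
  obtain ⟨c, hcδ, hcS⟩ : ∃ c ∈ ball (0 : ℂ) (δ / 2), c ∉ g '' S := by
    by_contra! hcon
    have h1 := MeasureTheory.measure_mono_null (show ball (0 : ℂ) (δ / 2) ⊆ g '' S from hcon) h0
    exact (measure_ball_pos MeasureTheory.volume (0 : ℂ) (half_pos hδ)).ne' h1
  refine ⟨fun z => g z - c, g.contMDiff.continuous.sub continuous_const, fun z => ?_, ?_⟩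
  · have h1 : ‖g z - F z‖ < δ / 2 := by simpa [dist_eq_norm] using hg z
    have h2 : ‖c‖ < δ / 2 := by simpa using hcδ
    calc ‖g z - c - F z‖ = ‖(g z - F z) - c‖ := by ring_nf
      _ ≤ ‖g z - F z‖ + ‖c‖ := norm_sub_le _ _
      _ < δ := by linarith
  · have hcl : IsClosed {z | g z - c = 0} :=
      isClosed_eq (g.contMDiff.continuous.sub continuous_const) continuous_const
    refine ((isCompact_closedBall (0 : ℂ) R).inter_right hcl).finite ?_
    rw [isDiscrete_iff_nhdsNE]
    rintro z ⟨-, hz⟩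
    have hz : g z - c = 0 := hz
    have hdet : (fderiv ℝ g z).det ≠ 0 := fun h => hcS ⟨z, h, by linear_combination hz⟩
    obtain ⟨K, -, hK⟩ := (fderiv ℝ g z : ℂ →ₗ[ℝ] ℂ).exists_antilipschitzWith
      (LinearMap.ker_eq_bot.2 (ContinuousLinearMap.injective_of_det_ne_zero hdet))
    have := (hgd z).hasFDerivAt.eventually_ne (c := c) ⟨K, hK⟩
    rw [Filter.inf_principal_eq_bot]
    filter_upwards [this] with w hw
    rintro ⟨-, h⟩
    exact hw (sub_eq_zero.1 h)

/-- A continuous circle-valued function on a compact subset of a disc extends to the disc outside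
of finitely many points. -/
theorem exists_extension_finite_punctures {A : Set ℂ} (hA : IsClosed A)
    (R : ℝ) {f : ℂ → Circle} (hf : ContinuousOn f A) :
    ∃ (P : Finset ℂ) (G : ℂ → Circle), ContinuousOn G (closedBall 0 R \ P) ∧ EqOn G f A := by
  -- Tietze's theorem extends `f` as a complex function, and `g` approximates the extension with
  -- finitely many zeros in the disc. Outside of these its direction is a first candidate.
  obtain ⟨F, hF⟩ := ContinuousMap.exists_restrict_eq hA
    (⟨fun x => (f x : ℂ), continuous_subtype_val.comp hf.domRestrict⟩ : C(A, ℂ))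
  have hFA : ∀ x ∈ A, F x = f x := fun x hx => congrArg (fun h => h ⟨x, hx⟩) hF
  obtain ⟨g, hgc, hg, hfin⟩ := exists_contDiff_approx_finite_zeros F R one_pos
  have hre : ∀ x ∈ A, 0 < (g x / (f x : ℂ)).re := by
    intro x hx
    have h1 : ‖g x / (f x : ℂ) - 1‖ < 1 := by
      rw [div_sub_one (f x).coe_ne_zero, norm_div, Circle.norm_coe, div_one, ← hFA x hx]
      exact hg x
    have h2 := (abs_le.1 (Complex.abs_re_le_norm (g x / (f x : ℂ) - 1))).1
    simp only [Complex.sub_re, Complex.one_re] at h2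
    linarith
  have hθ : ContinuousOn (fun x => (g x / (f x : ℂ)).arg) A :=
    arg_continuousOn_re_pos (hgc.continuousOn.div (continuous_subtype_val.comp_continuousOn hf)
      fun x _ => (f x).coe_ne_zero) hre
  -- On `A` the direction of `g` is off from `f` by an angle that is continuous because `g / f` lies
  -- in the right half-plane. This angle is a real function, extends by Tietze's theorem and is
  -- rotated away.
  obtain ⟨θ, hθ⟩ := ContinuousMap.exists_restrict_eq hA
    (⟨fun x => (g x / (f x : ℂ)).arg, hθ.domRestrict⟩ : C(A, ℝ))
  have hθA : ∀ x ∈ A, θ x = (g x / (f x : ℂ)).arg := fun x hx => congrArg (fun h => h ⟨x, hx⟩) hθ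
  refine ⟨hfin.toFinset, fun z => dir (g z) * Circle.exp (-θ z), ?_, fun z hz => ?_⟩
  · refine ContinuousOn.mul ?_ (Circle.exp.continuous.comp θ.continuous.neg).continuousOn
    refine continuousOn_dir.comp hgc.continuousOn fun z hz => ?_
    intro h0
    exact hz.2 (by simpa using ⟨by simpa using hz.1, h0⟩)
  · beta_reduce
    have h0 : g z / (f z : ℂ) ≠ 0 := fun h0 => by
      have := hre z hz
      rw [h0] at this
      simp at this
    have h1 : g z = f z * (g z / (f z : ℂ)) := by
      field_simp
    rw [hθA z hz, Circle.exp_neg]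
    change _ * (dir _)⁻¹ = _
    conv_lhs => rw [h1]
    rw [mul_div_cancel₀ _ (f z).coe_ne_zero, ← div_eq_mul_inv, div_eq_iff_eq_mul]
    conv_lhs => rw [h1]
    rw [dir_coe_mul _ _ h0]

/-- The extension theorem for functions which have themselves singularities in the interior of the
set on which they are given. -/
theorem exists_extension_with_punctures {C : Set ℂ} (hC : IsClosed C) (R : ℝ)
    (P : Finset ℂ) (hP : ∀ p ∈ P, p ∈ C → p ∈ interior C)
    {f : ℂ → Circle} (hf : ContinuousOn f (C \ P)) :
    ∃ (P' : Finset ℂ) (G : ℂ → Circle), P ⊆ P' ∧ ContinuousOn G (closedBall 0 R \ P') ∧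
      EqOn G f C := by
  classical
  have hε : ∀ p : ℂ, ∃ ε > 0, p ∈ P → p ∈ C → ball p ε ⊆ C := by
    intro p
    by_cases h : p ∈ P ∧ p ∈ C
    · obtain ⟨ε, hε, h'⟩ := Metric.isOpen_iff.1 isOpen_interior p (hP p h.1 h.2)
      exact ⟨ε, hε, fun _ _ => h'.trans interior_subset⟩
    · exact ⟨1, one_pos, fun h1 h2 => (h ⟨h1, h2⟩).elim⟩
  choose ε hε hεC using hε
  -- Around the punctures in `C` the given `f` is kept on small discs inside `C`. The remaining
  -- closed set `C \ U` contains no puncture and is handled by the previous theorem.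
  let U : Set ℂ := ⋃ p ∈ {p | p ∈ P ∧ p ∈ C}, ball p (ε p)
  have hU : IsOpen U := isOpen_biUnion fun p _ => isOpen_ball
  have hUC : U ⊆ C := iUnion₂_subset fun p hp => hεC p hp.1 hp.2
  have hA : C \ U ⊆ C \ P := fun z hz => ⟨hz.1, fun hzP =>
    hz.2 (mem_biUnion (show z ∈ {p | p ∈ P ∧ p ∈ C} from ⟨hzP, hz.1⟩) (mem_ball_self (hε z)))⟩
  obtain ⟨P₀, G₀, hG₀, hGf⟩ := exists_extension_finite_punctures (hC.sdiff hU) R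
    (hf.mono hA)
  refine ⟨P ∪ P₀, fun z => if z ∈ C then f z else G₀ z, Finset.subset_union_left, ?_, fun z hz => ?_⟩
  · refine ContinuousOn.of_isClosed_cover hC (isClosed_closedBall.sdiff hU)
      (t₂ := closedBall 0 R \ U) (fun z hz => ?_) ?_ ?_
    · by_cases hzU : z ∈ U
      · exact Or.inl (hUC hzU)
      · exact Or.inr ⟨hz.1, hzU⟩
    · refine (hf.mono ?_).congr fun z hz => if_pos hz.1
      exact fun z hz => ⟨hz.1, fun h => hz.2.2 (by simpa using Or.inl h)⟩
    · refine (hG₀.mono ?_).congr fun z hz => ?_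
      · exact fun z hz => ⟨hz.1.1, fun h => hz.2.2 (by simpa using Or.inr h)⟩
      · split_ifs with hzC
        · exact (hGf ⟨hzC, hz.1.2⟩).symm
        · rfl
  · simp [hz]

end

section

/-! ### The first homology of topological groups and of the circle -/

section Homology

open CategoryTheory AlgebraicTopology Simplicial Limits

universe v w u

/-- For the vanishing on H₁ a null-homotopy is needed in degree one only: on cycles the term through
`K.d 1 0` dies and the other one is a boundary. -/
theorem HomologicalComplex.homologyMap_one_eq_zero {C : Type w} [Category.{v} C] [Preadditive C]
    [CategoryWithHomology C] {K L : ChainComplex C ℕ} (φ : K ⟶ L) (H : K.X 1 ⟶ L.X 2)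
    (ψ : K.X 0 ⟶ L.X 1) (h : φ.f 1 = H ≫ L.d 2 1 + K.d 1 0 ≫ ψ) :
    HomologicalComplex.homologyMap φ 1 = 0 := by
  rw [← cancel_epi (K.homologyπ 1), HomologicalComplex.homologyπ_naturality, comp_zero]
  have h1 : HomologicalComplex.cyclesMap φ 1 = K.iCycles 1 ≫ H ≫ L.toCycles 2 1 := by
    rw [← cancel_mono (L.iCycles 1)]
    simp [h]
  rw [h1, Category.assoc, Category.assoc, L.toCycles_comp_homologyπ, comp_zero, comp_zero]

/-- The chains are a coproduct of copies of `R` indexed by the simplices, so a morphism may be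
prescribed simplex by simplex. -/
theorem SSet.exists_chainComplex_desc {C : Type w} [Category.{v} C] [Preadditive C]
    [HasCoproducts.{u} C] {R T : C} (X : SSet.{u}) {n : ℕ} (f : X _⦋n⦌ → (R ⟶ T)) :
    ∃ H : (X.chainComplex R).X n ⟶ T, ∀ x : X _⦋n⦌, X.ιChainComplex x ≫ H = f x :=
  ⟨(X.isColimitChainComplexXCofan R n).desc (Cofan.mk T f),
    fun x => (X.isColimitChainComplexXCofan R n).fac _ ⟨x⟩⟩

namespace TopCat

variable {G : TopCat.{u}} [CommGroup G] [IsTopologicalGroup G]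

/-- The product of two singular simplices of a topological group. -/
def simplexMul {n : ℕ} (x y : (toSSet.obj G) _⦋n⦌) : (toSSet.obj G) _⦋n⦌ :=
  ⟨ofHom (x.down.hom * y.down.hom)⟩

/-- The constant singular simplex. -/
def simplexOne (G : TopCat.{u}) [CommGroup G] (n : ℕ) : (toSSet.obj G) _⦋n⦌ :=
  ⟨ofHom (ContinuousMap.const _ 1)⟩

theorem simplexMul_comm {n : ℕ} (x y : (toSSet.obj G) _⦋n⦌) :
    simplexMul x y = simplexMul y x := by
  unfold simplexMul
  congr 2
  ext t
  exact mul_comm _ _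

theorem simplexOne_mul {n : ℕ} (x : (toSSet.obj G) _⦋n⦌) :
    simplexMul (simplexOne G n) x = x := by
  refine congrArg ULift.up (TopCat.hom_ext (ContinuousMap.ext fun t => ?_))
  exact one_mul _

theorem δ_simplexMul {n : ℕ} (x y : (toSSet.obj G) _⦋n + 1⦌) (i : Fin (n + 2)) :
    (toSSet.obj G).δ i (simplexMul x y) =
      simplexMul ((toSSet.obj G).δ i x) ((toSSet.obj G).δ i y) := rfl

/-- The triangle interpolating between the product of two paths and their juxtaposition. -/
def triangle (x y : (toSSet.obj G) _⦋1⦌) : (toSSet.obj G) _⦋2⦌ :=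
  simplexMul ((toSSet.obj G).σ 0 x) ((toSSet.obj G).σ 1 y)

theorem δ_zero_triangle (x y : (toSSet.obj G) _⦋1⦌) : (toSSet.obj G).δ 0 (triangle x y) =
    simplexMul x ((toSSet.obj G).σ 0 ((toSSet.obj G).δ 0 y)) := by
  rw [triangle, δ_simplexMul]
  congr 1
  · exact SSet.δ_comp_σ_self_apply 0 x
  · exact SSet.δ_comp_σ_of_le_apply (i := 0) (j := 0) le_rfl y

theorem δ_one_triangle (x y : (toSSet.obj G) _⦋1⦌) : (toSSet.obj G).δ 1 (triangle x y) =
    simplexMul x y := by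
  rw [triangle, δ_simplexMul]
  congr 1
  · exact SSet.δ_comp_σ_succ_apply 0 x
  · exact SSet.δ_comp_σ_self_apply 1 y

theorem δ_two_triangle (x y : (toSSet.obj G) _⦋1⦌) : (toSSet.obj G).δ 2 (triangle x y) =
    simplexMul ((toSSet.obj G).σ 0 ((toSSet.obj G).δ 1 x)) y := by
  rw [triangle, δ_simplexMul]
  congr 1
  · exact SSet.δ_comp_σ_of_gt_apply (i := 1) (j := 0) (by decide) x
  · exact SSet.δ_comp_σ_succ_apply 1 y

variable {C : Type w} [Category.{v} C] [Preadditive C] [HasCoproducts.{u} C] (R : C)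

theorem ι_triangle_d (x y : (toSSet.obj G) _⦋1⦌) :
    (toSSet.obj G).ιChainComplex (R := R) (triangle x y) ≫ ((toSSet.obj G).chainComplex R).d 2 1 =
      (toSSet.obj G).ιChainComplex (simplexMul x ((toSSet.obj G).σ 0 ((toSSet.obj G).δ 0 y)))
      - (toSSet.obj G).ιChainComplex (simplexMul x y)
      + (toSSet.obj G).ιChainComplex
          (simplexMul ((toSSet.obj G).σ 0 ((toSSet.obj G).δ 1 x)) y) := by
  rw [SSet.ιChainComplex_d, Fin.sum_univ_three, δ_zero_triangle, δ_one_triangle, δ_two_triangle]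
  simp [sub_eq_add_neg]

theorem ι_path_d {X : TopCat.{u}} (x : (toSSet.obj X) _⦋1⦌) :
    (toSSet.obj X).ιChainComplex (R := R) x ≫ ((toSSet.obj X).chainComplex R).d 1 0 =
      (toSSet.obj X).ιChainComplex ((toSSet.obj X).δ 0 x)
      - (toSSet.obj X).ιChainComplex ((toSSet.obj X).δ 1 x) := by
  rw [SSet.ιChainComplex_d, Fin.sum_univ_two]
  simp [sub_eq_add_neg]

/-- On the first homology, the pointwise product of maps into a path connected abelian topological
group induces the sum. -/
theorem homologyMap_mul [CategoryWithHomology C] {Y : TopCat.{u}} (φ ψ θ : Y ⟶ G)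
    (hθ : ∀ y, θ y = φ y * ψ y)
    (hG : ∀ g : (toSSet.obj G) _⦋0⦌, ∃ γ : (toSSet.obj G) _⦋1⦌,
      (toSSet.obj G).δ 1 γ = simplexOne G 0 ∧ (toSSet.obj G).δ 0 γ = g) :
    SSet.homologyMap (toSSet.map θ) R 1 =
      SSet.homologyMap (toSSet.map φ) R 1 + SSet.homologyMap (toSSet.map ψ) R 1 := by
  choose γ hγ₁ hγ₀ using hG
  let cst : (toSSet.obj G) _⦋0⦌ → (toSSet.obj G) _⦋1⦌ := fun g => (toSSet.obj G).σ 0 g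
  let Φ : ∀ {n : ℕ}, (toSSet.obj Y) _⦋n⦌ → (toSSet.obj G) _⦋n⦌ := fun {n} x => (toSSet.map φ).app _ x
  let Ψ : ∀ {n : ℕ}, (toSSet.obj Y) _⦋n⦌ → (toSSet.obj G) _⦋n⦌ := fun {n} x => (toSSet.map ψ).app _ x
  let τ : (toSSet.obj G) _⦋1⦌ → (toSSet.obj G) _⦋1⦌ → (R ⟶ ((toSSet.obj G).chainComplex R).X 2) := fun x y =>
    (toSSet.obj G).ιChainComplex (triangle x y)
  let ι₁ : (toSSet.obj G) _⦋1⦌ → (R ⟶ ((toSSet.obj G).chainComplex R).X 1) := fun x => (toSSet.obj G).ιChainComplex x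
  have hτ : ∀ x y, τ x y ≫ ((toSSet.obj G).chainComplex R).d 2 1 =
      ι₁ (simplexMul x (cst ((toSSet.obj G).δ 0 y))) - ι₁ (simplexMul x y)
        + ι₁ (simplexMul (cst ((toSSet.obj G).δ 1 x)) y) := fun x y => ι_triangle_d R x y
  -- The boundary of `τ x y` is x·(end of y) - xy + (start of x)·y, with constant paths in brackets.
  -- For based loops one triangle would do. In general the paths `γ` from 1 to the end points `p`,
  -- `q`, `r` are needed to trade translated paths for untranslated ones: the boundary of these nine
  -- triangles is s + t - st up to terms that depend only on the end points, namely the difference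
  -- of the values of `M` at the start and at the end.
  let N : (toSSet.obj G) _⦋1⦌ → (toSSet.obj G) _⦋1⦌ → (toSSet.obj G) _⦋1⦌ → (toSSet.obj G) _⦋1⦌ → (toSSet.obj G) _⦋1⦌ → (R ⟶ ((toSSet.obj G).chainComplex R).X 2) :=
    fun s t p q r => τ s t - τ s q + τ q s - τ t p + τ p t - τ p q + τ q p + τ p r - τ r p
  let M : (toSSet.obj G) _⦋0⦌ → (toSSet.obj G) _⦋0⦌ → (R ⟶ ((toSSet.obj G).chainComplex R).X 1) := fun y z =>
    ι₁ (γ z) - ι₁ (simplexMul (γ z) (cst y))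
  obtain ⟨H, hH⟩ : ∃ H : ((toSSet.obj Y).chainComplex R).X 1 ⟶ ((toSSet.obj G).chainComplex R).X 2,
      ∀ x : (toSSet.obj Y) _⦋1⦌, (toSSet.obj Y).ιChainComplex x ≫ H =
        N (Φ x) (Ψ x) (γ ((toSSet.obj G).δ 1 (Φ x))) (γ ((toSSet.obj G).δ 0 (Ψ x)))
          (γ ((toSSet.obj G).δ 1 (Ψ x))) :=
    SSet.exists_chainComplex_desc _ _
  obtain ⟨K, hK⟩ : ∃ K : ((toSSet.obj Y).chainComplex R).X 0 ⟶ ((toSSet.obj G).chainComplex R).X 1,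
      ∀ x : (toSSet.obj Y) _⦋0⦌, (toSSet.obj Y).ιChainComplex x ≫ K = M (Φ x) (Ψ x) :=
    SSet.exists_chainComplex_desc _ _
  have key := HomologicalComplex.homologyMap_one_eq_zero
    (SSet.chainComplexMap (toSSet.map φ) R + SSet.chainComplexMap (toSSet.map ψ) R
      - SSet.chainComplexMap (toSSet.map θ) R) H K (by
    refine SSet.chainComplex_hom_ext fun x => ?_
    have r1 := congrArg (· ≫ ((toSSet.obj G).chainComplex R).d 2 1) (hH x)
    have r2 : (toSSet.obj Y).ιChainComplex x ≫ ((toSSet.obj Y).chainComplex R).d 1 0 ≫ K =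
        M (Φ ((toSSet.obj Y).δ 0 x)) (Ψ ((toSSet.obj Y).δ 0 x)) -
          M (Φ ((toSSet.obj Y).δ 1 x)) (Ψ ((toSSet.obj Y).δ 1 x)) := by
      rw [← Category.assoc, ι_path_d, Preadditive.sub_comp, hK, hK]
    simp only [Category.assoc] at r1
    rw [Preadditive.comp_add, r1, r2]
    rw [HomologicalComplex.sub_f_apply, HomologicalComplex.add_f_apply, Preadditive.comp_sub,
      Preadditive.comp_add, SSet.ι_chainComplexMap_f, SSet.ι_chainComplexMap_f,
      SSet.ι_chainComplexMap_f]
    have hmul : (toSSet.map θ).app _ x = simplexMul (Φ x : (toSSet.obj G) _⦋1⦌) (Ψ x) := by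
      refine congrArg ULift.up (TopCat.hom_ext (ContinuousMap.ext fun t => ?_))
      exact hθ _
    rw [hmul]
    change ι₁ (Φ x) + ι₁ (Ψ x) - ι₁ _ = _
    have e1 : ∀ i, Φ ((toSSet.obj Y).δ i x) = (toSSet.obj G).δ i (Φ x : (toSSet.obj G) _⦋1⦌) := fun i => rfl
    have e2 : ∀ i, Ψ ((toSSet.obj Y).δ i x) = (toSSet.obj G).δ i (Ψ x : (toSSet.obj G) _⦋1⦌) := fun i => rfl
    rw [e1, e1, e2, e2]
    simp only [N, M, Preadditive.add_comp, Preadditive.sub_comp, hτ]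
    have c1 : cst (simplexOne G 0) = simplexOne G 1 := rfl
    simp only [hγ₁, hγ₀, c1, simplexOne_mul]
    generalize cst ((toSSet.obj G).δ 1 (Φ x)) = a
    generalize cst ((toSSet.obj G).δ 0 (Φ x)) = b
    generalize cst ((toSSet.obj G).δ 1 (Ψ x)) = a'
    generalize cst ((toSSet.obj G).δ 0 (Ψ x)) = b'
    generalize γ ((toSSet.obj G).δ 1 (Φ x)) = p
    generalize γ ((toSSet.obj G).δ 0 (Ψ x)) = q
    generalize γ ((toSSet.obj G).δ 1 (Ψ x)) = r
    rw [simplexMul_comm a q, simplexMul_comm a (Ψ x), simplexMul_comm q (Φ x),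
      simplexMul_comm p (Ψ x), simplexMul_comm q p, simplexMul_comm r p, simplexMul_comm a' p]
    abel)
  rw [HomologicalComplex.homologyMap_sub, HomologicalComplex.homologyMap_add, sub_eq_zero] at key
  exact key.symm

end TopCat

end Homology

end

section

/-! ### Degrees of self-maps of the circle and their action on the first homology. -/

section CircleHomology

open CategoryTheory AlgebraicTopology Simplicial Limits

universe u

/-- The circle in an arbitrary universe. -/
abbrev circleTop : TopCat.{u} := TopCat.of (ULift.{u} Circle)

instance : CommGroup circleTop.{u} := inferInstanceAs (CommGroup (ULift.{u} Circle))

instance : IsTopologicalGroup circleTop.{u} := inferInstanceAs (IsTopologicalGroup (ULift.{u} Circle))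

/-- The first singular homology with rational coefficients. -/
abbrev rationalH1 : TopCat.{u} ⥤ ModuleCat.{u} ℚ :=
  (AlgebraicTopology.singularHomologyFunctor (ModuleCat.{u} ℚ) 1).obj
      (ModuleCat.of ℚ (ULift.{u} ℚ))

/-- A self-map of the circle as a morphism. -/
def circleHom (f : C(Circle, Circle)) : circleTop.{u} ⟶ circleTop.{u} :=
  TopCat.ofHom ⟨fun w => ⟨f w.down⟩, continuous_uliftUp.comp (f.continuous.comp continuous_uliftDown)⟩

theorem loopClass_comp {X : Type u} [TopologicalSpace X] (j : C(Circle, X)) (f : C(Circle, Circle)) :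
    loopClass (j.comp f) = rationalH1.map (circleHom f) ≫ loopClass j := by
  rw [loopClass, loopClass, ← Functor.map_comp]
  rfl

theorem loopClass_eq_of_homotopic {X : Type u} [TopologicalSpace X] {f g : C(Circle, X)}
    (h : f.Homotopic g) : loopClass f = loopClass g := by
  obtain ⟨H⟩ := h
  exact TopCat.Homotopy.congr_homologyMap_singularChainComplexFunctor
    (f := TopCat.ofHom (f.comp ⟨ULift.down, continuous_uliftDown⟩))
    (g := TopCat.ofHom (g.comp ⟨ULift.down, continuous_uliftDown⟩))
    (H.comp (ContinuousMap.Homotopy.refl _)) _ 1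

/-- The singular simplex of the circle which is the exponential of a function on the simplex. -/
def expSimplex {n : ℕ} (g : C(stdSimplex ℝ (Fin (n + 1)), ℝ)) :
    (TopCat.toSSet.obj circleTop.{u}) _⦋n⦌ :=
  ⟨TopCat.ofHom ⟨fun p => ⟨Circle.exp (g p.down)⟩, by
    refine continuous_uliftUp.comp (Circle.exp.continuous.comp (g.continuous.comp ?_))
    exact continuous_uliftDown⟩⟩

theorem δ_expSimplex {n : ℕ} (g : C(stdSimplex ℝ (Fin (n + 2)), ℝ)) (i : Fin (n + 2)) :
    (TopCat.toSSet.obj circleTop.{u}).δ i (expSimplex g) =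
      expSimplex (g.comp ⟨stdSimplex.map (SimplexCategory.δ i), stdSimplex.continuous_map _⟩) := rfl

theorem exists_expSimplex {n : ℕ} (x : (TopCat.toSSet.obj circleTop.{u}) _⦋n⦌) :
    ∃ g, x = expSimplex g := by
  -- `expOn_of_convex` asks for an open convex set and the simplex is not open in its ambient space.
  -- The half-space of positive coordinate sum is, and `r` retracts it onto the simplex by dropping
  -- the negative parts and normalising.
  let r : (Fin (n + 1) → ℝ) → (Fin (n + 1) → ℝ) := fun f i => max (f i) 0 / ∑ j, max (f j) 0
  let s : Set (Fin (n + 1) → ℝ) := {f | 0 < ∑ j, f j}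
  have hpos : ∀ f ∈ s, 0 < ∑ j, max (f j) 0 := fun f hf =>
    lt_of_lt_of_le hf (Finset.sum_le_sum fun j _ => le_max_left _ _)
  have hr : ∀ f ∈ s, r f ∈ stdSimplex ℝ (Fin (n + 1)) := fun f hf =>
    ⟨fun i => div_nonneg (le_max_right _ _) (hpos f hf).le, by
      simp only [r]
      rw [← Finset.sum_div, div_self (hpos f hf).ne']⟩
  have hrc : ContinuousOn r s := by
    refine continuousOn_pi.2 fun i => ContinuousOn.div (by fun_prop) (by fun_prop) ?_
    exact fun f hf => (hpos f hf).ne'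
  have hid : ∀ f ∈ stdSimplex ℝ (Fin (n + 1)), f ∈ s ∧ r f = f := by
    intro f hf
    have h1 : ∑ j, max (f j) 0 = 1 := by
      rw [← hf.2]
      exact Finset.sum_congr rfl fun j _ => max_eq_left (hf.1 j)
    refine ⟨by simp [s, hf.2], funext fun i => ?_⟩
    simp [r, h1, max_eq_left (hf.1 i)]
  let X : ULift.{u} (stdSimplex ℝ (Fin (n + 1))) → Circle := fun p => (x.down.hom p).down
  have hX : Continuous X := continuous_uliftDown.comp x.down.hom.continuous
  classical
  have hsc : Convex ℝ s := by
    refine convex_halfSpace_gt (𝕜 := ℝ) (f := fun f : Fin (n + 1) → ℝ => ∑ j, f j) ⟨?_, ?_⟩ 0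
    · intro f g
      simp [Finset.sum_add_distrib]
    · intro a f
      simp [Finset.mul_sum]
  obtain ⟨g, hg, h⟩ := expOn_of_convex (s := s) (F := fun f => if hf : f ∈ s then X ⟨⟨r f, hr f hf⟩⟩ else 1)
    hsc (isOpen_lt continuous_const (by fun_prop)) (by
      rw [continuousOn_iff_continuous_domRestrict]
      have : Continuous fun f : s => X ⟨⟨r f, hr f f.2⟩⟩ :=
        hX.comp (continuous_uliftUp.comp (Continuous.subtype_mk hrc.domRestrict _))
      refine this.congr fun f => ?_
      simp)
  refine ⟨⟨fun p => g p, hg.comp_continuous continuous_subtype_val fun p => (hid p p.2).1⟩, ?_⟩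
  refine congrArg ULift.up (TopCat.hom_ext (ContinuousMap.ext fun p => ?_))
  refine ULift.ext _ _ ?_
  obtain ⟨p⟩ := p
  let p' : stdSimplex ℝ (Fin (n + 1)) := p
  change X ⟨p'⟩ = Circle.exp (g p'.1)
  refine Eq.trans ?_ (h p'.1 (hid _ p'.2).1)
  simp only [dif_pos (hid _ p'.2).1]
  congr 1
  refine ULift.ext _ _ (Subtype.ext ?_)
  exact (hid _ p'.2).2.symm

theorem expSimplex_congr {n : ℕ} {g h : C(stdSimplex ℝ (Fin (n + 1)), ℝ)}
    (e : ∀ p, Circle.exp (g p) = Circle.exp (h p)) : expSimplex.{u} g = expSimplex h :=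
  congrArg ULift.up (TopCat.hom_ext (ContinuousMap.ext fun p => ULift.ext _ _ (e p.down)))

/-- Two logarithms of one simplex differ by a constant, so the increment of the logarithm along an
edge depends on the simplex alone. This makes the winding cocycle below well defined. -/
theorem expSimplex_eq {n : ℕ} {g h : C(stdSimplex ℝ (Fin (n + 1)), ℝ)}
    (e : expSimplex.{u} g = expSimplex h) (p q) : g p - g q = h p - h q := by
  have : ∀ p, Circle.exp (g p) = Circle.exp (h p) := fun p =>
    congrArg (fun x : (TopCat.toSSet.obj circleTop.{u}) _⦋n⦌ => (x.down.hom ⟨p⟩).down) e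
  obtain ⟨k, hk⟩ := (isPreconnected_univ (α := stdSimplex ℝ (Fin (n + 1)))).exists_int_of_exp_eq_one
    (g := fun p => g p - h p) (by fun_prop) (fun p _ => by
      rw [Circle.exp_sub, this, div_self'])
  have h1 := hk p trivial
  have h2 := hk q trivial
  linarith

theorem circle_exists_path (g : (TopCat.toSSet.obj circleTop.{u}) _⦋0⦌) :
    ∃ γ : (TopCat.toSSet.obj circleTop.{u}) _⦋1⦌,
      (TopCat.toSSet.obj circleTop.{u}).δ 1 γ = TopCat.simplexOne circleTop.{u} 0 ∧
        (TopCat.toSSet.obj circleTop.{u}).δ 0 γ = g := by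
  obtain ⟨θ, rfl⟩ := exists_expSimplex g
  refine ⟨expSimplex ⟨fun p => p.1 1 * θ (stdSimplex.vertex 0),
    ((continuous_apply 1).comp continuous_subtype_val).mul continuous_const⟩, ?_, ?_⟩
  · rw [δ_expSimplex]
    have h1 : TopCat.simplexOne circleTop.{u} 0 = expSimplex 0 :=
      congrArg ULift.up (TopCat.hom_ext (ContinuousMap.ext fun p => ULift.ext _ _ Circle.exp_zero.symm))
    rw [h1]
    refine expSimplex_congr fun p => ?_
    obtain rfl : p = stdSimplex.vertex 0 := Subsingleton.elim _ _
    change Circle.exp ((stdSimplex.map _ (stdSimplex.vertex 0)).1 1 * _) = _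
    rw [stdSimplex.map_vertex]
    have : (SimplexCategory.δ (1 : Fin 2)) 0 = 0 := rfl
    rw [this]
    simp
  · rw [δ_expSimplex]
    refine expSimplex_congr fun p => ?_
    obtain rfl : p = stdSimplex.vertex 0 := Subsingleton.elim _ _
    change Circle.exp ((stdSimplex.map _ (stdSimplex.vertex 0)).1 1 * _) = _
    rw [stdSimplex.map_vertex]
    have : (SimplexCategory.δ (0 : Fin 2)) 0 = 1 := rfl
    rw [this]
    simp

theorem rationalH1_map_mul (f g : C(Circle, Circle)) :
    rationalH1.{u}.map (circleHom (f * g)) =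
      rationalH1.map (circleHom f) + rationalH1.map (circleHom g) :=
  TopCat.homologyMap_mul _ (circleHom f) (circleHom g) (circleHom (f * g)) (fun _ => rfl)
    circle_exists_path

theorem rationalH1_map_one : rationalH1.{u}.map (circleHom 1) = 0 := by
  have := rationalH1_map_mul.{u} 1 1
  rwa [mul_one, left_eq_add] at this

/-- Shrinking the logarithm to zero contracts the map to a constant. -/
theorem rationalH1_map_exp (g : C(Circle, ℝ)) :
    rationalH1.{u}.map (circleHom (Circle.exp.comp g)) = 0 := by
  rw [← rationalH1_map_one]
  have h : (Circle.exp.comp g).Homotopic 1 := by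
    refine ⟨⟨⟨fun x => Circle.exp ((1 - (x.1 : ℝ)) * g x.2), by fun_prop⟩, ?_, ?_⟩⟩
    · intro x; simp
    · intro x; simp
  obtain ⟨H⟩ := h
  exact TopCat.Homotopy.congr_homologyMap_singularChainComplexFunctor
    (f := circleHom (Circle.exp.comp g)) (g := circleHom 1)
    (((ContinuousMap.Homotopy.refl (⟨ULift.up, continuous_uliftUp⟩ : C(Circle, ULift.{u} Circle))).comp
      H).comp (ContinuousMap.Homotopy.refl (⟨ULift.down, continuous_uliftDown⟩ :
        C(ULift.{u} Circle, Circle)))) _ 1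

theorem rationalH1_map_zpow (K : ℤ) :
    rationalH1.{u}.map (circleHom (ContinuousMap.id Circle ^ K)) = K • 𝟙 _ := by
  have h1 : rationalH1.{u}.map (circleHom (ContinuousMap.id Circle)) = 𝟙 _ :=
    rationalH1.{u}.map_id _
  induction K using Int.induction_on with
  | zero => rw [zpow_zero, rationalH1_map_one, zero_smul]
  | succ n ih => rw [zpow_add_one, rationalH1_map_mul, ih, h1, add_smul, one_smul]
  | pred n ih =>
    have := rationalH1_map_mul.{u} (ContinuousMap.id Circle ^ (-(n : ℤ) - 1)) (ContinuousMap.id Circle)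
    rw [← zpow_add_one, sub_add_cancel, ih, h1] at this
    rw [sub_smul, one_smul, this, add_sub_cancel_right]

theorem rationalH1_map_of_degree {f : C(Circle, Circle)} {K : ℤ} {g : Circle → ℝ}
    (hg : Continuous g) (h : ∀ w, f w = w ^ K * Circle.exp (g w)) :
    rationalH1.{u}.map (circleHom f) = K • 𝟙 _ := by
  have : f = (ContinuousMap.id Circle ^ K) * Circle.exp.comp ⟨g, hg⟩ := by
    ext w
    simp [h w]
  rw [this, rationalH1_map_mul, rationalH1_map_zpow, rationalH1_map_exp, add_zero]

theorem loopClass_comp_of_degree {X : Type u} [TopologicalSpace X] (j : C(Circle, X))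
    {f : C(Circle, Circle)} {K : ℤ} {g : Circle → ℝ}
    (hg : Continuous g) (h : ∀ w, f w = w ^ K * Circle.exp (g w)) :
    loopClass (j.comp f) = K • loopClass j := by
  rw [loopClass_comp, rationalH1_map_of_degree hg h, Preadditive.zsmul_comp, Category.id_comp]

/-- The increment of the logarithm is a real cochain `W` on 1-simplices. It vanishes on boundaries,
because the increments around a triangle cancel, and has the value 2π on the cycle `x₁` that runs
once around the circle. So H₁ is not zero. -/
theorem rationalH1_circle_id_ne_zero : 𝟙 (rationalH1.{u}.obj circleTop) ≠ 0 := by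
  choose θ hθ using exists_expSimplex.{u} (n := 1)
  let v : ∀ {n : ℕ}, Fin (n + 1) → stdSimplex ℝ (Fin (n + 1)) := fun i => stdSimplex.vertex i
  let W₀ : (TopCat.toSSet.obj circleTop.{u}) _⦋1⦌ → ℝ := fun x => θ x (v 1) - θ x (v 0)
  have hW₀ : ∀ g, W₀ (expSimplex g) = g (v 1) - g (v 0) := fun g =>
    (expSimplex_eq (hθ (expSimplex g)) _ _).symm
  let R : ModuleCat.{u} ℚ := ModuleCat.of ℚ (ULift.{u} ℚ)
  let T : ModuleCat.{u} ℚ := ModuleCat.of ℚ (ULift.{u} ℝ)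
  let L : ℝ → (R ⟶ T) := fun r => ModuleCat.ofHom
    { toFun := fun q => ⟨q.down • r⟩
      map_add' := fun a b => ULift.ext _ _ (add_smul _ _ _)
      map_smul' := fun a b => ULift.ext _ _ (mul_smul _ _ _) }
  have hL : ∀ a b c, L a - L b + L c = L (a - b + c) := fun a b c =>
    ModuleCat.hom_ext (LinearMap.ext fun q => ULift.ext _ _ (by
      change q.down • a - q.down • b + q.down • c = q.down • (a - b + c)
      rw [smul_add, smul_sub]))
  obtain ⟨W, hW⟩ := SSet.exists_chainComplex_desc (R := R) (T := T) (TopCat.toSSet.obj circleTop.{u}) (fun x => L (W₀ x))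
  have hd : ((TopCat.toSSet.obj circleTop.{u}).chainComplex R).d 2 1 ≫ W = 0 := by
    refine SSet.chainComplex_hom_ext fun y => ?_
    obtain ⟨g, rfl⟩ := exists_expSimplex y
    rw [← Category.assoc, SSet.ιChainComplex_d, comp_zero, Fin.sum_univ_three]
    rw [δ_expSimplex, δ_expSimplex, δ_expSimplex]
    simp only [Preadditive.add_comp, Preadditive.zsmul_comp, hW, hW₀, v, ContinuousMap.comp_apply,
      ContinuousMap.coe_mk, stdSimplex.map_vertex]
    have h01 : (SimplexCategory.δ (0 : Fin 3)) 1 = 2 := rfl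
    have h00 : (SimplexCategory.δ (0 : Fin 3)) 0 = 1 := rfl
    have h11 : (SimplexCategory.δ (1 : Fin 3)) 1 = 2 := rfl
    have h10 : (SimplexCategory.δ (1 : Fin 3)) 0 = 0 := rfl
    have h21 : (SimplexCategory.δ (2 : Fin 3)) 1 = 1 := rfl
    have h20 : (SimplexCategory.δ (2 : Fin 3)) 0 = 0 := rfl
    rw [h01, h00, h11, h10, h21, h20]
    have hneg : ((-1 : ℤ) ^ ((1 : Fin 3) : ℕ)) = -1 := rfl
    have hpos0 : ((-1 : ℤ) ^ ((0 : Fin 3) : ℕ)) = 1 := rfl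
    have hpos2 : ((-1 : ℤ) ^ ((2 : Fin 3) : ℕ)) = 1 := rfl
    rw [hneg, hpos0, hpos2, one_smul, one_smul, neg_smul, one_smul, ← sub_eq_add_neg]
    refine (hL _ _ _).trans ?_
    rw [show ∀ a b c : ℝ, (c - b) - (c - a) + (b - a) = 0 by intros; ring]
    exact ModuleCat.hom_ext (LinearMap.ext fun q => ULift.ext _ _ (smul_zero _))
  let x₁ : (TopCat.toSSet.obj circleTop.{u}) _⦋1⦌ := expSimplex ⟨fun p => 2 * Real.pi * p.1 1,
    continuous_const.mul ((continuous_apply 1).comp continuous_subtype_val)⟩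
  have hx₁ : (TopCat.toSSet.obj circleTop.{u}).ιChainComplex (R := R) x₁ ≫ ((TopCat.toSSet.obj circleTop.{u}).chainComplex R).d 1 0 = 0 := by
    rw [TopCat.ι_path_d, sub_eq_zero]
    congr 1
    rw [δ_expSimplex, δ_expSimplex]
    refine expSimplex_congr fun p => ?_
    obtain rfl : p = stdSimplex.vertex 0 := Subsingleton.elim _ _
    change Circle.exp (_ * (stdSimplex.map _ (stdSimplex.vertex 0)).1 1) =
      Circle.exp (_ * (stdSimplex.map _ (stdSimplex.vertex 0)).1 1)
    rw [stdSimplex.map_vertex, stdSimplex.map_vertex]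
    have h0 : (SimplexCategory.δ (0 : Fin 2)) 0 = 1 := rfl
    have h1 : (SimplexCategory.δ (1 : Fin 2)) 0 = 0 := rfl
    rw [h0, h1]
    simp
  intro h0
  have hπ : ((TopCat.toSSet.obj circleTop.{u}).chainComplex R).homologyπ 1 = 0 := by
    rw [← Category.comp_id (((TopCat.toSSet.obj circleTop.{u}).chainComplex R).homologyπ 1)]
    exact (congrArg (((TopCat.toSSet.obj circleTop.{u}).chainComplex R).homologyπ 1 ≫ ·) h0).trans comp_zero
  have h1 : (TopCat.toSSet.obj circleTop.{u}).ιChainComplex (R := R) x₁ ≫ W = 0 := by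
    -- The value of a cocycle on a cycle factors through homology, here through the morphism
    -- `homologyπ` that has been shown to vanish.
    rw [← ((TopCat.toSSet.obj circleTop.{u}).chainComplex R).liftCycles_i ((TopCat.toSSet.obj circleTop.{u}).ιChainComplex (R := R) x₁) 0 (by simp) hx₁,
      ← ((TopCat.toSSet.obj circleTop.{u}).chainComplex R).p_descOpcycles W 2 (by simp) hd, Category.assoc,
      ← Category.assoc _ _ (((TopCat.toSSet.obj circleTop.{u}).chainComplex R).descOpcycles W 2 (by simp) hd),
      ← ((TopCat.toSSet.obj circleTop.{u}).chainComplex R).homology_π_ι, hπ]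
    simp
  rw [hW, hW₀] at h1
  have h2 := congrArg (fun f : R ⟶ T => (f.hom ⟨1⟩).down) h1
  change (1 : ℚ) • (2 * Real.pi * (v (1 : Fin 2)).1 1 - 2 * Real.pi * (v (0 : Fin 2)).1 1) = 0 at h2
  simp [v] at h2

/-- Pushed forward by `Φ`, the relation becomes K • 𝟙 = (q M) • 𝟙 on H₁ of the circle, where the
identity is not zero. -/
theorem degree_eq_of_loopClass_eq {X : Type u} [TopologicalSpace X] (Φ : C(X, Circle))
    {l s : C(Circle, X)} {q : ℚ} (hq : loopClass l = q • loopClass s) {K M : ℤ} {g h : Circle → ℝ}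
    (hg : Continuous g) (hl : ∀ w, Φ (l w) = w ^ K * Circle.exp (g w))
    (hh : Continuous h) (hs : ∀ w, Φ (s w) = w ^ M * Circle.exp (h w)) : (K : ℚ) = q * M := by
  let φ : TopCat.of X ⟶ circleTop.{u} := TopCat.ofHom ⟨fun x => ⟨Φ x⟩, by fun_prop⟩
  have key : ∀ f : C(Circle, X), loopClass f ≫ rationalH1.map φ =
      rationalH1.map (circleHom (Φ.comp f)) := fun f => by
    rw [loopClass, ← Functor.map_comp]
    rfl
  have h1 := congrArg (· ≫ rationalH1.map φ) hq
  simp only [Linear.smul_comp] at h1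
  rw [key, key, rationalH1_map_of_degree hg hl, rationalH1_map_of_degree hh hs] at h1
  have h2 : ((K : ℚ) - q * M) • 𝟙 (rationalH1.{u}.obj circleTop) = 0 := by
    rw [sub_smul, sub_eq_zero, mul_smul, Int.cast_smul_eq_zsmul, Int.cast_smul_eq_zsmul]
    exact h1
  rcases smul_eq_zero.1 h2 with h | h
  · linarith
  · exact (rationalH1_circle_id_ne_zero h).elim

end CircleHomology

end

section

/-! ### Charts and transition maps -/

/-- The identification of `ℂ` with the Euclidean plane. -/
def complexPlane : ℂ ≃L[ℝ] EuclideanSpace ℝ (Fin 2) :=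
  Complex.orthonormalBasisOneI.repr.toContinuousLinearEquiv

instance : IsContDiffCompatible ℂ := ⟨Iff.rfl⟩

/-- Plots are defined on whole Euclidean spaces. To apply them on an open set `W`, a ball in `W`
around `t` is parameterised smoothly by the whole space. -/
theorem exists_reparam_ball {E : Type*} [NormedAddCommGroup E] [InnerProductSpace ℝ E] {W : Set E}
    (hW : IsOpen W) {t : E} (ht : t ∈ W) : ∃ (f g : E → E) (N : Set E), ContDiff ℝ ∞ f ∧
      (∀ s, f s ∈ W) ∧ IsOpen N ∧ t ∈ N ∧ N ⊆ W ∧ ContDiffOn ℝ ∞ g N ∧ (∀ s ∈ N, f (g s) = s) ∧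
      f 0 = t ∧ g t = 0 := by
  obtain ⟨r, hr, hrW⟩ := Metric.isOpen_iff.1 hW t ht
  let u := OpenPartialHomeomorph.univBall t r
  have htar : u.target = ball t r := OpenPartialHomeomorph.univBall_target t hr
  have hsrc : u.source = univ := OpenPartialHomeomorph.univBall_source t r
  have h0 : u 0 = t := OpenPartialHomeomorph.univBall_apply_zero t r
  refine ⟨u, u.symm, ball t r, OpenPartialHomeomorph.contDiff_univBall, fun s => hrW ?_,
    isOpen_ball, mem_ball_self hr, hrW, OpenPartialHomeomorph.contDiffOn_univBall_symm,
    fun s hs => u.right_inv (htar.symm ▸ hs), h0, ?_⟩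
  · exact htar ▸ u.map_source (by rw [hsrc]; trivial)
  · rw [← h0]
    exact u.left_inv (by rw [hsrc]; trivial)

section Continuity

variable {X Y : Type*} [TopologicalSpace X] [DiffeologicalSpace X] [IsDTopologyCompatible X]
  [TopologicalSpace Y] [DiffeologicalSpace Y] [IsDTopologyCompatible Y]

theorem isOpen_iff_plots {s : Set X} : IsOpen s ↔
    ∀ (n : ℕ) (p : EuclideanSpace ℝ (Fin n) → X), IsPlot p → IsOpen (p ⁻¹' s) := by
  rw [← isOpen_iff_preimages_plots, IsDTopologyCompatible.dTop_eq X]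

theorem Diffeology.IsPlot.continuous_compatible {n : ℕ} {p : EuclideanSpace ℝ (Fin n) → X}
    (hp : IsPlot p) : Continuous p :=
  continuous_def.2 fun _ hs => isOpen_iff_plots.1 hs n p hp

/-- Translating the plot moves any parameter to the origin. -/
theorem isOpen_of_local_plots {s : Set X} (hs : ∀ (n : ℕ) (p : EuclideanSpace ℝ (Fin n) → X),
    IsPlot p → p 0 ∈ s → p ⁻¹' s ∈ nhds 0) : IsOpen s := by
  rw [isOpen_iff_plots]
  intro n p hp
  rw [isOpen_iff_mem_nhds]
  intro t ht
  have := hs n (p ∘ fun s => s + t) (isPlot_reparam hp (by fun_prop)) (by simpa using ht)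
  have h2 : Filter.Tendsto (fun s => s - t) (nhds t) (nhds 0) := by
    have : Continuous fun s : EuclideanSpace ℝ (Fin n) => s - t := by fun_prop
    simpa using this.tendsto t
  filter_upwards [h2 this] with s hs
  simpa using hs

theorem DSmoothOn.continuousOn {f : X → Y} {s : Set X} (hs : IsOpen s) (hf : DSmoothOn f s) :
    ContinuousOn f s := by
  rw [continuousOn_open_iff hs]
  intro O hO
  refine isOpen_of_local_plots fun n p hp h0 => ?_
  obtain ⟨φ, g, N, hφ, hφW, hN, h0N, hNW, hg, hφg, -, -⟩ :=
    exists_reparam_ball (isOpen_iff_plots.1 hs n p hp) (t := 0) h0.1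
  have hpl := (hf n (p ∘ φ) (isPlot_reparam hp hφ) hφW).continuous_compatible
  have hev : ∀ t ∈ N, ((f ∘ p ∘ φ) ∘ g) t = f (p t) := fun t ht => by simp [hφg t ht]
  filter_upwards [hN.mem_nhds h0N, ((hpl.comp_continuousOn hg.continuousOn).isOpen_inter_preimage
    hN hO).mem_nhds ⟨h0N, by rw [mem_preimage, hev 0 h0N]; exact h0.2⟩] with t ht ht2
  refine ⟨hNW ht, ?_⟩
  have := ht2.2
  rwa [mem_preimage, hev t ht] at this

end Continuity

theorem DSmoothOn.mono {X Y : Type*} [DiffeologicalSpace X] [DiffeologicalSpace Y] {f : X → Y}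
    {s t : Set X} (hf : DSmoothOn f s) (h : t ⊆ s) : DSmoothOn f t :=
  fun n p hp ht => hf n p hp fun x => h (ht x)

theorem isPreconnected_punctured_ball (r : ℝ) : IsPreconnected (ball (0 : ℂ) r \ {0}) := by
  rcases le_or_gt r 0 with hr | hr
  · rw [ball_eq_empty.2 hr]
    simpa using isPreconnected_empty
  have : ball (0 : ℂ) r \ {0} = Complex.exp '' {ζ | ζ.re < Real.log r} := by
    ext z
    constructor
    · rintro ⟨hz, h0⟩
      refine ⟨Complex.log z, ?_, Complex.exp_log h0⟩
      rw [mem_ofPred_eq, Complex.log_re]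
      exact Real.log_lt_log (norm_pos_iff.2 h0) (by simpa using hz)
    · rintro ⟨ζ, hζ, rfl⟩
      refine ⟨?_, Complex.exp_ne_zero ζ⟩
      rw [mem_ball_zero_iff, Complex.norm_exp]
      exact (Real.lt_log_iff_exp_lt hr).1 hζ
  rw [this]
  exact (convex_halfSpace_re_lt _).isPreconnected.image _ Complex.continuous_exp.continuousOn

namespace OrbifoldChart

variable {X : Type*} [TopologicalSpace X] [DiffeologicalSpace X]

theorem norm_eq_one_of_pow {c : OrbifoldChart X} {ξ : ℂ} (h : ξ ^ c.order = 1) : ‖ξ‖ = 1 :=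
  (pow_eq_one_iff_of_nonneg (norm_nonneg ξ) c.order_pos.ne').1 (by rw [← norm_pow, h, norm_one])

theorem rot_mem {c : OrbifoldChart X} {ξ : ℂ} (h : ξ ^ c.order = 1) {r : ℝ} {z : ℂ}
    (hz : z ∈ ball (0 : ℂ) r) : ξ * z ∈ ball (0 : ℂ) r := by
  simpa [norm_eq_one_of_pow h] using hz

theorem apply_rot (c : OrbifoldChart X) {ξ : ℂ} (h : ξ ^ c.order = 1) {z : ℂ}
    (hz : z ∈ ball (0 : ℂ) 2) : c (ξ * z) = c z :=
  ((c.fibres z hz _ (rot_mem h hz)).2 ⟨ξ, h, rfl⟩).symm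

theorem mem_image (c : OrbifoldChart X) {z : ℂ} (hz : z ∈ ball (0 : ℂ) 2) : c z ∈ c.image :=
  mem_image_of_mem _ hz

theorem eq_of_order_eq_one (c : OrbifoldChart X) (hc : c.order = 1) {z w : ℂ}
    (hz : z ∈ ball (0 : ℂ) 2) (hw : w ∈ ball (0 : ℂ) 2) (h : c z = c w) : z = w := by
  obtain ⟨ξ, hξ, rfl⟩ := (c.fibres z hz w hw).1 h
  simp [show ξ = 1 by simpa [hc] using hξ]

/-- Transfers the lifting property of charts from plots on all of ℝⁿ to smooth maps on open subsets
of ℂ. -/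
theorem exists_local_lift (c : OrbifoldChart X) {W : Set ℂ} (hW : IsOpen W) {q : ℂ → X}
    (hq : DSmoothOn q W) (hm : MapsTo q W c.image) {z : ℂ} (hz : z ∈ W) :
    ∃ (U : Set ℂ) (h : ℂ → ℂ), IsOpen U ∧ z ∈ U ∧ U ⊆ W ∧ ContDiffOn ℝ ∞ h U ∧
      ∀ w ∈ U, h w ∈ ball 0 2 ∧ c (h w) = q w := by
  obtain ⟨φ, g, N, hφ, hφW, hN, h0N, hNW, hg, hφg, hφ0, hg0⟩ := exists_reparam_ball hW hz
  obtain ⟨U, p, hU, h0, hp, hpU⟩ := c.lift 2 (q ∘ φ ∘ complexPlane.symm)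
    (hq 2 (φ ∘ complexPlane.symm) (hφ.comp complexPlane.symm.contDiff).isPlot
      fun t => hφW _) (fun t => hm (hφW _)) 0
  have hgc : ContinuousOn (fun w => complexPlane (g w)) N :=
    complexPlane.continuous.comp_continuousOn hg.continuousOn
  refine ⟨N ∩ (fun w => complexPlane (g w)) ⁻¹' U, fun w => p (complexPlane (g w)),
    hgc.isOpen_inter_preimage hN hU, ⟨h0N, ?_⟩, fun w hw => hNW hw.1, ?_, ?_⟩
  · simpa [hg0] using h0
  · exact hp.comp ((complexPlane.contDiff.comp_contDiffOn hg).mono inter_subset_left)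
      fun w hw => hw.2
  · rintro w ⟨hw, hwU⟩
    refine ⟨(hpU _ hwU).1, (hpU _ hwU).2.trans ?_⟩
    simp [hφg w hw]

variable [IsTwoOrbifold X]

theorem continuousOn (c : OrbifoldChart X) : ContinuousOn c (ball 0 2) :=
  c.smooth.continuousOn isOpen_ball

/-- A continuous map of the domain of a chart that is the identity on the orbifold is a rotation. -/
theorem exists_rotation (a : OrbifoldChart X) {U : Set ℂ} (hU : IsOpen U) {z : ℂ} (hz : z ∈ U)
    (hU2 : U ⊆ ball 0 2) {k : ℂ → ℂ} (hk : ContinuousOn k U)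
    (hka : ∀ w ∈ U, k w ∈ ball 0 2 ∧ a (k w) = a w) :
    ∃ ξ : ℂ, ξ ^ a.order = 1 ∧ ∀ᶠ w in nhds z, k w = ξ * w := by
  -- The set `ball z ε \ {0}` is to be connected: for z = 0 it is a punctured disc, otherwise the
  -- disc is taken so small that it misses 0. On it k(w)/w is continuous with values in the finite
  -- group of rotations, hence constant.
  obtain ⟨ε, hε, hεU⟩ : ∃ ε > 0, ball z ε ⊆ U ∧ IsPreconnected (ball z ε \ {0}) := by
    obtain ⟨ε, hε, hεU⟩ := Metric.isOpen_iff.1 hU z hz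
    rcases eq_or_ne z 0 with rfl | h0
    · exact ⟨ε, hε, hεU, isPreconnected_punctured_ball ε⟩
    · refine ⟨min ε ‖z‖, lt_min hε (norm_pos_iff.2 h0),
        (ball_subset_ball (min_le_left _ _)).trans hεU, ?_⟩
      rw [sdiff_singleton_eq_self]
      · exact (convex_ball _ _).isPreconnected
      · simp
  obtain ⟨hεU, hpre⟩ := hεU
  have hfib : ∀ w ∈ ball z ε, ∃ ξ : ℂ, ξ ^ a.order = 1 ∧ k w = ξ * w := fun w hw =>
    (a.fibres w (hU2 (hεU hw)) (k w) (hka w (hεU hw)).1).1 (hka w (hεU hw)).2.symm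
  have hfin : {ξ : ℂ | ξ ^ a.order = 1}.Finite := by
    refine (Polynomial.nthRoots a.order (1 : ℂ)).toFinset.finite_toSet.subset fun ξ hξ => ?_
    simpa [Polynomial.mem_nthRoots a.order_pos] using hξ
  have hcon : ContinuousOn (fun w => k w / w) (ball z ε \ {0}) :=
    (hk.mono (sdiff_subset.trans hεU)).div continuousOn_id fun w hw => hw.2
  have hmaps : MapsTo (fun w => k w / w) (ball z ε \ {0}) {ξ : ℂ | ξ ^ a.order = 1} := by
    rintro w ⟨hw, h0⟩
    obtain ⟨ξ, hξ, h⟩ := hfib w hw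
    simpa [h, mul_div_cancel_right₀ ξ (show w ≠ 0 from h0)] using hξ
  obtain ⟨w₀, hw₀⟩ : (ball z ε \ {0}).Nonempty := by
    rcases eq_or_ne z 0 with rfl | h0
    · refine ⟨(ε / 2 : ℝ), ?_, by simpa using hε.ne'⟩
      rw [mem_ball_zero_iff, Complex.norm_real, Real.norm_of_nonneg] <;> linarith
    · exact ⟨z, mem_ball_self hε, h0⟩
  refine ⟨k w₀ / w₀, hmaps hw₀, ?_⟩
  filter_upwards [ball_mem_nhds z hε] with w hw
  rcases eq_or_ne w 0 with rfl | h0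
  · obtain ⟨ξ, -, h⟩ := hfib 0 hw
    simp [h]
  · have := hpre.constant_of_mapsTo hfin.isDiscrete hcon hmaps ⟨hw, h0⟩ hw₀
    rw [← this, div_mul_cancel₀ _ h0]

end OrbifoldChart

/-! ### Changes of charts as local lifts of the identity. -/

section Transition

variable {X : Type*} [TopologicalSpace X] [DiffeologicalSpace X] [IsTwoOrbifold X]
  {a b c : OrbifoldChart X} {h k : ℂ → ℂ} {z w : ℂ}

/-- `h` lifts the chart `a` to the chart `b` near `z`. -/
def IsChartLift {X : Type*} [TopologicalSpace X] [DiffeologicalSpace X]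
    (a b : OrbifoldChart X) (h : ℂ → ℂ) (z : ℂ) : Prop :=
  ∃ U : Set ℂ, IsOpen U ∧ z ∈ U ∧ U ⊆ ball 0 2 ∧ ContDiffOn ℝ ∞ h U ∧
    ∀ w ∈ U, h w ∈ ball 0 2 ∧ b (h w) = a w

theorem IsTransition.isChartLift (hh : IsTransition a b h z) : IsChartLift a b h z := hh.1

namespace IsChartLift

theorem mem_left (hh : IsChartLift a b h z) : z ∈ ball 0 2 := by
  obtain ⟨U, -, hz, hU2, -⟩ := hh
  exact hU2 hz

theorem mem_right (hh : IsChartLift a b h z) : h z ∈ ball 0 2 := by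
  obtain ⟨U, -, hz, -, -, h⟩ := hh
  exact (h z hz).1

theorem apply (hh : IsChartLift a b h z) : b (h z) = a z := by
  obtain ⟨U, -, hz, -, -, h⟩ := hh
  exact (h z hz).2

theorem eventually (hh : IsChartLift a b h z) : ∀ᶠ w in nhds z, IsChartLift a b h w := by
  obtain ⟨U, hU, hz, h⟩ := hh
  filter_upwards [hU.mem_nhds hz] with w hw
  exact ⟨U, hU, hw, h⟩

theorem contDiffAt (hh : IsChartLift a b h z) : ContDiffAt ℝ ∞ h z := by
  obtain ⟨U, hU, hz, -, h, -⟩ := hh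
  exact h.contDiffAt (hU.mem_nhds hz)

theorem differentiableAt (hh : IsChartLift a b h z) : DifferentiableAt ℝ h z :=
  hh.contDiffAt.differentiableAt (by simp)

theorem comp (hk : IsChartLift b c k (h z)) (hh : IsChartLift a b h z) :
    IsChartLift a c (k ∘ h) z := by
  obtain ⟨U, hU, hz, hU2, hs, hh⟩ := hh
  obtain ⟨V, hV, hw, -, ht, h'⟩ := hk
  refine ⟨U ∩ h ⁻¹' V, hs.continuousOn.isOpen_inter_preimage hU hV, ⟨hz, hw⟩,
    inter_subset_left.trans hU2, ht.comp (hs.mono inter_subset_left) fun _ hw => hw.2, ?_⟩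
  rintro w ⟨hw, hw'⟩
  exact ⟨(h' _ hw').1, (h' _ hw').2.trans (hh w hw).2⟩

theorem rotate {ξ : ℂ} (hξ : ξ ^ b.order = 1) (hh : IsChartLift a b h z) :
    IsChartLift a b (fun w => ξ * h w) z := by
  obtain ⟨U, hU, hz, hU2, hs, h⟩ := hh
  exact ⟨U, hU, hz, hU2, contDiffOn_const.mul hs, fun w hw =>
    ⟨OrbifoldChart.rot_mem hξ (h w hw).1, (b.apply_rot hξ (h w hw).1).trans (h w hw).2⟩⟩

/-- Any local lift sends `z` to some point of the orbit of `w`; a rotation corrects it. -/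
theorem exists_of_eq (a b : OrbifoldChart X) (hz : z ∈ ball 0 2) (hw : w ∈ ball 0 2)
    (hab : a z = b w) : ∃ h, IsChartLift a b h z ∧ h z = w := by
  obtain ⟨U, h, hU, hzU, hUW, hs, hh⟩ := b.exists_local_lift
    (a.continuousOn.isOpen_inter_preimage isOpen_ball b.isOpen_image)
    (a.smooth.mono inter_subset_left) (fun x hx => hx.2)
    (z := z) ⟨hz, w, hw, hab.symm⟩
  have h1 : IsChartLift a b h z := ⟨U, hU, hzU, fun x hx => (hUW hx).1, hs, hh⟩
  obtain ⟨ξ, hξ, hξw⟩ := (b.fibres (h z) h1.mem_right w hw).1 (h1.apply.trans hab)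
  exact ⟨_, h1.rotate hξ, hξw.symm⟩

theorem exists_rotation (hk : IsChartLift a a k z) :
    ∃ ξ : ℂ, ξ ^ a.order = 1 ∧ ∀ᶠ w in nhds z, k w = ξ * w := by
  obtain ⟨U, hU, hz, hU2, hs, h⟩ := hk
  exact a.exists_rotation hU hz hU2 hs.continuousOn h

/-- A lift `k` back to the first chart makes k ∘ h a lift of `a` to itself, which is a rotation. Its
inverse is absorbed into `k`. -/
theorem exists_leftInverse (hh : IsChartLift a b h z) :
    ∃ k, IsChartLift b a k (h z) ∧ ∀ᶠ w in nhds z, k (h w) = w := by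
  obtain ⟨k, hk, hkz⟩ := exists_of_eq b a hh.mem_right hh.mem_left hh.apply
  obtain ⟨ξ, hξ, he⟩ := (hk.comp hh).exists_rotation
  have hξ0 : ξ ≠ 0 := by
    rintro rfl
    simp [a.order_pos.ne'] at hξ
  refine ⟨_, hk.rotate (ξ := ξ⁻¹) (by rw [inv_pow, hξ, inv_one]), ?_⟩
  filter_upwards [he] with w hw
  rw [show k (h w) = ξ * w from hw, inv_mul_cancel_left₀ hξ0]

/-- The condition on the determinant is automatic, since a smooth left inverse exists. -/
theorem isTransition (hh : IsChartLift a b h z) : IsTransition a b h z := by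
  refine ⟨hh, fun h0 => ?_⟩
  obtain ⟨k, hk, he⟩ := hh.exists_leftInverse
  have h1 : fderiv ℝ (k ∘ h) z = ContinuousLinearMap.id ℝ ℂ := by
    rw [Filter.EventuallyEq.fderiv_eq (show (k ∘ h) =ᶠ[nhds z] id from he)]
    exact fderiv_id
  rw [show fderiv ℝ (k ∘ h) z = _ from fderiv_comp z hk.differentiableAt hh.differentiableAt] at h1
  have h2 := congrArg ContinuousLinearMap.det h1
  have h3 : ((fderiv ℝ k (h z)).comp (fderiv ℝ h z)).det =
    (fderiv ℝ k (h z)).det * (fderiv ℝ h z).det := LinearMap.det_comp _ _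
  rw [h3, h0, mul_zero] at h2
  have h4 : (ContinuousLinearMap.id ℝ ℂ).det = 1 := LinearMap.det_id
  rw [h4] at h2
  exact zero_ne_one h2

end IsChartLift

theorem det_fderiv_comp (hk : DifferentiableAt ℝ k (h z)) (hh : DifferentiableAt ℝ h z) :
    (fderiv ℝ (k ∘ h) z).det = (fderiv ℝ k (h z)).det * (fderiv ℝ h z).det := by
  rw [fderiv_comp z hk hh]
  exact LinearMap.det_comp _ _

theorem det_fderiv_id_eventually (he : ∀ᶠ w in nhds z, h w = w) : (fderiv ℝ h z).det = 1 := by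
  rw [Filter.EventuallyEq.fderiv_eq (f := id) he, fderiv_id]
  exact LinearMap.det_id

end Transition

namespace OrbifoldChart

variable {X : Type*} [TopologicalSpace X] [DiffeologicalSpace X] [IsTwoOrbifold X]

theorem isOpen_image_of_isOpen (c : OrbifoldChart X) {W : Set ℂ} (hW : IsOpen W)
    (hW2 : W ⊆ ball 0 2) : IsOpen (c '' W) := by
  refine isOpen_of_local_plots fun n p hp h0 => ?_
  obtain ⟨z, hz, hzp⟩ := h0
  obtain ⟨φ, g, N, hφ, hφW, hN, h0N, hNW, hg, hφg, hφ0, hg0⟩ :=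
    exists_reparam_ball (isOpen_iff_plots.1 c.isOpen_image n p hp) (t := 0)
      (show p 0 ∈ c '' ball 0 2 from hzp ▸ c.mem_image (hW2 hz))
  obtain ⟨U, q, hU, hU0, hq, hqU⟩ := c.lift n (p ∘ φ) (isPlot_reparam hp hφ) hφW 0
  -- The lifted plot need not pass through `z` but only through its orbit. After a rotation it does,
  -- and then it stays in `W` for nearby parameters.
  obtain ⟨ξ, hξ, hξz⟩ := (c.fibres _ (hqU 0 hU0).1 z (hW2 hz)).1
    ((hqU 0 hU0).2.trans (by simpa [hφ0] using hzp.symm))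
  have hc : ContinuousOn (fun s => ξ * q s) U := continuousOn_const.mul hq.continuousOn
  have hgc := hg.continuousOn.isOpen_inter_preimage hN (hc.isOpen_inter_preimage hU hW)
  filter_upwards [hgc.mem_nhds ⟨h0N, by simpa [hg0, hU0, ← hξz] using hz⟩] with t ht
  refine ⟨ξ * q (g t), ht.2.2, ?_⟩
  rw [c.apply_rot hξ (hqU _ ht.2.1).1, (hqU _ ht.2.1).2]
  simp [hφg t ht.1]

/-- `h` is injective near 0 and maps the orbit of a small nonzero `z` under the first group into the
orbit of `h z` under the second. Counting gives the inequality. -/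
theorem order_le_of_lift {a b : OrbifoldChart X} {h : ℂ → ℂ} (hh : IsChartLift a b h 0) :
    a.order ≤ b.order := by
  obtain ⟨k, -, he⟩ := hh.exists_leftInverse
  obtain ⟨ε, hε, hb⟩ := Metric.eventually_nhds_iff_ball.1 (he.and hh.eventually)
  let z : ℂ := (ε / 2 : ℝ)
  have hz : z ∈ ball (0 : ℂ) ε := by
    rw [mem_ball_zero_iff, Complex.norm_real, Real.norm_of_nonneg] <;> linarith
  have hz0 : z ≠ 0 := by simpa [z] using hε.ne'
  have hΓ : ∀ m : ℕ, 0 < m → {ξ : ℂ | ξ ^ m = 1}.ncard = m := fun m hm => by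
    have := IsPrimitiveRoot.card_nthRootsFinset (Complex.isPrimitiveRoot_exp m hm.ne')
    rw [← Set.ncard_coe_finset] at this
    convert! this using 2
    ext ξ
    simp [Polynomial.mem_nthRootsFinset hm]
  have hfin : {ξ : ℂ | ξ ^ b.order = 1}.Finite :=
    Set.finite_of_ncard_ne_zero (by rw [hΓ _ b.order_pos]; exact b.order_pos.ne')
  have hmap : ∀ ξ : ℂ, ξ ^ a.order = 1 → ∃ η : ℂ, η ^ b.order = 1 ∧ h (ξ * z) = η * h z := by
    intro ξ hξ
    have h1 := (hb _ (rot_mem hξ hz)).2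
    have h2 := (hb _ hz).2
    exact (b.fibres (h z) h2.mem_right _ h1.mem_right).1
      (by rw [h1.apply, h2.apply, a.apply_rot hξ h2.mem_left])
  choose! f hf hfz using hmap
  rw [← hΓ a.order a.order_pos, ← hΓ b.order b.order_pos]
  refine Set.ncard_le_ncard_of_injOn f (fun ξ hξ => hf ξ hξ) (fun ξ hξ η hη hfe => ?_) hfin
  have h1 := hfz ξ hξ
  rw [hfe, ← hfz η hη] at h1
  have h2 := congrArg k h1
  rw [(hb _ (rot_mem hξ hz)).1, (hb _ (rot_mem hη hz)).1] at h2
  exact mul_right_cancel₀ hz0 h2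

theorem order_eq_of_center_eq {a b : OrbifoldChart X} (h : a.center = b.center) :
    a.order = b.order := by
  have h0 : (0 : ℂ) ∈ ball (0 : ℂ) 2 := by simp
  obtain ⟨k, hk, hk0⟩ := IsChartLift.exists_of_eq a b h0 h0 h
  obtain ⟨l, hl, hl0⟩ := IsChartLift.exists_of_eq b a h0 h0 h.symm
  exact le_antisymm (order_le_of_lift hk) (order_le_of_lift hl)

end OrbifoldChart

end

section

/-! ### Restricted charts, regular points and positive charts -/

namespace OrbifoldChart

variable {X : Type*} [TopologicalSpace X] [DiffeologicalSpace X] [IsTwoOrbifold X]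

theorem dSmoothOn_comp (c : OrbifoldChart X) {f : ℂ → ℂ} (hf : ContDiff ℝ ∞ f)
    (hm : MapsTo f (ball 0 2) (ball 0 2)) : DSmoothOn (fun z => c (f z)) (ball 0 2) := by
  intro n p hp hpm
  exact c.smooth n (fun t => f (p t)) (hf.comp (IsPlot.contDiff hp)).isPlot fun t => hm (hpm t)

theorem affine_mem {z₀ : ℂ} {s : ℝ} (hs : 0 < s) {z : ℂ} (hz : z ∈ ball (0 : ℂ) 2) :
    z₀ + s * z ∈ ball z₀ (2 * s) := by
  rw [mem_ball_zero_iff] at hz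
  rw [mem_ball_iff_norm, add_sub_cancel_left, norm_mul, Complex.norm_real, Real.norm_of_nonneg hs.le]
  nlinarith

theorem smul_mem {s : ℝ} (hs : 0 < s) {z : ℂ} (hz : z ∈ ball (0 : ℂ) 2) :
    s * z ∈ ball (0 : ℂ) (2 * s) := by
  simpa only [zero_add] using affine_mem (z₀ := 0) hs hz

theorem image_affine {z₀ : ℂ} {s : ℝ} (hs : 0 < s) :
    (fun z : ℂ => z₀ + s * z) '' ball 0 2 = ball z₀ (2 * s) := by
  have hs0 : (s : ℂ) ≠ 0 := by exact_mod_cast hs.ne'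
  refine Subset.antisymm (image_subset_iff.2 fun z hz => affine_mem hs hz) fun w hw => ?_
  refine ⟨(w - z₀) / s, ?_, by field_simp; ring⟩
  rw [mem_ball_iff_norm] at hw
  rw [mem_ball_zero_iff, norm_div, Complex.norm_real, Real.norm_of_nonneg hs.le, div_lt_iff₀ hs]
  exact hw

/-- The restriction of a chart to a disc on which it is injective. -/
def sub (c : OrbifoldChart X) (z₀ : ℂ) (s : ℝ) (hs : 0 < s) (hsub : ball z₀ (2 * s) ⊆ ball 0 2)
    (hinj : InjOn c (ball z₀ (2 * s))) : OrbifoldChart X where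
  toFun z := c (z₀ + s * z)
  order := 1
  order_pos := one_pos
  isOpen_image := by
    have := c.isOpen_image_of_isOpen (isOpen_ball (x := z₀) (ε := 2 * s)) hsub
    rwa [← image_affine hs, image_image] at this
  fibres z hz w hw := by
    have hs0 : (s : ℂ) ≠ 0 := by exact_mod_cast hs.ne'
    constructor
    · intro h
      have := hinj (affine_mem hs hz) (affine_mem hs hw) h
      exact ⟨1, by simp, by simpa [hs0] using this.symm⟩
    · rintro ⟨ξ, hξ, rfl⟩
      rw [show ξ = 1 by simpa using hξ, one_mul]
  smooth := c.dSmoothOn_comp (by fun_prop) fun z hz => hsub (affine_mem hs hz)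
  lift n q hq hm t := by
    have hs0 : (s : ℂ) ≠ 0 := by exact_mod_cast hs.ne'
    have hm' : ∀ t, q t ∈ c '' ball z₀ (2 * s) := fun t => by
      obtain ⟨z, hz, h⟩ := hm t
      exact ⟨_, affine_mem hs hz, h⟩
    obtain ⟨U, p, hU, htU, hp, h⟩ := c.lift n q hq (fun t => image_mono hsub (hm' t)) t
    obtain ⟨w, hw, hwq⟩ := hm' t
    obtain ⟨ξ, hξ, hξw⟩ := (c.fibres (p t) (h t htU).1 w (hsub hw)).1 ((h t htU).2.trans hwq.symm)
    have hp' : ContDiffOn ℝ ∞ (fun s => ξ * p s) U := contDiffOn_const.mul hp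
    refine ⟨U ∩ (fun s => ξ * p s) ⁻¹' ball z₀ (2 * s), fun x => (ξ * p x - z₀) / s,
      hp'.continuousOn.isOpen_inter_preimage hU isOpen_ball, ⟨htU, by simpa [← hξw] using hw⟩,
      ((hp'.sub contDiffOn_const).div_const _).mono inter_subset_left, ?_⟩
    rintro x ⟨hx, hx'⟩
    have he : z₀ + s * ((ξ * p x - z₀) / s) = ξ * p x := by field_simp; ring
    rw [mem_preimage, ← image_affine hs] at hx'
    obtain ⟨y, hy, hy'⟩ := hx'
    have : (ξ * p x - z₀) / s = y := by
      rw [← hy']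
      field_simp
      ring
    refine ⟨(this ▸ hy : (ξ * p x - z₀) / s ∈ ball (0 : ℂ) 2), ?_⟩
    rw [he, c.apply_rot hξ (h x hx).1, (h x hx).2]

/-- The restriction of a chart to a smaller disc with the same centre. -/
def scale (c : OrbifoldChart X) (s : ℝ) (hs : 0 < s) (hs1 : s ≤ 1) : OrbifoldChart X where
  toFun z := c (s * z)
  order := c.order
  order_pos := c.order_pos
  isOpen_image := by
    have := c.isOpen_image_of_isOpen (isOpen_ball (x := (0 : ℂ)) (ε := 2 * s))
      (ball_subset_ball (by linarith))
    rw [← image_affine hs, image_image] at this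
    simpa using this
  fibres z hz w hw := by
    have hs0 : (s : ℂ) ≠ 0 := by exact_mod_cast hs.ne'
    have hmem : ∀ {z : ℂ}, z ∈ ball (0 : ℂ) 2 → (s : ℂ) * z ∈ ball (0 : ℂ) 2 := fun {z} hz =>
      ball_subset_ball (by linarith) (smul_mem hs hz)
    rw [c.fibres _ (hmem hz) _ (hmem hw)]
    refine exists_congr fun ξ => and_congr_right fun _ => ?_
    rw [mul_left_comm]
    exact mul_right_inj' hs0
  smooth := c.dSmoothOn_comp (by fun_prop) fun z hz =>
    ball_subset_ball (by linarith) (smul_mem hs hz)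
  lift n q hq hm t := by
    have hs0 : (s : ℂ) ≠ 0 := by exact_mod_cast hs.ne'
    have hsub : ball (0 : ℂ) (2 * s) ⊆ ball 0 2 := ball_subset_ball (by linarith)
    have hm' : ∀ t, q t ∈ c '' ball 0 (2 * s) := fun t => by
      obtain ⟨z, hz, h⟩ := hm t
      exact ⟨s * z, smul_mem hs hz, h⟩
    obtain ⟨U, p, hU, htU, hp, h⟩ := c.lift n q hq (fun t => image_mono hsub (hm' t)) t
    refine ⟨U, fun x => p x / s, hU, htU, hp.div_const _, fun x hx => ?_⟩
    have he : (s : ℂ) * (p x / s) = p x := by field_simp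
    refine ⟨?_, by rw [he, (h x hx).2]⟩
    obtain ⟨w, hw, hwq⟩ := hm' x
    obtain ⟨ξ, hξ, hξw⟩ := (c.fibres w (hsub hw) (p x) (h x hx).1).1 (hwq.trans (h x hx).2.symm)
    rw [mem_ball_zero_iff] at hw
    change p x / s ∈ ball (0 : ℂ) 2
    rw [mem_ball_zero_iff, hξw, norm_div, norm_mul, norm_eq_one_of_pow hξ, one_mul,
      Complex.norm_real, Real.norm_of_nonneg hs.le, div_lt_iff₀ hs]
    exact hw

@[simp] theorem sub_apply (c : OrbifoldChart X) {z₀ : ℂ} {s : ℝ} (hs hsub hinj) (z : ℂ) :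
    c.sub z₀ s hs hsub hinj z = c (z₀ + s * z) := rfl

@[simp] theorem scale_apply (c : OrbifoldChart X) {s : ℝ} (hs hs1) (z : ℂ) :
    c.scale s hs hs1 z = c (s * z) := rfl

theorem injOn_of_order_eq_one (c : OrbifoldChart X) (hc : c.order = 1) : InjOn c (ball 0 2) :=
  fun _ hz _ hw h => c.eq_of_order_eq_one hc hz hw h

theorem exists_injOn_ball (c : OrbifoldChart X) {z₀ : ℂ} (hz : z₀ ∈ ball 0 2) (h : z₀ ≠ 0) :
    ∃ δ > 0, ball z₀ δ ⊆ ball 0 2 ∧ InjOn c (ball z₀ δ) := by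
  obtain ⟨ε, hε, hε2⟩ := Metric.isOpen_iff.1 isOpen_ball z₀ hz
  have hfin : ({ξ : ℂ | ξ ^ c.order = 1} \ {1}).Finite := by
    refine ((Polynomial.nthRoots c.order (1 : ℂ)).toFinset.finite_toSet.subset
      fun ξ hξ => ?_).sdiff
    simpa [Polynomial.mem_nthRoots c.order_pos] using hξ
  obtain ⟨η, hη, hη2⟩ := Metric.isOpen_iff.1 hfin.isClosed.isOpen_compl 1 (by simp)
  have hz0 : 0 < ‖z₀‖ := norm_pos_iff.2 h
  -- All nontrivial rotations have distance at least `η` from 1, and ‖z‖ ≥ ‖z₀‖/2 in this disc. So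
  -- such a rotation moves `z` by at least η‖z₀‖/2, whereas two points of the disc are closer than
  -- that.
  refine ⟨min ε (min (‖z₀‖ / 2) (η * ‖z₀‖ / 4)), by positivity,
    (ball_subset_ball (min_le_left _ _)).trans hε2, fun z hz w hw hzw => ?_⟩
  have hsub := (ball_subset_ball (min_le_left ε (min (‖z₀‖ / 2) (η * ‖z₀‖ / 4)))).trans hε2
  obtain ⟨ξ, hξ, rfl⟩ := (c.fibres z (hsub hz) w (hsub hw)).1 hzw
  by_contra hne
  have hξ1 : ξ ≠ 1 := by
    rintro rfl
    simp at hne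
  have h1 : η ≤ ‖ξ - 1‖ := by
    by_contra! hlt
    exact hη2 (mem_ball_iff_norm.2 hlt) ⟨hξ, hξ1⟩
  rw [mem_ball_iff_norm, lt_min_iff, lt_min_iff] at hz hw
  have h2 : ‖(ξ - 1) * z‖ ≤ ‖ξ * z - z₀‖ + ‖z - z₀‖ := by
    rw [show (ξ - 1) * z = (ξ * z - z₀) - (z - z₀) by ring]
    exact norm_sub_le _ _
  have h3 : ‖z₀‖ / 2 ≤ ‖z‖ := by
    have := norm_sub_norm_le z₀ z
    rw [norm_sub_rev] at this
    linarith [hz.2.1]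
  rw [norm_mul] at h2
  nlinarith [hz.2.2, hw.2.2, mul_le_mul h1 h3 (by positivity) (norm_nonneg _)]

/-- Restricting the chart gives a chart of order 1 centred at the point, and the order at a centre
is unique. -/
theorem notMem_singularSet_of_injOn (c : OrbifoldChart X) {z₀ : ℂ} {δ : ℝ} (hδ : 0 < δ)
    (hsub : ball z₀ δ ⊆ ball 0 2) (hinj : InjOn c (ball z₀ δ)) : c z₀ ∉ singularSet X := by
  rintro ⟨b, hb, hb1⟩
  have h2 : 2 * (δ / 2) = δ := by ring
  have := order_eq_of_center_eq (a := b) (b := c.sub z₀ (δ / 2) (by positivity) (by rwa [h2])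
    (by rwa [h2])) (by rw [hb]; simp [center])
  exact hb1 this

theorem notMem_singularSet (c : OrbifoldChart X) {z : ℂ} (hz : z ∈ ball 0 2) (h : z ≠ 0) :
    c z ∉ singularSet X := by
  obtain ⟨δ, hδ, hs, hi⟩ := c.exists_injOn_ball hz h
  exact c.notMem_singularSet_of_injOn hδ hs hi

theorem order_eq_one (c : OrbifoldChart X) (h : c.center ∉ singularSet X) : c.order = 1 := by
  by_contra h1
  exact h ⟨c, rfl, h1⟩

theorem isChartLift_affine {c e : OrbifoldChart X} {z₀ : ℂ} {s : ℝ}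
    (he : ∀ z ∈ ball (0 : ℂ) 2, z₀ + s * z ∈ ball 0 2 ∧ e z = c (z₀ + s * z)) {z : ℂ}
    (hz : z ∈ ball (0 : ℂ) 2) : IsChartLift e c (fun z => z₀ + s * z) z :=
  ⟨ball 0 2, isOpen_ball, hz, subset_rfl, by fun_prop, fun w hw => ⟨(he w hw).1, (he w hw).2.symm⟩⟩

theorem sub_affine (c : OrbifoldChart X) {z₀ : ℂ} {s : ℝ} (hs hsub hinj) :
    ∀ z ∈ ball (0 : ℂ) 2, z₀ + s * z ∈ ball (0 : ℂ) 2 ∧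
      c.sub z₀ s hs hsub hinj z = c (z₀ + s * z) :=
  fun _ hz => ⟨hsub (affine_mem hs hz), rfl⟩

theorem scale_affine (c : OrbifoldChart X) {s : ℝ} (hs hs1) :
    ∀ z ∈ ball (0 : ℂ) 2, 0 + s * z ∈ ball (0 : ℂ) 2 ∧ c.scale s hs hs1 z = c (0 + s * z) :=
  fun z hz => ⟨ball_subset_ball (by linarith) (affine_mem hs hz), by simp⟩

end OrbifoldChart

theorem fderiv_affine (z₀ : ℂ) (s : ℝ) (z : ℂ) :
    fderiv ℝ (fun z : ℂ => z₀ + s * z) z = s • ContinuousLinearMap.id ℝ ℂ := by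
  have h : HasFDerivAt (fun z : ℂ => z₀ + s • z) (s • ContinuousLinearMap.id ℝ ℂ) z :=
    ((hasFDerivAt_id z).const_smul s).const_add z₀
  simpa only [Complex.real_smul] using h.fderiv

theorem det_fderiv_affine (z₀ : ℂ) (s : ℝ) (z : ℂ) :
    (fderiv ℝ (fun z : ℂ => z₀ + s * z) z).det = s ^ 2 := by
  rw [fderiv_affine]
  have := LinearMap.det_smul s (LinearMap.id : ℂ →ₗ[ℝ] ℂ)
  rw [Complex.finrank_real_complex, LinearMap.det_id, mul_one] at this
  exact this

namespace OrbifoldOrientation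

variable {X : Type*} [TopologicalSpace X] [DiffeologicalSpace X] [IsTwoOrbifold X]
  {o : OrbifoldOrientation X} {a b c e : OrbifoldChart X} {h : ℂ → ℂ} {z z₀ : ℂ}

theorem isPositive_of_mem (ha : a ∈ o.atlas) : o.IsPositive a :=
  fun b hb h z hh => o.compatible b hb a ha h z hh

theorem IsPositive.of_affine (hc : o.IsPositive c) {s : ℝ} (hs : 0 < s)
    (he : ∀ z ∈ ball (0 : ℂ) 2, z₀ + s * z ∈ ball 0 2 ∧ e z = c (z₀ + s * z)) :
    o.IsPositive e := by
  intro a ha h z hh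
  have h1 : IsChartLift e c (fun z => z₀ + s * z) (h z) :=
    OrbifoldChart.isChartLift_affine he hh.isChartLift.mem_right
  have h2 := hc a ha _ z (h1.comp hh.isChartLift).isTransition
  rw [det_fderiv_comp h1.differentiableAt hh.isChartLift.differentiableAt, det_fderiv_affine] at h2
  exact (pos_iff_pos_of_mul_pos h2).1 (by positivity)

theorem IsPositive.det_pos_of_regular (ha : o.IsPositive a) (hb : o.IsPositive b)
    (hh : IsChartLift a b h z) (hz : a z ∉ singularSet X) : 0 < (fderiv ℝ h z).det := by
  obtain ⟨c, hc, u, hu, hcu⟩ := o.covers _ hz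
  obtain ⟨k, hk, rfl⟩ := IsChartLift.exists_of_eq c a hu hh.mem_left hcu
  have h1 := ha c hc k u hk.isTransition
  have h2 := hb c hc _ u (hh.comp hk).isTransition
  rw [det_fderiv_comp hh.differentiableAt hk.differentiableAt] at h2
  exact (pos_iff_pos_of_mul_pos h2).2 h1

/-- Positivity of charts is tested at regular points only. At a cone point the determinant is
nonzero and, by continuity, has the sign it has at nearby points, which are regular. -/
theorem IsPositive.det_pos (ha : o.IsPositive a) (hb : o.IsPositive b)
    (hh : IsChartLift a b h z) : 0 < (fderiv ℝ h z).det := by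
  by_cases hz : a z ∈ singularSet X
  · by_contra! hle
    have hlt : (fderiv ℝ h z).det < 0 := lt_of_le_of_ne hle hh.isTransition.2
    have hz0 : z = 0 := by
      by_contra h0
      exact a.notMem_singularSet hh.mem_left h0 hz
    subst hz0
    have hc : ContinuousAt (fun w => (fderiv ℝ h w).det) 0 :=
      (ContinuousLinearMap.continuous_det.continuousAt).comp
        (hh.contDiffAt.fderiv_right (m := 0) (by simp)).continuousAt
    obtain ⟨w, ⟨hw1, hw2⟩, hw0⟩ := (((hc.eventually (gt_mem_nhds hlt)).and
      hh.eventually).filter_mono nhdsWithin_le_nhds |>.and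
      (self_mem_nhdsWithin : ({0}ᶜ : Set ℂ) ∈ nhdsWithin 0 {0}ᶜ)).exists
    exact (ha.det_pos_of_regular hb hw2 (a.notMem_singularSet hw2.mem_left hw0)).not_gt hw1
  · exact ha.det_pos_of_regular hb hh hz

/-- Every singular point is the centre of a positive chart. -/
def HasPositiveCharts (o : OrbifoldOrientation X) : Prop :=
  ∀ x ∈ singularSet X, ∃ c, o.IsPositive c ∧ c.center = x

theorem IsPositive.exists_scale (hc : o.IsPositive c) {W : Set X} (hW : W ∈ nhds c.center) :
    ∃ s, ∃ (hs : 0 < s) (hs1 : s ≤ 1), o.IsPositive (c.scale s hs hs1) ∧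
      (c.scale s hs hs1).image ⊆ W := by
  have h0 : ContinuousAt c 0 := c.continuousOn.continuousAt (ball_mem_nhds _ two_pos)
  obtain ⟨ε, hε, hεW⟩ := Metric.mem_nhds_iff.1 (h0 hW)
  refine ⟨min 1 (ε / 2), by positivity, min_le_left _ _,
    hc.of_affine (by positivity) (c.scale_affine _ _), ?_⟩
  rintro _ ⟨z, hz, rfl⟩
  refine hεW (ball_subset_ball ?_ (OrbifoldChart.smul_mem (by positivity) hz))
  linarith [min_le_right 1 (ε / 2)]

theorem HasPositiveCharts.exists_chart (ho : o.HasPositiveCharts) {x : X} {W : Set X}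
    (hW : W ∈ nhds x) : ∃ c, o.IsPositive c ∧ c.center = x ∧ c.image ⊆ W := by
  suffices ∃ c, o.IsPositive c ∧ c.center = x by
    obtain ⟨c, hc, rfl⟩ := this
    obtain ⟨s, hs, hs1, h1, h2⟩ := hc.exists_scale hW
    exact ⟨_, h1, by simp [OrbifoldChart.center], h2⟩
  by_cases hx : x ∈ singularSet X
  · exact ho x hx
  obtain ⟨a, ha, z, hz, rfl⟩ := o.covers x hx
  obtain ⟨ε, hε, hε2⟩ := Metric.isOpen_iff.1 isOpen_ball z hz
  have h2 : 2 * (ε / 2) = ε := by ring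
  refine ⟨a.sub z (ε / 2) (by positivity) (by rwa [h2]) ?_,
    (isPositive_of_mem ha).of_affine (s := ε / 2) (by positivity) (a.sub_affine _ _ _), ?_⟩
  swap
  · change a (z + _ * 0) = a z
    rw [mul_zero, add_zero]
  rw [h2]
  exact (a.injOn_of_order_eq_one (o.order_eq_one a ha)).mono hε2

end OrbifoldOrientation

end

section

/-! ### Rays in the tangent orbibundle -/

section Rays

variable {X : Type*} [TopologicalSpace X] [DiffeologicalSpace X] [IsTwoOrbifold X]

theorem IsChartLift.refl {a : OrbifoldChart X} {z : ℂ} (hz : z ∈ ball (0 : ℂ) 2) :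
    IsChartLift a a id z :=
  ⟨ball 0 2, isOpen_ball, hz, subset_rfl, contDiffOn_id, fun _ hw => ⟨hw, rfl⟩⟩

theorem IsChartLift.fderiv_ne_zero {a b : OrbifoldChart X} {h : ℂ → ℂ} {z : ℂ}
    (hh : IsChartLift a b h z) {v : ℂ} (hv : v ≠ 0) : fderiv ℝ h z v ≠ 0 := fun h0 =>
  hv (ContinuousLinearMap.injective_of_det_ne_zero hh.isTransition.2 (by rw [h0, map_zero]))

/-- Two tangent vectors in charts span the same ray. -/
def RayRel (p q : PreTangent X) : Prop :=
  ∃ (h : ℂ → ℂ) (t : ℝ), 0 < t ∧ IsChartLift p.1 q.1 h p.2.1 ∧ h p.2.1 = q.2.1 ∧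
    fderiv ℝ h p.2.1 p.2.2 = t * q.2.2

namespace RayRel

variable {p q r : PreTangent X}

theorem symm (hpq : RayRel p q) : RayRel q p := by
  obtain ⟨h, t, ht, hh, hq, hv⟩ := hpq
  obtain ⟨k, hk, he⟩ := hh.exists_leftInverse
  have h1 : (fderiv ℝ k (h p.2.1)).comp (fderiv ℝ h p.2.1) = ContinuousLinearMap.id ℝ ℂ := by
    rw [← show fderiv ℝ (k ∘ h) _ = _ from fderiv_comp _ hk.differentiableAt hh.differentiableAt,
      Filter.EventuallyEq.fderiv_eq (show (k ∘ h) =ᶠ[nhds _] id from he)]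
    exact fderiv_id
  have h2 := congrArg (fun L : ℂ →L[ℝ] ℂ => L p.2.2) h1
  simp only [ContinuousLinearMap.comp_apply, hv, ContinuousLinearMap.id_apply] at h2
  rw [← Complex.real_smul, map_smul, Complex.real_smul] at h2
  refine ⟨k, t⁻¹, inv_pos.2 ht, hq ▸ hk, by rw [← hq]; exact he.self_of_nhds, ?_⟩
  rw [← hq, ← h2]
  have : (t : ℂ) ≠ 0 := by exact_mod_cast ht.ne'
  push_cast
  field_simp

theorem trans (hpq : RayRel p q) (hqr : RayRel q r) : RayRel p r := by
  obtain ⟨h, t, ht, hh, hq, hv⟩ := hpq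
  obtain ⟨k, s, hs, hk, hr, hw⟩ := hqr
  rw [← hq] at hk hr hw
  refine ⟨k ∘ h, s * t, mul_pos hs ht, hk.comp hh, hr, ?_⟩
  rw [show fderiv ℝ (k ∘ h) _ = _ from fderiv_comp _ hk.differentiableAt hh.differentiableAt,
    ContinuousLinearMap.comp_apply, hv, ← Complex.real_smul, map_smul, hw, Complex.real_smul]
  push_cast
  ring

theorem of_tangentRel (h : TangentRel p q) : RayRel p q := by
  obtain ⟨h, hh, hq, hv⟩ := h
  exact ⟨h, 1, one_pos, hh.isChartLift, hq, by simpa using hv⟩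

end RayRel

namespace SphereTangent

variable {a b c : OrbifoldChart X} {h : ℂ → ℂ}

theorem ray_eq_of_rayRel {z w : ball (0 : ℂ) 2} {v u : Circle}
    (hr : RayRel ⟨a, z, v⟩ ⟨b, w, u⟩) : ray a z v = ray b w u := by
  obtain ⟨h, t, ht, hh, hq, hv⟩ := hr
  refine (Quot.sound ⟨b, w, u, t, ht, rfl, ?_⟩ : Quot.mk _ _ = Quot.mk _ _).symm
  exact Quot.sound ⟨h, hh.isTransition, hq, hv⟩

/-- `RayRel` is symmetric and transitive and absorbs both identifications in the construction of the
bundle, so spanning the same ray as a given vector is a predicate that descends through both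
quotients. -/
theorem rayRel_of_ray_eq {z w : ball (0 : ℂ) 2} {v u : Circle} (hr : ray a z v = ray b w u) :
    RayRel ⟨a, z, v⟩ ⟨b, w, u⟩ := by
  let r : PreTangent X := ⟨a, z, v⟩
  let T : TangentOrbibundle X → Prop := Quot.lift (fun q => RayRel r q) fun p q hpq =>
    propext ⟨fun h => h.trans (.of_tangentRel hpq), fun h => h.trans (RayRel.of_tangentRel hpq).symm⟩
  have hT : ∀ ξ η : NonzeroTangent X, PositiveMultiple ξ η → T ξ.1 = T η.1 := by
    rintro ξ η ⟨c, w, u, t, ht, hξ, hη⟩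
    rw [hξ, hη]
    have key : RayRel (⟨c, w, u⟩ : PreTangent X) ⟨c, w, t * u⟩ := by
      refine ⟨id, t⁻¹, inv_pos.2 ht, .refl w.2, rfl, ?_⟩
      have : (t : ℂ) ≠ 0 := by exact_mod_cast ht.ne'
      rw [fderiv_id]
      simp [this]
    exact propext ⟨fun h => h.trans key, fun h => h.trans key.symm⟩
  have h1 := congrArg (Quot.lift (fun ξ : NonzeroTangent X => T ξ.1) hT) hr
  exact h1.mp ⟨id, 1, one_pos, .refl z.2, rfl, by rw [fderiv_id]; simp [r]⟩

open Classical in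
/-- The direction `v` at the point `z` of the domain of the chart `c`, with a conventional value
for `z` outside the domain. -/
def rayAt {X : Type*} [TopologicalSpace X] [DiffeologicalSpace X] (c : OrbifoldChart X) (z : ℂ) (v : Circle) : SphereTangent X :=
  if hz : z ∈ ball (0 : ℂ) 2 then ray c ⟨z, hz⟩ v else ray c ⟨0, by simp⟩ v

theorem rayAt_of_mem {z : ℂ} (hz : z ∈ ball (0 : ℂ) 2) (v : Circle) :
    rayAt c z v = ray c ⟨z, hz⟩ v := dif_pos hz

theorem rayAt_coe (z : ball (0 : ℂ) 2) (v : Circle) : rayAt c z v = ray c z v := dif_pos z.2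

theorem proj_rayAt {z : ℂ} (hz : z ∈ ball (0 : ℂ) 2) (v : Circle) : proj (rayAt c z v) = c z := by
  rw [rayAt_of_mem hz]
  rfl

theorem rayAt_eq_iff {z w : ℂ} (hz : z ∈ ball (0 : ℂ) 2) (hw : w ∈ ball (0 : ℂ) 2) {v u : Circle} :
    rayAt a z v = rayAt b w u ↔
      ∃ h, IsChartLift a b h z ∧ h z = w ∧ dir (fderiv ℝ h z v) = u := by
  rw [rayAt_of_mem hz, rayAt_of_mem hw]
  constructor
  · intro h
    obtain ⟨h, t, ht, hh, hq, hv⟩ := rayRel_of_ray_eq h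
    exact ⟨h, hh, hq, by rw [show fderiv ℝ h z v = t * (u : ℂ) from hv, dir_ofReal_mul_coe ht]⟩
  · rintro ⟨h, hh, hq, hv⟩
    have h0 := hh.fderiv_ne_zero v.coe_ne_zero
    refine ray_eq_of_rayRel ⟨h, ‖fderiv ℝ h z v‖, norm_pos_iff.2 h0, hh, hq, ?_⟩
    rw [← hv]
    exact (norm_mul_dir _).symm

theorem rayAt_lift {z : ℂ} (hh : IsChartLift a b h z) (v : Circle) :
    rayAt a z v = rayAt b (h z) (dir (fderiv ℝ h z v)) :=
  (rayAt_eq_iff hh.mem_left hh.mem_right).2 ⟨h, hh, rfl, rfl⟩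

/-- The lifts of a chart to itself are rotations, and these are their own differentials. -/
theorem rayAt_eq_iff_same {z w : ℂ} (hz : z ∈ ball (0 : ℂ) 2) (hw : w ∈ ball (0 : ℂ) 2)
    {v u : Circle} : rayAt c z v = rayAt c w u ↔
      ∃ ξ : ℂ, ξ ^ c.order = 1 ∧ w = ξ * z ∧ (u : ℂ) = ξ * v := by
  have key : ∀ ξ : ℂ, ξ ^ c.order = 1 → (dir (ξ * v) : ℂ) = ξ * v := fun ξ hξ => by
    have hn : ‖ξ * (v : ℂ)‖ = 1 := by
      rw [norm_mul, OrbifoldChart.norm_eq_one_of_pow hξ, Circle.norm_coe, one_mul]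
    have := norm_mul_dir (ξ * v)
    rwa [hn, Complex.ofReal_one, one_mul] at this
  have hd : ∀ ξ : ℂ, fderiv ℝ (fun w => ξ * w) z v = ξ * v := fun ξ => by
    rw [fderiv_const_mul differentiableAt_fun_id]
    simp
  rw [rayAt_eq_iff hz hw]
  constructor
  · rintro ⟨h, hh, rfl, rfl⟩
    obtain ⟨ξ, hξ, he⟩ := hh.exists_rotation
    refine ⟨ξ, hξ, he.self_of_nhds, ?_⟩
    rw [Filter.EventuallyEq.fderiv_eq (show h =ᶠ[nhds z] (fun w => ξ * w) from he), hd, key ξ hξ]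
  · rintro ⟨ξ, hξ, rfl, hu⟩
    refine ⟨fun w => ξ * w, (IsChartLift.refl hz).rotate hξ, rfl, ?_⟩
    rw [hd]
    ext
    rw [key ξ hξ, hu]

theorem rayAt_injective {z : ℂ} (hz : z ∈ ball (0 : ℂ) 2) (h0 : c.order = 1 ∨ z ≠ 0)
    {v u : Circle} (h : rayAt c z v = rayAt c z u) : v = u := by
  obtain ⟨ξ, hξ, h1, h2⟩ := (rayAt_eq_iff_same hz hz).1 h
  have : ξ = 1 := by
    rcases h0 with h0 | h0
    · simpa [h0] using hξ
    · exact (mul_eq_right₀ h0).1 h1.symm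
  ext
  rw [h2, this, one_mul]

theorem exists_rayAt_eq {z : ℂ} (hz : z ∈ ball (0 : ℂ) 2) {ξ : SphereTangent X}
    (h : proj ξ = c z) : ∃ v, rayAt c z v = ξ := by
  obtain ⟨⟨ξ, hξ⟩, rfl⟩ := Quot.exists_rep ξ
  obtain ⟨⟨a, w, v⟩, rfl⟩ := Quot.exists_rep ξ
  have hv : v ≠ 0 := hξ
  have h1 : (Quot.mk _ ⟨Quot.mk _ ⟨a, w, v⟩, hξ⟩ : SphereTangent X) = ray a w (dir v) := by
    refine (Quot.sound ⟨a, w, dir v, ‖v‖, norm_pos_iff.2 hv, rfl, ?_⟩ :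
      Quot.mk _ _ = Quot.mk _ _).symm
    rw [norm_mul_dir]
    rfl
  rw [h1]
  obtain ⟨h, hh, rfl⟩ := IsChartLift.exists_of_eq a c w.2 hz h
  exact ⟨_, by rw [← rayAt_coe, rayAt_lift hh]⟩

theorem continuousOn_rayAt :
    ContinuousOn (fun p : ℂ × Circle => rayAt c p.1 p.2) (ball 0 2 ×ˢ univ) := by
  have h1 : Continuous fun p : ball (0 : ℂ) 2 × Circle => ray c p.1 p.2 := by
    have h2 : Continuous fun p : ball (0 : ℂ) 2 × Circle =>
        (⟨c, p.1, p.2⟩ : PreTangent X) :=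
      continuous_sigmaMk.comp (continuous_fst.prodMk (continuous_subtype_val.comp continuous_snd))
    have h3 : Continuous fun p : ball (0 : ℂ) 2 × Circle =>
        (⟨TangentOrbibundle.mk c p.1 p.2, p.2.coe_ne_zero⟩ : NonzeroTangent X) :=
      Continuous.subtype_mk (continuous_quot_mk.comp h2) _
    exact continuous_quot_mk.comp h3
  rw [continuousOn_iff_continuous_domRestrict]
  have h4 : Continuous fun p : ↥(ball (0 : ℂ) 2 ×ˢ (univ : Set Circle)) =>
      ((⟨p.1.1, p.2.1⟩, p.1.2) : ball (0 : ℂ) 2 × Circle) := by fun_prop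
  refine (h1.comp h4).congr fun p => ?_
  exact (rayAt_of_mem p.2.1 _).symm

/-- Openness in the two-fold quotient is tested in an arbitrary chart `a`. There the transition and
its differential act continuously on points and directions and carry nearby vectors into `W`. -/
theorem isOpen_image_rayAt {W : Set (ℂ × Circle)} (hW : IsOpen W) (hW2 : W ⊆ ball 0 2 ×ˢ univ) :
    IsOpen ((fun p : ℂ × Circle => rayAt c p.1 p.2) '' W) := by
  set O := (fun p : ℂ × Circle => rayAt c p.1 p.2) '' W
  change IsOpen ((Quot.mk _ : NonzeroTangent X → SphereTangent X) ⁻¹' O)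
  let O' : Set (TangentOrbibundle X) := {ξ | ∃ h : ¬ ξ.IsZero, (Quot.mk _ ⟨ξ, h⟩ : SphereTangent X) ∈ O}
  suffices IsOpen O' by
    convert! this.preimage continuous_subtype_val using 1
    ext ξ
    exact ⟨fun h => ⟨ξ.2, h⟩, fun h => h.2⟩
  change IsOpen ((Quot.mk _ : PreTangent X → TangentOrbibundle X) ⁻¹' O')
  rw [isOpen_sigma_iff]
  intro a
  rw [isOpen_iff_mem_nhds]
  have hrep : ∀ (w : ball (0 : ℂ) 2) (v : ℂ) (hv : v ≠ 0),
      (Quot.mk _ ⟨TangentOrbibundle.mk a w v, hv⟩ : SphereTangent X) = rayAt a w (dir v) := by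
    intro w v hv
    rw [rayAt_coe]
    refine (Quot.sound ⟨a, w, dir v, ‖v‖, norm_pos_iff.2 hv, rfl, ?_⟩ :
      Quot.mk _ _ = Quot.mk _ _).symm
    rw [norm_mul_dir]
  rintro ⟨w, v⟩ ⟨hv, ⟨z, u⟩, hzu, he⟩
  replace hv : v ≠ 0 := hv
  replace he : rayAt c z u = rayAt a w (dir v) := he.trans (hrep w v hv)
  obtain ⟨h, hh, rfl, rfl⟩ := (rayAt_eq_iff w.2 (hW2 hzu).1).1 he.symm
  have hc : ContinuousAt (fun p : ball (0 : ℂ) 2 × ℂ =>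
      (h p.1, dir (fderiv ℝ h p.1 (dir p.2)))) (w, v) := by
    have hd : ContinuousAt (fun p : ball (0 : ℂ) 2 × ℂ => (dir p.2 : ℂ)) (w, v) :=
      (continuous_subtype_val (p := (· ∈ Submonoid.unitSphere ℂ))).continuousAt.comp
        (ContinuousAt.comp (f := Prod.snd) (continuousAt_dir hv) continuousAt_snd)
    have h1 : ContinuousAt (fun p : ball (0 : ℂ) 2 × ℂ => (p.1 : ℂ)) (w, v) := by fun_prop
    refine ContinuousAt.prodMk (ContinuousAt.comp (g := h) hh.contDiffAt.continuousAt h1) ?_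
    refine ContinuousAt.comp (g := dir)
      (continuousAt_dir (hh.fderiv_ne_zero (dir v).coe_ne_zero)) ?_
    exact (ContinuousAt.comp (g := fderiv ℝ h) (x := ((w, v) : ball (0 : ℂ) 2 × ℂ))
      (hh.contDiffAt.fderiv_right (m := 0) (by simp)).continuousAt h1).clm_apply hd
  have h1 : ∀ᶠ p : ball (0 : ℂ) 2 × ℂ in nhds (w, v), IsChartLift a c h p.1 :=
    (show ContinuousAt (fun p : ball (0 : ℂ) 2 × ℂ => (p.1 : ℂ)) (w, v) by fun_prop).tendsto.eventually
      hh.eventually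
  filter_upwards [hc.preimage_mem_nhds (hW.mem_nhds hzu), h1,
    continuousAt_snd.eventually (isOpen_ne.mem_nhds hv)] with p hp hp1 hp0
  refine ⟨hp0, _, hp, ?_⟩
  exact (rayAt_lift hp1 _).symm.trans (hrep p.1 p.2 hp0).symm

/-- Functions on the circle bundle are given by invariant functions in charts. -/
theorem exists_descend {T : Type*} [TopologicalSpace T] [Nonempty T] (c : OrbifoldChart X)
    {A : Set ℂ} (hA : IsOpen A) (hA2 : A ⊆ ball 0 2) (f : ℂ → Circle → T)
    (hf : ContinuousOn (fun p : ℂ × Circle => f p.1 p.2) (A ×ˢ univ))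
    (hinv : ∀ z ∈ A, ∀ v u : Circle, ∀ ξ : ℂ, ξ ^ c.order = 1 → (u : ℂ) = ξ * v →
      f (ξ * z) u = f z v) :
    ∃ Φ : SphereTangent X → T, (∀ z ∈ A, ∀ v, Φ (rayAt c z v) = f z v) ∧
      ∀ z ∈ A, ∀ v, ContinuousAt Φ (rayAt c z v) := by
  classical
  let Φ : SphereTangent X → T := fun ξ =>
    if h : ∃ p : ℂ × Circle, p.1 ∈ A ∧ rayAt c p.1 p.2 = ξ then f h.choose.1 h.choose.2
      else Classical.arbitrary T
  have hΦ : ∀ z ∈ A, ∀ v, Φ (rayAt c z v) = f z v := by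
    intro z hz v
    have h : ∃ p : ℂ × Circle, p.1 ∈ A ∧ rayAt c p.1 p.2 = rayAt c z v := ⟨(z, v), hz, rfl⟩
    obtain ⟨ξ, hξ, h1, h2⟩ := (rayAt_eq_iff_same (hA2 hz) (hA2 h.choose_spec.1)).1
      h.choose_spec.2.symm
    simp only [Φ, dif_pos h]
    rw [h1]
    exact hinv z hz v _ ξ hξ h2
  refine ⟨Φ, hΦ, fun z hz v => ?_⟩
  intro N hN
  rw [hΦ z hz v] at hN
  obtain ⟨N', hN', hNo, hzN⟩ := mem_nhds_iff.1 hN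
  have ho := hf.isOpen_inter_preimage (hA.prod isOpen_univ) hNo
  rw [Filter.mem_map]
  filter_upwards [(isOpen_image_rayAt (c := c) ho fun p hp => ⟨hA2 hp.1.1, trivial⟩).mem_nhds
    ⟨(z, v), ⟨⟨hz, trivial⟩, hzN⟩, rfl⟩]
  rintro _ ⟨p, ⟨⟨hp, -⟩, hp'⟩, rfl⟩
  rw [mem_preimage, hΦ _ hp]
  exact hN' hp'

/-- The vectors of a section in a chart. -/
theorem exists_vec (c : OrbifoldChart X) {A : Set ℂ} (hA : A ⊆ ball 0 2)
    (h0 : c.order = 1 ∨ 0 ∉ A) {σ : X → SphereTangent X} (hσ : ContinuousOn (fun z => σ (c z)) A)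
    (hs : ∀ z ∈ A, proj (σ (c z)) = c z) :
    ∃ v : ℂ → Circle, ContinuousOn v A ∧ ∀ z ∈ A, σ (c z) = rayAt c z (v z) := by
  have hv : ∀ z, ∃ v, z ∈ A → rayAt c z v = σ (c z) := fun z => by
    by_cases hz : z ∈ A
    · exact (exists_rayAt_eq (hA hz) (hs z hz)).imp fun v h _ => h
    · exact ⟨1, fun h => (hz h).elim⟩
  choose v hv using hv
  refine ⟨v, ?_, fun z hz => (hv z hz).symm⟩
  rcases h0 with h0 | h0
  -- With trivial group the direction itself descends to the bundle.
  · obtain ⟨Φ, h1, h2⟩ := exists_descend c isOpen_ball subset_rfl (fun _ v => v)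
      continuousOn_snd (by
        intro z hz v u ξ hξ hu
        rw [show ξ = 1 by simpa [h0] using hξ, one_mul] at hu
        exact Circle.ext hu)
    have h3 : ContinuousOn (fun z => Φ (σ (c z))) A := fun z hz => by
      refine ContinuousAt.comp_continuousWithinAt (g := Φ) ?_ (hσ z hz)
      rw [← hv z hz]
      exact h2 z (hA hz) _
    refine h3.congr fun z hz => ?_
    beta_reduce
    rw [← hv z hz, h1 z (hA hz)]
  -- Away from the centre the group rotates `v` and `dir z` alike, so their quotient descends, and
  -- `v` is recovered as a product with `dir z`.
  · obtain ⟨Φ, h1, h2⟩ := exists_descend c (isOpen_ball.sdiff isClosed_singleton)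
      (sdiff_subset (t := {0})) (fun z v => v * (dir z)⁻¹)
      (continuousOn_snd.mul (continuousOn_dir.comp continuousOn_fst fun p hp => hp.1.2).inv) (by
        rintro z ⟨hz, hz0⟩ v u ξ hξ hu
        have hξ1 := OrbifoldChart.norm_eq_one_of_pow hξ
        have hz0 : z ≠ 0 := hz0
        have hξ0 : ξ ≠ 0 := by
          rintro rfl
          simp at hξ1
        ext
        rw [Circle.coe_mul, Circle.coe_mul, Circle.coe_inv, Circle.coe_inv,
          coe_dir hz0, coe_dir (mul_ne_zero hξ0 hz0), norm_mul, hξ1, hu]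
        have : (‖z‖ : ℂ) ≠ 0 := by simpa using hz0
        push_cast
        field_simp)
    have hA0 : ∀ z ∈ A, z ∈ ball (0 : ℂ) 2 \ {0} := fun z hz => ⟨hA hz, fun h => h0 (h ▸ hz)⟩
    have h3 : ContinuousOn (fun z => Φ (σ (c z)) * dir z) A := fun z hz => by
      refine ContinuousWithinAt.mul ?_ (continuousAt_dir (hA0 z hz).2).continuousWithinAt
      refine ContinuousAt.comp_continuousWithinAt (g := Φ) ?_ (hσ z hz)
      rw [← hv z hz]
      exact h2 z (hA0 z hz) _
    refine h3.congr fun z hz => ?_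
    beta_reduce
    rw [← hv z hz, h1 z (hA0 z hz), inv_mul_cancel_right]

theorem continuousOn_rayAt_comp {T : Type*} [TopologicalSpace T] {s : Set T} {f : T → ℂ}
    {v : T → Circle} (hf : ContinuousOn f s) (hm : MapsTo f s (ball 0 2)) (hv : ContinuousOn v s) :
    ContinuousOn (fun t => rayAt c (f t) (v t)) s :=
  (continuousOn_rayAt (c := c)).comp (hf.prodMk hv) fun _ ht => ⟨hm ht, trivial⟩

end SphereTangent

/-- Continuity on an invariant set may be checked in a chart. -/
theorem OrbifoldChart.continuousOn_image (c : OrbifoldChart X) {Y : Type*} [TopologicalSpace Y]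
    {f : X → Y} {A : Set ℂ} (hA : A ⊆ ball 0 2) (hinv : ∀ z ∈ A, ∀ ξ : ℂ, ξ ^ c.order = 1 → ξ * z ∈ A)
    (hf : ContinuousOn (fun z => f (c z)) A) : ContinuousOn f (c '' A) := by
  rintro _ ⟨z, hz, rfl⟩
  intro N hN
  obtain ⟨V, hV, hzV, h⟩ := mem_nhdsWithin.1 (hf z hz hN)
  refine mem_nhdsWithin.2 ⟨c '' (V ∩ ball 0 2), c.isOpen_image_of_isOpen (hV.inter isOpen_ball)
    inter_subset_right, ⟨z, ⟨hzV, hA hz⟩, rfl⟩, ?_⟩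
  rintro _ ⟨⟨w, ⟨hwV, hw2⟩, rfl⟩, ⟨y, hy, hyw⟩⟩
  obtain ⟨ξ, hξ, rfl⟩ := (c.fibres y (hA hy) w hw2).1 hyw
  exact h ⟨hwV, hinv y hy ξ hξ⟩

end Rays

/-! ### Rotation of vectors by orientation preserving maps -/

/-- A real linear map has the form u ↦ α u + β ū with determinant |α|² - |β|². If this is positive,
the conformal part dominates, with δ = |α| - |β|. -/
theorem exists_near_conformal (L : ℂ →L[ℝ] ℂ) (hL : 0 < L.det) :
    ∃ (α : ℂ) (δ : ℝ), 0 < δ ∧ ∀ u, ‖L u - α * u‖ ≤ (‖α‖ - δ) * ‖u‖ := by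
  let α : ℂ := (L 1 - Complex.I * L Complex.I) / 2
  let β : ℂ := (L 1 + Complex.I * L Complex.I) / 2
  have hdet : L.det = ‖α‖ ^ 2 - ‖β‖ ^ 2 := by
    have h1 : L.det = LinearMap.det (L : ℂ →ₗ[ℝ] ℂ) := rfl
    rw [h1, ← LinearMap.det_toMatrix Complex.basisOneI, Matrix.det_fin_two,
      Complex.sq_norm, Complex.sq_norm]
    simp only [LinearMap.toMatrix_apply, Complex.coe_basisOneI, Complex.coe_basisOneI_repr,
      Complex.normSq_apply, α, β]
    simp
    ring
  have hlt : ‖β‖ < ‖α‖ := by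
    refine lt_of_pow_lt_pow_left₀ 2 (norm_nonneg _) ?_
    linarith
  refine ⟨α, ‖α‖ - ‖β‖, by linarith, fun u => ?_⟩
  have hu : L u = u.re * L 1 + u.im * L Complex.I := by
    conv_lhs => rw [← Complex.re_add_im u]
    rw [map_add, show (u.re : ℂ) = u.re • (1 : ℂ) by simp,
      show (u.im : ℂ) * Complex.I = u.im • Complex.I by simp, map_smul, map_smul]
    simp
  have h2 : L u - α * u = β * (starRingEnd ℂ) u := by
    rw [hu]
    apply Complex.ext <;> simp [α, β] <;> ring
  rw [h2, norm_mul, RCLike.norm_conj]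
  apply le_of_eq
  ring

/-- An orientation preserving local diffeomorphism winds once around the image point: (h z - h
z₀)/(z - z₀) stays close to the values of (α u + β ū)/u, which lie in a disc around α that misses 0.
-/
theorem exists_expOn_dir_sub {h : ℂ → ℂ} {z₀ : ℂ} {U : Set ℂ} (hU : U ∈ nhds z₀)
    (hc : ContinuousOn h U) (hd : DifferentiableAt ℝ h z₀) (hdet : 0 < (fderiv ℝ h z₀).det) :
    ∃ ε > 0, (∀ z ∈ ball z₀ ε \ {z₀}, h z ≠ h z₀) ∧
      ExpOn (fun z => dir (h z - h z₀) * (dir (z - z₀))⁻¹) (ball z₀ ε \ {z₀}) := by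
  obtain ⟨α, δ, hδ, hα⟩ := exists_near_conformal _ hdet
  have h1 := hd.hasFDerivAt.isLittleO.def (c := δ / 2) (by positivity)
  obtain ⟨ε, hε, hb⟩ := Metric.eventually_nhds_iff_ball.1 (h1.and (Filter.eventually_mem_set.2 hU))
  have key : ∀ z ∈ ball z₀ ε \ {z₀}, ‖(h z - h z₀) / (z - z₀) - α‖ < ‖α‖ := by
    rintro z ⟨hz, hz0⟩
    have hz0 : z - z₀ ≠ 0 := sub_ne_zero.2 hz0
    have h2 := (hb z hz).1
    have h3 := hα (z - z₀)
    rw [show (h z - h z₀) / (z - z₀) - α = ((h z - h z₀ - fderiv ℝ h z₀ (z - z₀)) +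
      (fderiv ℝ h z₀ (z - z₀) - α * (z - z₀))) / (z - z₀) by field_simp; ring, norm_div,
      div_lt_iff₀ (norm_pos_iff.2 hz0)]
    refine (norm_add_le _ _).trans_lt ?_
    have := norm_pos_iff.2 hz0
    nlinarith
  have hne : ∀ z ∈ ball z₀ ε \ {z₀}, h z - h z₀ ≠ 0 := fun z hz h0 => by
    have := key z hz
    simp [h0] at this
  refine ⟨ε, hε, fun z hz => sub_ne_zero.1 (hne z hz), ?_⟩
  refine (expOn_dir_of_near (f := fun z => (h z - h z₀) / (z - z₀)) ?_ α key).congr fun z hz => ?_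
  · exact ((hc.mono fun z hz => (hb z hz.1).2).sub continuousOn_const).div (by fun_prop)
      fun z hz => sub_ne_zero.2 hz.2
  · have h0 : z - z₀ ≠ 0 := sub_ne_zero.2 hz.2
    rw [mul_inv_eq_iff_eq_mul, ← dir_mul (div_ne_zero (hne z hz) h0) h0, div_mul_cancel₀ _ h0]

/-- The differential turns directions in a way that is homotopic to the identity, by the same
estimate and uniformly in the base point. -/
theorem exists_expOn_dir_fderiv {h : ℂ → ℂ} {z₀ : ℂ} (hc : ContDiffAt ℝ ∞ h z₀)
    (hdet : 0 < (fderiv ℝ h z₀).det) :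
    ∃ ε > 0, ExpOn (fun p : ℂ × Circle => dir (fderiv ℝ h p.1 p.2) * (p.2)⁻¹)
      (ball z₀ ε ×ˢ univ) := by
  obtain ⟨α, δ, hδ, hα⟩ := exists_near_conformal _ hdet
  have h1 : ContinuousAt (fderiv ℝ h) z₀ := (hc.fderiv_right (m := 0) (by simp)).continuousAt
  obtain ⟨V, hV, hVc⟩ : ∃ V ∈ nhds z₀, ContinuousOn (fderiv ℝ h) V := by
    obtain ⟨V, hV, hVc⟩ := (hc.fderiv_right (m := 0) (by simp)).contDiffOn (m := 0) le_rfl (by simp)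
    exact ⟨V, by simpa using hV, fun x hx => (hVc x hx).continuousWithinAt⟩
  obtain ⟨ε, hε, hb⟩ := Metric.eventually_nhds_iff_ball.1
    ((h1.eventually (ball_mem_nhds _ hδ)).and (Filter.eventually_mem_set.2 hV))
  have key : ∀ p ∈ ball z₀ ε ×ˢ (univ : Set Circle), ‖fderiv ℝ h p.1 p.2 / p.2 - α‖ < ‖α‖ := by
    rintro ⟨z, v⟩ ⟨hz, -⟩
    have h2 := (hb z hz).1
    rw [dist_eq_norm] at h2
    have h3 := hα v
    rw [Circle.norm_coe, mul_one] at h3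
    have h4 := (fderiv ℝ h z - fderiv ℝ h z₀).le_opNorm v
    rw [Circle.norm_coe, mul_one, sub_apply] at h4
    have hv := v.coe_ne_zero
    rw [show fderiv ℝ h z v / v - α = ((fderiv ℝ h z v - fderiv ℝ h z₀ v) +
      (fderiv ℝ h z₀ v - α * v)) / v by field_simp; ring, norm_div, Circle.norm_coe, div_one]
    refine (norm_add_le _ _).trans_lt ?_
    linarith
  refine ⟨ε, hε, (expOn_dir_of_near (f := fun p : ℂ × Circle => fderiv ℝ h p.1 p.2 / p.2)
    ?_ α key).congr fun p hp => ?_⟩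
  · refine ContinuousOn.div ?_ (by fun_prop) fun p _ => p.2.coe_ne_zero
    exact (hVc.comp continuousOn_fst fun p hp => (hb _ hp.1).2).clm_apply (by fun_prop)
  · have hv := p.2.coe_ne_zero
    have hne : fderiv ℝ h p.1 p.2 / p.2 ≠ 0 := fun h0 => by
      have := key p hp
      simp [h0] at this
    have h1 := dir_mul hne hv
    rw [div_mul_cancel₀ _ hv, dir_coe] at h1
    rw [h1, mul_inv_cancel_right]

end

section

/-! ### The index of a section at a point -/

theorem HasDegAt.exists_continuousOn {F : ℂ → Circle} {p : ℂ} {K : ℤ} (h : HasDegAt F p K) :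
    ∃ ε > 0, ContinuousOn F (ball p ε \ {p}) := by
  obtain ⟨ε, hε, h⟩ := h
  refine ⟨ε, hε, ?_⟩
  have h1 : ContinuousOn (fun z => dir (z - p)) (ball p ε \ {p}) :=
    continuousOn_dir.comp (by fun_prop) fun z hz => sub_ne_zero.2 hz.2
  refine (h.continuousOn.mul (h1.zpow K)).congr fun z _ => ?_
  change F z = F z * dir (z - p) ^ (-K) * dir (z - p) ^ K
  rw [zpow_neg, inv_mul_cancel_right]

theorem HasDegAt.comp_affine {F : ℂ → Circle} {p : ℂ} {K : ℤ} (h : HasDegAt F p K) {s : ℝ}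
    (hs : 0 < s) : HasDegAt (fun z => F (p + s * z)) 0 K := by
  obtain ⟨ε, hε, h⟩ := h
  have hs0 : (s : ℂ) ≠ 0 := by exact_mod_cast hs.ne'
  refine ⟨ε / s, by positivity, ?_⟩
  refine (h.comp (f := fun z => p + s * z) (by fun_prop) ?_).congr fun z _ => ?_
  · rintro z ⟨hz, hz0⟩
    refine ⟨?_, by simpa [hs0] using hz0⟩
    rw [mem_ball_zero_iff, lt_div_iff₀ hs] at hz
    rw [mem_ball_iff_norm, add_sub_cancel_left, norm_mul, Complex.norm_real,
      Real.norm_of_nonneg hs.le, mul_comm]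
    exact hz
  · rw [add_sub_cancel_left, dir_ofReal_mul hs, sub_zero]

open SphereTangent

variable {X : Type*} [TopologicalSpace X] [DiffeologicalSpace X] [IsTwoOrbifold X]
  {o : OrbifoldOrientation X} {c : OrbifoldChart X} {σ τ : X → SphereTangent X} {p : X} {q r : ℚ}

/-- The section `σ`, defined around `p`, has index `q` at `p`. -/
def HasIdx {X : Type*} [TopologicalSpace X] [DiffeologicalSpace X] (o : OrbifoldOrientation X)
    (σ : X → SphereTangent X) (p : X) (q : ℚ) : Prop :=
  ∃ (c : OrbifoldChart X) (v : ℂ → Circle) (K : ℤ), o.IsPositive c ∧ c.center = p ∧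
    q = K / c.order ∧ HasDegAt v 0 K ∧ ∃ ε > 0, ∀ z ∈ ball (0 : ℂ) ε \ {0},
      σ (c z) = rayAt c z (v z)

theorem OrbifoldChart.apply_ne_center (c : OrbifoldChart X) {z : ℂ} (hz : z ∈ ball (0 : ℂ) 2)
    (h0 : z ≠ 0) : c z ≠ c.center := by
  intro h
  obtain ⟨ξ, -, h1⟩ := (c.fibres 0 (by simp) z hz).1 h.symm
  exact h0 (by simpa using h1)

theorem ball_min_subset (z : ℂ) (r s : ℝ) : ball z (min r s) \ {z} ⊆ ball z r \ {z} :=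
  sdiff_subset_sdiff_left (ball_subset_ball (min_le_left _ _))

theorem ball_min_subset' (z : ℂ) (r s : ℝ) : ball z (min r s) \ {z} ⊆ ball z s \ {z} :=
  sdiff_subset_sdiff_left (ball_subset_ball (min_le_right _ _))

/-- A change of charts `h` gives u(h z) = dir(dh(v z)). As `h` winds once around its value at 0 and
`dh` turns directions like the identity, `v` and `u` have the same degree. The orders agree because
the centres do. -/
theorem HasIdx.unique (hq : HasIdx o σ p q) (hr : HasIdx o σ p r) : q = r := by
  obtain ⟨a, v, K, ha, hap, rfl, hv, ε₁, hε₁, hσ⟩ := hq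
  obtain ⟨b, u, L, hb, hbp, rfl, hu, ε₂, hε₂, hσ'⟩ := hr
  have h0 : (0 : ℂ) ∈ ball (0 : ℂ) 2 := by simp
  obtain ⟨h, hh, hh0⟩ := IsChartLift.exists_of_eq a b h0 h0 (hap.trans hbp.symm)
  have hdet := ha.det_pos hb hh
  obtain ⟨U, hU, h0U, hU2, hUs, hUh⟩ := hh
  have hh : IsChartLift a b h 0 := ⟨U, hU, h0U, hU2, hUs, hUh⟩
  obtain ⟨ε₃, hε₃, hne, hE⟩ := exists_expOn_dir_sub (hU.mem_nhds h0U) hUs.continuousOn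
    hh.differentiableAt hdet
  obtain ⟨ε₄, hε₄, hF⟩ := exists_expOn_dir_fderiv hh.contDiffAt hdet
  obtain ⟨ε₅, hε₅, hvc⟩ := hv.exists_continuousOn
  obtain ⟨ε₆, hε₆, huE⟩ := id hu
  have hev : ∀ᶠ z in nhds (0 : ℂ), IsChartLift a b h z ∧ h z ∈ ball (0 : ℂ) (min ε₂ ε₆) :=
    hh.eventually.and (hh.contDiffAt.continuousAt.eventually (by
      rw [hh0]
      exact ball_mem_nhds _ (lt_min hε₂ hε₆)))
  obtain ⟨ε₇, hε₇, hev⟩ := Metric.eventually_nhds_iff_ball.1 hev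
  obtain ⟨ε, hε, hle⟩ : ∃ ε > 0, ε ≤ ε₁ ∧ ε ≤ ε₃ ∧ ε ≤ ε₄ ∧ ε ≤ ε₅ ∧ ε ≤ ε₇ :=
    ⟨min ε₁ (min ε₃ (min ε₄ (min ε₅ ε₇))), by positivity, by simp⟩
  have hsub : ∀ {δ}, ε ≤ δ → ball (0 : ℂ) ε \ {0} ⊆ ball 0 δ \ {0} := fun h =>
    sdiff_subset_sdiff_left (ball_subset_ball h)
  have hK : HasDegAt v 0 L := by
    have hhm : ∀ z ∈ ball (0 : ℂ) ε \ {0}, h z ∈ ball (0 : ℂ) (min ε₂ ε₆) \ {0} := fun z hz =>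
      ⟨(hev z (hsub hle.2.2.2.2 hz).1).2, fun h1 => hne z (hsub hle.2.1 hz) (by rw [hh0]; exact h1)⟩
    have hcont : ContinuousOn h (ball (0 : ℂ) ε \ {0}) := fun z hz =>
      (hev z (hsub hle.2.2.2.2 hz).1).1.contDiffAt.continuousAt.continuousWithinAt
    have h1 := huE.comp (f := h) (u := ball (0 : ℂ) ε \ {0}) hcont
      fun z hz => ball_min_subset' _ _ _ (hhm z hz)
    have h2 := (hE.mono (hsub hle.2.1)).zpow L
    have h3 := hF.comp (f := fun z => (z, v z)) (u := ball (0 : ℂ) ε \ {0})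
      (continuousOn_id.prodMk (hvc.mono (hsub hle.2.2.2.1)))
      fun z hz => ⟨(hsub hle.2.2.1 hz).1, trivial⟩
    refine ⟨ε, hε, ((h1.mul h2).mul h3.inv).congr fun z hz => ?_⟩
    have hz1 := hev z (hsub hle.2.2.2.2 hz).1
    have key : u (h z) = dir (fderiv ℝ h z (v z)) := by
      refine rayAt_injective hz1.1.mem_right (c := b) (Or.inr (hhm z hz).2) ?_
      rw [← rayAt_lift hz1.1, ← hσ z (hsub hle.1 hz), ← hσ' _ (ball_min_subset _ _ _ (hhm z hz)),
        hz1.1.apply]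
    rw [← key, hh0, sub_zero, sub_zero, mul_zpow, inv_zpow, mul_inv, inv_inv, zpow_neg, zpow_neg]
    generalize u (h z) = y
    generalize dir (h z) ^ L = x
    generalize dir z ^ L = w
    generalize v z = t
    apply Circle.ext
    simp only [Circle.coe_mul, Circle.coe_inv]
    field_simp
  rw [hv.unique hK, OrbifoldChart.order_eq_of_center_eq (hap.trans hbp.symm)]

theorem HasIdx.congr (h : HasIdx o σ p q) (he : ∀ᶠ x in nhdsWithin p {p}ᶜ, τ x = σ x) :
    HasIdx o τ p q := by
  obtain ⟨a, v, K, ha, rfl, rfl, hv, ε, hε, hσ⟩ := h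
  have h0 : ContinuousAt a 0 := a.continuousOn.continuousAt (ball_mem_nhds _ two_pos)
  obtain ⟨δ, hδ, hb⟩ := Metric.eventually_nhds_iff_ball.1
    ((h0.tendsto.eventually (eventually_nhdsWithin_iff.1 he)).and (ball_mem_nhds 0 two_pos))
  refine ⟨a, v, K, ha, rfl, rfl, hv, min ε δ, lt_min hε hδ, fun z hz => ?_⟩
  have h1 := hb z (ball_min_subset' _ _ _ hz).1
  rw [h1.1 (a.apply_ne_center h1.2 hz.2), hσ z (ball_min_subset _ _ _ hz)]

/-- Away from the centre of a chart the restricted chart has order 1, so there is no denominator. -/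
theorem hasIdx_of_hasDegAt (hc : o.IsPositive c) {z₀ : ℂ} (hz₀ : z₀ ∈ ball (0 : ℂ) 2)
    (h0 : z₀ ≠ 0) {v : ℂ → Circle} {K : ℤ} (hv : HasDegAt v z₀ K) {ε : ℝ} (hε : 0 < ε)
    (hσ : ∀ z ∈ ball z₀ ε \ {z₀}, σ (c z) = rayAt c z (v z)) : HasIdx o σ (c z₀) K := by
  obtain ⟨δ, hδ, hs, hi⟩ := c.exists_injOn_ball hz₀ h0
  have h2 : 2 * (δ / 2) = δ := by ring
  have hδ2 : 0 < δ / 2 := by positivity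
  have hs0 : ((δ / 2 : ℝ) : ℂ) ≠ 0 := by exact_mod_cast hδ2.ne'
  have haff := c.sub_affine (z₀ := z₀) hδ2 (by rwa [h2]) (by rwa [h2])
  refine ⟨c.sub z₀ (δ / 2) hδ2 (by rwa [h2]) (by rwa [h2]), _, K, hc.of_affine hδ2 haff, ?_,
    by simp [OrbifoldChart.sub], hv.comp_affine hδ2, min 2 (ε / (δ / 2)), by positivity, ?_⟩
  · change c (z₀ + _ * 0) = c z₀
    rw [mul_zero, add_zero]
  · intro z hz
    rw [rayAt_lift (OrbifoldChart.isChartLift_affine haff (ball_min_subset _ _ _ hz).1),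
      OrbifoldChart.sub_apply, fderiv_affine, hσ]
    · congr 1
      simp only [smul_apply, ContinuousLinearMap.id_apply, Complex.real_smul]
      rw [dir_ofReal_mul_coe hδ2]
    · have h3 := (ball_min_subset' _ _ _ hz).1
      refine ⟨?_, by simpa [hδ.ne'] using hz.2⟩
      rw [mem_ball_zero_iff, lt_div_iff₀ hδ2] at h3
      rw [mem_ball_iff_norm, add_sub_cancel_left, norm_mul, Complex.norm_real,
        Real.norm_of_nonneg hδ2.le, mul_comm]
      exact h3

/-- A continuous section of the circle bundle over the complement of `s`. -/
structure IsSectionOff {X : Type*} [TopologicalSpace X] [DiffeologicalSpace X]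
    (σ : X → SphereTangent X) (s : Set X) : Prop where
  continuousOn : ContinuousOn σ sᶜ
  proj_eq : ∀ x ∉ s, proj (σ x) = x

theorem IsSectionOff.mono {s t : Set X} (h : IsSectionOff σ s) (hst : s ⊆ t) : IsSectionOff σ t :=
  ⟨h.continuousOn.mono (compl_subset_compl.2 hst), fun x hx => h.proj_eq x fun h => hx (hst h)⟩

theorem IsSectionOff.exists_vec {s : Set X} (h : IsSectionOff σ s) (c : OrbifoldChart X)
    (hc : c.order = 1 ∨ c.center ∈ s) : ∃ v : ℂ → Circle,
      ContinuousOn v (ball 0 2 \ c ⁻¹' s) ∧ ∀ z ∈ ball 0 2 \ c ⁻¹' s, σ (c z) = rayAt c z (v z) := by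
  refine SphereTangent.exists_vec c sdiff_subset (hc.imp id fun h1 h2 => h2.2 h1) ?_
    fun z hz => h.proj_eq _ hz.2
  exact h.continuousOn.comp (c.continuousOn.mono sdiff_subset) fun z hz => hz.2

theorem IsSectionOff.exists_hasIdx (ho : o.HasPositiveCharts) {s : Set X} (h : IsSectionOff σ s)
    (hps : (s \ {p})ᶜ ∈ nhds p) :
    ∃ q, HasIdx o σ p q := by
  obtain ⟨c, hc, rfl, hcs⟩ := ho.exists_chart hps
  obtain ⟨v, hv, hσ⟩ := (h.mono (t := insert c.center s) (subset_insert _ _)).exists_vec c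
    (Or.inr (mem_insert _ _))
  have hsub : ball (0 : ℂ) 2 \ {0} ⊆ ball 0 2 \ c ⁻¹' (insert c.center s) := by
    rintro z ⟨hz, hz0⟩
    refine ⟨hz, ?_⟩
    have h1 := c.apply_ne_center hz hz0
    rintro (h2 | h2)
    · exact h1 h2
    · exact hcs (c.mem_image hz) ⟨h2, h1⟩
  obtain ⟨K, hK⟩ := exists_hasDegAt two_pos (hv.mono hsub)
  exact ⟨_, c, v, K, hc, rfl, rfl, ⟨2, two_pos, hK⟩, 2, two_pos, fun z hz => hσ z (hsub hz)⟩

theorem hasIdx_zero (ho : o.HasPositiveCharts) {s : Set X} (h : IsSectionOff σ s)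
    (hps : sᶜ ∈ nhds p) (hp : p ∉ singularSet X) : HasIdx o σ p 0 := by
  obtain ⟨c, hc, rfl, hcs⟩ := ho.exists_chart hps
  obtain ⟨v, hv, hσ⟩ := h.exists_vec c (Or.inl (c.order_eq_one hp))
  have hsub : ball (0 : ℂ) 2 ⊆ ball 0 2 \ c ⁻¹' s := fun z hz => ⟨hz, hcs (c.mem_image hz)⟩
  exact ⟨c, v, 0, hc, rfl, by simp, hasDegAt_zero_of_continuousOn two_pos (hv.mono hsub), 2, two_pos,
    fun z hz => hσ z (hsub hz.1)⟩

open Classical in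
variable (o σ p) in
/-- The index of a section at a point. -/
def idx : ℚ := if h : ∃ q, HasIdx o σ p q then h.choose else 0

theorem HasIdx.idx_eq (h : HasIdx o σ p q) : idx o σ p = q := by
  have h1 : ∃ q, HasIdx o σ p q := ⟨q, h⟩
  rw [idx, dif_pos h1]
  exact h1.choose_spec.unique h

theorem IsSectionOff.hasIdx (ho : o.HasPositiveCharts) {P : Finset X} (h : IsSectionOff σ P)
    (p : X) : HasIdx o σ p (idx o σ p) := by
  have h1 : ((P : Set X) \ {p})ᶜ ∈ nhds p :=
    (P.finite_toSet.sdiff.isClosed.isOpen_compl).mem_nhds (by simp)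
  obtain ⟨q, hq⟩ := h.exists_hasIdx ho h1
  rwa [hq.idx_eq]

/-- The preimage of a finite set in the domain of a chart. -/
theorem OrbifoldChart.finite_preimage (c : OrbifoldChart X) (P : Finset X) :
    (ball (0 : ℂ) 2 ∩ c ⁻¹' P).Finite := by
  have h1 : ∀ p ∈ P, (ball (0 : ℂ) 2 ∩ c ⁻¹' {p}).Finite := by
    intro p _
    by_cases hp : p ∈ c.image
    · obtain ⟨z, hz, rfl⟩ := hp
      refine (((Polynomial.nthRoots c.order (1 : ℂ)).toFinset.finite_toSet).image
        (fun ξ => ξ * z)).subset ?_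
      rintro w ⟨hw, hw'⟩
      obtain ⟨ξ, hξ, rfl⟩ := (c.fibres z hz w hw).1 hw'.symm
      exact ⟨ξ, by simpa [Polynomial.mem_nthRoots c.order_pos] using hξ, rfl⟩
    · convert finite_empty (α := ℂ)
      ext z
      simp only [mem_inter_iff, mem_empty_iff_false, iff_false, not_and]
      rintro hz rfl
      exact hp (c.mem_image hz)
  refine (P.finite_toSet.biUnion h1).subset ?_
  rintro z ⟨hz, hzP⟩
  exact mem_biUnion hzP ⟨hz, rfl⟩

theorem OrbifoldChart.card_fibre (c : OrbifoldChart X) {z : ℂ} (h0 : z ≠ 0)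
    {Q : Finset ℂ} (hQ : ∀ w, w ∈ Q ↔ ∃ ξ : ℂ, ξ ^ c.order = 1 ∧ w = ξ * z) :
    Q.card = c.order := by
  have h1 : Q = (Polynomial.nthRootsFinset c.order (1 : ℂ)).image (fun ξ => ξ * z) := by
    ext w
    rw [hQ]
    simp only [Finset.mem_image, Polynomial.mem_nthRootsFinset c.order_pos]
    exact exists_congr fun ξ => and_congr_right fun _ => eq_comm
  rw [h1, Finset.card_image_of_injective _ (mul_left_injective₀ h0),
    IsPrimitiveRoot.card_nthRootsFinset (Complex.isPrimitiveRoot_exp _ c.order_pos.ne')]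

theorem exists_ball_inter_subset_singleton {Q : Set ℂ} (hQ : Q.Finite) (z : ℂ) (hz : z ∈ ball (0 : ℂ) 2) :
    ∃ ε > 0, ball z ε \ {z} ⊆ ball 0 2 \ Q := by
  have h1 : ball (0 : ℂ) 2 \ (Q \ {z}) ∈ nhds z :=
    (isOpen_ball.sdiff hQ.sdiff.isClosed).mem_nhds ⟨hz, by simp⟩
  obtain ⟨ε, hε, h⟩ := Metric.mem_nhds_iff.1 h1
  exact ⟨ε, hε, fun w hw => ⟨(h hw.1).1, fun h2 => (h hw.1).2 ⟨h2, hw.2⟩⟩⟩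

open Classical in
/-- The degrees of a section in a chart add up to the order times the sum of the indices. -/
theorem sum_degrees_eq_sum_idx (hc : o.IsPositive c) {P : Finset X}
    {Q : Finset ℂ} (hQ : ∀ z, z ∈ Q ↔ z ∈ ball (0 : ℂ) 2 ∧ c z ∈ P)
    {v : ℂ → Circle} (hσ : ∀ z ∈ ball 0 2 \ c ⁻¹' P, σ (c z) = rayAt c z (v z)) {d : ℂ → ℤ}
    (hd : ∀ z ∈ Q, HasDegAt v z (d z)) :
    ((∑ z ∈ Q, d z : ℤ) : ℚ) = c.order * ∑ p ∈ P with p ∈ c.image, idx o σ p := by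
  have hm : (c.order : ℚ) ≠ 0 := by exact_mod_cast c.order_pos.ne'
  have h0 : (0 : ℂ) ∈ ball (0 : ℂ) 2 := by simp
  have hmaps : ∀ z ∈ Q, c z ∈ P.filter (· ∈ c.image) := fun z hz =>
    Finset.mem_filter.2 ⟨((hQ z).1 hz).2, c.mem_image ((hQ z).1 hz).1⟩
  have hpunct : ∀ z ∈ Q, ∃ ε > 0, ball z ε \ {z} ⊆ ball 0 2 \ c ⁻¹' P := fun z hz => by
    obtain ⟨ε, hε, h⟩ := exists_ball_inter_subset_singleton (c.finite_preimage P) z ((hQ z).1 hz).1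
    exact ⟨ε, hε, fun w hw => ⟨(h hw).1, fun h2 => (h hw).2 ⟨(h hw).1, h2⟩⟩⟩
  rw [← Finset.sum_fiberwise_of_maps_to hmaps, Int.cast_sum, Finset.mul_sum]
  refine Finset.sum_congr rfl fun p hp => ?_
  obtain ⟨hpP, z, hz, rfl⟩ := Finset.mem_filter.1 hp
  have hzQ : z ∈ Q := (hQ z).2 ⟨hz, hpP⟩
  rcases eq_or_ne z 0 with rfl | hz0
  -- The centre has one preimage, whose degree is the order times the index.
  · have h1 : Q.filter (fun w => c w = c 0) = {0} := by
      ext w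
      simp only [Finset.mem_filter, Finset.mem_singleton]
      constructor
      · rintro ⟨hw, hw0⟩
        by_contra h
        exact c.apply_ne_center ((hQ w).1 hw).1 h hw0
      · rintro rfl
        exact ⟨hzQ, rfl⟩
    obtain ⟨ε, hε, h⟩ := hpunct 0 hzQ
    have h2 : HasIdx o σ (c 0) (d 0 / c.order) :=
      ⟨c, v, d 0, hc, rfl, rfl, hd 0 hzQ, ε, hε, fun w hw => hσ w (h hw)⟩
    rw [h1, Finset.sum_singleton, h2.idx_eq]
    field_simp
  -- Any other point has as many preimages as the order, each with degree equal to the index.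
  · have h1 : ∀ w ∈ Q.filter (fun w => c w = c z), (d w : ℚ) = idx o σ (c z) := by
      intro w hw
      obtain ⟨hwQ, hwz⟩ := Finset.mem_filter.1 hw
      obtain ⟨ε, hε, h⟩ := hpunct w hwQ
      have hw0 : w ≠ 0 := by
        rintro rfl
        exact c.apply_ne_center hz hz0 hwz.symm
      have h2 := hasIdx_of_hasDegAt hc ((hQ w).1 hwQ).1 hw0 (hd w hwQ) hε fun y hy => hσ y (h hy)
      rw [← hwz, h2.idx_eq]
    rw [Int.cast_sum, Finset.sum_congr rfl h1, Finset.sum_const, nsmul_eq_mul,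
      c.card_fibre hz0 fun w => ?_]
    rw [Finset.mem_filter, hQ]
    constructor
    · rintro ⟨⟨hw, -⟩, hwz⟩
      exact (c.fibres z hz w hw).1 hwz.symm
    · rintro ⟨ξ, hξ, rfl⟩
      have h3 := c.apply_rot hξ hz
      exact ⟨⟨OrbifoldChart.rot_mem hξ hz, h3.symm ▸ hpP⟩, h3⟩

open Classical in
/-- Two sections that agree outside of a disc have the same sum of indices. -/
theorem sum_idx_eq_of_disc (ho : o.HasPositiveCharts) (hc : o.IsPositive c) {P : Finset X}
    (hcP : c.center ∈ P) (hσ : IsSectionOff σ P) (hτ : IsSectionOff τ P) {ρ : ℝ} (hρ : ρ < 2)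
    (h : ∀ x ∉ P, x ∉ c '' ball 0 ρ → σ x = τ x) : ∑ p ∈ P, idx o σ p = ∑ p ∈ P, idx o τ p := by
  have hm : (c.order : ℚ) ≠ 0 := by exact_mod_cast c.order_pos.ne'
  obtain ⟨v, hv, hσv⟩ := hσ.exists_vec c (Or.inr hcP)
  obtain ⟨u, hu, hτu⟩ := hτ.exists_vec c (Or.inr hcP)
  let Q := (c.finite_preimage P).toFinset
  have hQ : ∀ z, z ∈ Q ↔ z ∈ ball (0 : ℂ) 2 ∧ c z ∈ P := fun z => by simp [Q]
  have hQP : ball (0 : ℂ) 2 \ (Q : Set ℂ) ⊆ ball 0 2 \ c ⁻¹' P := fun z hz =>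
    ⟨hz.1, fun h1 => hz.2 ((hQ z).2 ⟨hz.1, h1⟩)⟩
  have hdeg : ∀ {v : ℂ → Circle}, ContinuousOn v (ball 0 2 \ c ⁻¹' P) →
      ∃ d : ℂ → ℤ, ∀ z ∈ Q, HasDegAt v z (d z) := by
    intro v hv
    have h1 : ∀ z, ∃ d : ℤ, z ∈ Q → HasDegAt v z d := fun z => by
      by_cases hz : z ∈ Q
      · obtain ⟨ε, hε, h⟩ := exists_ball_inter_subset_singleton Q.finite_toSet z ((hQ z).1 hz).1
        obtain ⟨K, hK⟩ := exists_hasDegAt hε (hv.mono (h.trans hQP))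
        exact ⟨K, fun _ => ⟨ε, hε, hK⟩⟩
      · exact ⟨0, fun h => (hz h).elim⟩
    choose d hd using h1
    exact ⟨d, hd⟩
  obtain ⟨d, hd⟩ := hdeg hv
  obtain ⟨d', hd'⟩ := hdeg hu
  -- The two sections coincide beyond radius ρ, so their vectors in the chart have the same total
  -- degree.
  have hsum := sum_degrees_eq (F := v) (F' := u) (Q := Q) (R := 2) hρ two_pos
    (fun q hq => ((hQ q).1 hq).1) hd hd' (hv.mono hQP) (hu.mono hQP) (by
      intro w hw hρw hwQ
      have h1 : c w ∉ P := fun h1 => hwQ ((hQ w).2 ⟨hw, h1⟩)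
      have hw0 : w ≠ 0 := fun h0 => h1 (h0 ▸ hcP)
      refine rayAt_injective hw (c := c) (Or.inr hw0) ?_
      rw [← hσv w ⟨hw, h1⟩, ← hτu w ⟨hw, h1⟩]
      refine h _ h1 ?_
      rintro ⟨y, hy, hyw⟩
      obtain ⟨ξ, hξ, rfl⟩ := (c.fibres y (ball_subset_ball hρ.le hy) w hw).1 hyw
      have := OrbifoldChart.rot_mem hξ hy
      rw [mem_ball_zero_iff] at this
      exact hρw.not_gt this)
  have h1 := sum_degrees_eq_sum_idx hc hQ hσv hd
  rw [hsum, sum_degrees_eq_sum_idx hc hQ hτu hd'] at h1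
  rw [← Finset.sum_filter_add_sum_filter_not P (· ∈ c.image),
    ← Finset.sum_filter_add_sum_filter_not P (· ∈ c.image) (idx o τ), mul_left_cancel₀ hm h1]
  congr 1
  -- At the points outside of the domain of the chart the sections coincide locally, and so do the
  -- indices.
  refine Finset.sum_congr rfl fun p hp => ?_
  obtain ⟨hpP, hpc⟩ := Finset.mem_filter.1 hp
  refine ((hτ.hasIdx ho p).congr ?_).idx_eq
  have hcl : IsClosed (c '' closedBall 0 ρ) :=
    ((isCompact_closedBall _ _).image_of_continuousOn
      (c.continuousOn.mono (closedBall_subset_ball hρ))).isClosed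
  have hpcl : p ∉ c '' closedBall 0 ρ := fun h => hpc (image_mono (closedBall_subset_ball hρ) h)
  have hP1 : ((P : Set X) \ {p})ᶜ ∈ nhds p :=
    (P.finite_toSet.sdiff.isClosed.isOpen_compl).mem_nhds (by simp)
  rw [eventually_nhdsWithin_iff]
  filter_upwards [hcl.isOpen_compl.mem_nhds hpcl, hP1] with x hx hxP hxp
  exact h x (fun h1 => hxP ⟨h1, hxp⟩) fun h1 => hx (image_mono ball_subset_closedBall h1)

end

section

/-! ### The homological index along the boundary of a disc -/

/-- The map (t, w) ↦ (t, w^m) is a closed continuous surjection, by compactness, and therefore a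
quotient map. The parameter `T` is there for homotopies. -/
theorem Circle.exists_descend_pow {T Y : Type*} [TopologicalSpace T] [CompactSpace T] [T2Space T]
    [TopologicalSpace Y] {m : ℕ} (hm : 0 < m) (f : C(T × Circle, Y))
    (hf : ∀ t, ∀ w w' : Circle, w ^ m = w' ^ m → f (t, w) = f (t, w')) :
    ∃ g : C(T × Circle, Y), ∀ t w, g (t, w ^ m) = f (t, w) := by
  have hsurj : Function.Surjective fun p : T × Circle => (p.1, p.2 ^ m) := by
    rintro ⟨t, u⟩
    refine ⟨(t, Circle.exp ((u : ℂ).arg / m)), Prod.ext rfl ?_⟩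
    have h1 : (m : ℝ) ≠ 0 := by exact_mod_cast hm.ne'
    change Circle.exp ((u : ℂ).arg / m) ^ m = u
    rw [← Circle.exp_nsmul, nsmul_eq_mul, mul_div_cancel₀ _ h1, Circle.exp_arg]
  have hcont : Continuous fun p : T × Circle => (p.1, p.2 ^ m) := by fun_prop
  have hq : Topology.IsQuotientMap (fun p : T × Circle => (p.1, p.2 ^ m)) :=
    hcont.isClosedMap.isQuotientMap hcont hsurj
  let e : C(T × Circle, T × Circle) := ⟨_, hcont⟩
  have hlift : Function.FactorsThrough f e := by
    rintro ⟨t, w⟩ ⟨t', w'⟩ h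
    obtain ⟨rfl, h⟩ := Prod.mk.inj h
    exact hf t w w' h
  exact ⟨Topology.IsQuotientMap.lift (f := e) hq f hlift, fun t w =>
    congrArg (fun k : C(T × Circle, Y) => k (t, w)) (Topology.IsQuotientMap.lift_comp hq f hlift)⟩

theorem Circle.degree_unique {K L : ℤ} {g h : Circle → ℝ} (hg : Continuous g) (hh : Continuous h)
    (e : ∀ w : Circle, w ^ K * Circle.exp (g w) = w ^ L * Circle.exp (h w)) : K = L := by
  refine sub_eq_zero.1 (Circle.degree_eq_zero (hh.sub hg) fun w => ?_)
  rw [Pi.sub_apply, Circle.exp_sub, zpow_sub, ← div_eq_mul_inv, div_eq_div_iff_mul_eq_mul, e w,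
    mul_comm]

universe u

open SphereTangent

section

variable {X : Type u} [TopologicalSpace X] [DiffeologicalSpace X] [IsTwoOrbifold X]
  {o : OrbifoldOrientation X} {c : OrbifoldChart X} {σ : X → SphereTangent X} {q : ℚ}
  {v : ℂ → Circle} {K : ℤ} {g : Circle → ℝ}

theorem coe_circle_mem_ball (w : Circle) : (w : ℂ) ∈ ball (0 : ℂ) 2 := by
  simp [Circle.norm_coe]

theorem vec_equivariant {w w' : Circle} (hσ : ∀ w : Circle, σ (c w) = rayAt c w (v w))
    (h : w ^ c.order = w' ^ c.order) :
    ∃ ξ : ℂ, ξ ^ c.order = 1 ∧ (w' : ℂ) = ξ * w ∧ (v w' : ℂ) = ξ * v w := by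
  refine (rayAt_eq_iff_same (coe_circle_mem_ball w) (coe_circle_mem_ball w')).1 ?_
  rw [← hσ, ← hσ]
  congr 1
  refine (c.fibres w (coe_circle_mem_ball w) w' (coe_circle_mem_ball w')).2 ⟨w' / w, ?_, ?_⟩
  · rw [div_pow]
    have := congrArg ((↑) : Circle → ℂ) h
    rw [Circle.coe_pow, Circle.coe_pow] at this
    rw [this, div_self (pow_ne_zero _ w'.coe_ne_zero)]
  · rw [div_mul_cancel₀ _ w.coe_ne_zero]

/-- The group acts on directions by m-th roots of unity, so v^m is well defined on the part of the
bundle over the chart, the centre included. It restricts to degree m on regular fibres. -/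
theorem exists_fibreDegree (c : OrbifoldChart X) : ∃ Φ : SphereTangent X → Circle,
    (∀ z ∈ ball (0 : ℂ) 2, ∀ v, Φ (rayAt c z v) = v ^ c.order) ∧
      ∀ z ∈ ball (0 : ℂ) 2, ∀ v, ContinuousAt Φ (rayAt c z v) := by
  refine exists_descend c isOpen_ball subset_rfl (fun _ v => v ^ c.order)
    (continuousOn_snd.pow _) ?_
  intro z _ v u ξ hξ hu
  ext
  rw [Circle.coe_pow, Circle.coe_pow, hu, mul_pow, hξ, one_mul]

/-- Apply v^m to the relation in homology. Along the boundary it has degree m K in `w`, hence degree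
K in the loop parameter w^m; on a positive regular fibre it has degree m. So K = q m. -/
theorem index_eq_of_isLocalIndex (hc : o.IsPositive c) (hg : Continuous g)
    (hσ : ∀ w : Circle, σ (c w) = rayAt c w (v w))
    (hv : ∀ w : Circle, v w = w ^ K * Circle.exp (g w))
    (h : IsLocalIndex (SphereTangent.proj (B := X)) (IsPositiveFibre o) c σ q) :
    q = K / c.order := by
  obtain ⟨l, s, hl, ⟨e, z, he, -, hs⟩, hq⟩ := h
  replace hs : ∀ w, (s w : SphereTangent X) = ray e z w := hs
  obtain ⟨Φ, hΦ, hΦc⟩ := exists_fibreDegree c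
  have hcl : ∀ ξ : SphereTangent.proj ⁻¹' c.closedDisc, ContinuousAt Φ ξ := by
    rintro ⟨ξ, y, hy, hyξ⟩
    have hy2 := closedBall_subset_ball (by norm_num : (1 : ℝ) < 2) hy
    obtain ⟨u, rfl⟩ := exists_rayAt_eq hy2 hyξ.symm
    exact hΦc y hy2 u
  let Ψ : C(SphereTangent.proj ⁻¹' c.closedDisc, Circle) :=
    ⟨fun ξ => Φ ξ, continuous_iff_continuousAt.2 fun ξ =>
      ContinuousAt.comp (g := Φ) (hcl ξ) continuous_subtype_val.continuousAt⟩
  obtain ⟨K', g', hg', hK'⟩ := Circle.exists_degree (fun u => Ψ (l u)) (by fun_prop)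
  have hKK : K' = K := by
    have h1 : (c.order : ℤ) * K' = c.order * K := by
      refine Circle.degree_unique (g := fun w => g' (w ^ c.order)) (h := fun w => c.order * g w)
        (by fun_prop) (by fun_prop) fun w => ?_
      rw [zpow_mul, zpow_natCast, ← hK' (w ^ c.order)]
      change Φ (l (w ^ c.order)) = _
      rw [hl, hσ, hΦ _ (coe_circle_mem_ball w), hv, mul_pow, ← Circle.exp_nsmul, nsmul_eq_mul,
        mul_comm (c.order : ℤ), zpow_mul, zpow_natCast]
    exact mul_left_cancel₀ (by exact_mod_cast c.order_pos.ne') h1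
  subst hKK
  obtain ⟨y, hy, hyz⟩ : e z ∈ c.closedDisc := by
    have := (s 1).2
    rwa [mem_preimage, hs 1] at this
  have hy2 := closedBall_subset_ball (by norm_num : (1 : ℝ) < 2) hy
  obtain ⟨h, hh, rfl⟩ := IsChartLift.exists_of_eq e c z.2 hy2 hyz.symm
  obtain ⟨ε, hε, f, hf, hfe⟩ := exists_expOn_dir_fderiv hh.contDiffAt (he.det_pos hc hh)
  have hm1 : ∀ w : Circle, ((z : ℂ), w) ∈ ball (z : ℂ) ε ×ˢ (univ : Set Circle) := fun w =>
    ⟨mem_ball_self hε, trivial⟩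
  have key := degree_eq_of_loopClass_eq Ψ hq hg' hK' (M := c.order)
    (h := fun w => c.order * f (z, w))
    (continuous_const.mul (hf.comp_continuous (by fun_prop) hm1)) (fun w => by
      change Φ (s w) = _
      rw [hs, ← rayAt_coe, rayAt_lift hh, hΦ _ hy2, zpow_natCast, ← nsmul_eq_mul, Circle.exp_nsmul,
        ← hfe _ (hm1 w), ← mul_pow]
      congr 1
      exact (mul_inv_cancel_comm_assoc _ _).symm)
  rw [eq_div_iff (by exact_mod_cast c.order_pos.ne')]
  exact_mod_cast key.symm

/-- The boundary loop and a fibre over a boundary point are both contracted radially to the central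
fibre 𝕊¹/Γ, the image of a loop `j` with parameter v^m. There they become `j` composed with maps of
degree K and m. -/
theorem isLocalIndex_of_degree (hc : o.IsPositive c) (hg : Continuous g)
    (hσ : ∀ w : Circle, σ (c w) = rayAt c w (v w))
    (hv : ∀ w : Circle, v w = w ^ K * Circle.exp (g w)) :
    IsLocalIndex (SphereTangent.proj (B := X)) (IsPositiveFibre o) c σ (K / c.order) := by
  have hvc : Continuous fun w : Circle => v w := by
    simp only [hv]
    fun_prop
  have hmem : ∀ (t : unitInterval) (w : Circle), ((t : ℝ) : ℂ) * (w : ℂ) ∈ closedBall (0 : ℂ) 1 := by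
    intro t w
    simp [Circle.norm_coe, abs_of_nonneg t.2.1, t.2.2]
  have hmem2 : ∀ (t : unitInterval) (w : Circle), ((t : ℝ) : ℂ) * (w : ℂ) ∈ ball (0 : ℂ) 2 :=
    fun t w => closedBall_subset_ball (by norm_num) (hmem t w)
  have hcont : ∀ {f : unitInterval × Circle → ℂ} {u : unitInterval × Circle → Circle},
      Continuous f → (∀ p, f p ∈ ball (0 : ℂ) 2) → Continuous u →
      Continuous fun p => rayAt c (f p) (u p) := fun {f u} hf hm hu => by
    rw [← continuousOn_univ]
    exact continuousOn_rayAt_comp hf.continuousOn (fun p _ => hm p) hu.continuousOn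
  have hproj : ∀ {z : ℂ} (_ : z ∈ closedBall (0 : ℂ) 1) (u : Circle),
      rayAt c z u ∈ SphereTangent.proj ⁻¹' c.closedDisc := fun {z} hz u => by
    rw [mem_preimage, proj_rayAt (closedBall_subset_ball (by norm_num) hz)]
    exact mem_image_of_mem _ hz
  -- the cone over the section
  obtain ⟨H, hH⟩ := Circle.exists_descend_pow (T := unitInterval) c.order_pos
    ⟨fun p => (⟨rayAt c ((p.1 : ℝ) * (p.2 : ℂ)) (v p.2), hproj (hmem _ _) _⟩ :
      SphereTangent.proj ⁻¹' c.closedDisc),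
      (hcont (by fun_prop) (fun p => hmem2 _ _) (hvc.comp continuous_snd)).subtype_mk _⟩ (by
      intro t w w' hw
      obtain ⟨ξ, hξ, h1, h2⟩ := vec_equivariant hσ hw
      refine Subtype.ext ((rayAt_eq_iff_same (hmem2 _ _) (hmem2 _ _)).2 ⟨ξ, hξ, ?_, h2⟩)
      rw [h1, mul_left_comm])
  -- the fibre over the centre
  obtain ⟨J, hJ⟩ := Circle.exists_descend_pow (T := unitInterval) c.order_pos
    ⟨fun p => (⟨rayAt c 0 p.2, hproj (by simp) _⟩ : SphereTangent.proj ⁻¹' c.closedDisc),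
      (hcont (by fun_prop) (by simp) continuous_snd).subtype_mk _⟩ (by
      intro t w w' hw
      refine Subtype.ext ((rayAt_eq_iff_same (by simp) (by simp)).2
        ⟨w' / w, ?_, by simp, by simp [w.coe_ne_zero]⟩)
      have := congrArg ((↑) : Circle → ℂ) hw
      rw [Circle.coe_pow, Circle.coe_pow] at this
      rw [div_pow, this, div_self (pow_ne_zero _ w'.coe_ne_zero)])
  -- The position in the central fibre of the contracted boundary loop, as a function of the loop
  -- parameter w^m.
  obtain ⟨Λ, hΛ⟩ := Circle.exists_descend_pow (T := unitInterval) c.order_pos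
    ⟨fun p => v p.2 ^ c.order, (hvc.comp continuous_snd).pow _⟩ (by
      intro t w w' hw
      obtain ⟨ξ, hξ, h1, h2⟩ := vec_equivariant hσ hw
      change v w ^ _ = v w' ^ _
      ext
      rw [Circle.coe_pow, Circle.coe_pow, h2, mul_pow, hξ, one_mul])
  let l : C(Circle, SphereTangent.proj ⁻¹' c.closedDisc) := ⟨fun u => H (1, u), by fun_prop⟩
  let j : C(Circle, SphereTangent.proj ⁻¹' c.closedDisc) := ⟨fun u => J (0, u), by fun_prop⟩
  let lam : C(Circle, Circle) := ⟨fun u => Λ (0, u), by fun_prop⟩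
  let S : C(unitInterval × Circle, SphereTangent.proj ⁻¹' c.closedDisc) :=
    ⟨fun p => ⟨rayAt c ((p.1 : ℝ) * ((1 : Circle) : ℂ)) p.2, hproj (hmem _ _) _⟩,
      (hcont (by fun_prop) (fun p => hmem2 _ _) continuous_snd).subtype_mk _⟩
  let s : C(Circle, SphereTangent.proj ⁻¹' c.closedDisc) := ⟨fun w => S (1, w), by fun_prop⟩
  let pw : C(Circle, Circle) := ⟨fun w => w ^ c.order, by fun_prop⟩
  have hpow : ∀ u : Circle, ∃ w : Circle, w ^ c.order = u := fun u => by
    have h1 : (c.order : ℝ) ≠ 0 := by exact_mod_cast c.order_pos.ne'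
    exact ⟨Circle.exp ((u : ℂ).arg / c.order), by
      rw [← Circle.exp_nsmul, nsmul_eq_mul, mul_div_cancel₀ _ h1, Circle.exp_arg]⟩
  have hlj : l.Homotopic (j.comp lam) := by
    refine ContinuousMap.Homotopic.symm ⟨⟨H, fun u => ?_, fun u => rfl⟩⟩
    obtain ⟨w, rfl⟩ := hpow u
    change H (0, w ^ c.order) = J (0, Λ (0, w ^ c.order))
    rw [hH, hΛ]
    change _ = J (0, v w ^ c.order)
    rw [hJ]
    refine Subtype.ext ?_
    simp
  have hsj : s.Homotopic (j.comp pw) := by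
    refine ContinuousMap.Homotopic.symm ⟨⟨S, fun w => ?_, fun u => rfl⟩⟩
    change S (0, w) = J (0, w ^ c.order)
    rw [hJ]
    refine Subtype.ext ?_
    simp [S]
  obtain ⟨K', g', hg', hK'⟩ := Circle.exists_degree lam lam.continuous
  have hKK : K' = K := by
    have h1 : (c.order : ℤ) * K' = c.order * K := by
      refine Circle.degree_unique (g := fun w => g' (w ^ c.order)) (h := fun w => c.order * g w)
        (by fun_prop) (by fun_prop) fun w => ?_
      rw [zpow_mul, zpow_natCast, ← hK' (w ^ c.order)]
      change Λ (0, w ^ c.order) = _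
      rw [hΛ]
      change v w ^ c.order = _
      rw [hv, mul_pow, ← Circle.exp_nsmul, nsmul_eq_mul,
        mul_comm (c.order : ℤ), zpow_mul, zpow_natCast]
    exact mul_left_cancel₀ (by exact_mod_cast c.order_pos.ne') h1
  subst hKK
  refine ⟨l, s, fun w => ?_, ⟨c, ⟨1, by simp⟩, hc, c.notMem_singularSet (by simp) (by simp),
    fun w => ?_⟩, ?_⟩
  · change (H (1, w ^ c.order) : SphereTangent X) = _
    rw [hH, hσ]
    simp
  · rw [← rayAt_coe]
    simp [s, S]
  · rw [loopClass_eq_of_homotopic hlj, loopClass_eq_of_homotopic hsj,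
      loopClass_comp_of_degree j hg' hK',
      loopClass_comp_of_degree j (f := pw) (K := c.order) (g := fun _ => 0) continuous_const
        (fun w => by simp [pw])]
    have hm : (c.order : ℚ) ≠ 0 := by exact_mod_cast c.order_pos.ne'
    rw [← Int.cast_smul_eq_zsmul ℚ, ← Int.cast_smul_eq_zsmul ℚ, smul_smul]
    congr 1
    push_cast
    field_simp

end

end

section

/-! ### Gluing sections -/

open SphereTangent

variable {X : Type*} [TopologicalSpace X] [DiffeologicalSpace X] [IsTwoOrbifold X]
  {o : OrbifoldOrientation X} {c : OrbifoldChart X} {σ τ : X → SphereTangent X} {p : X} {q : ℚ}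

/-- A continuous section of the circle bundle over `s`. -/
structure IsSectionOn {X : Type*} [TopologicalSpace X] [DiffeologicalSpace X]
    (σ : X → SphereTangent X) (s : Set X) : Prop where
  continuousOn : ContinuousOn σ s
  proj_eq : ∀ x ∈ s, proj (σ x) = x

theorem isSectionOff_iff {s : Set X} : IsSectionOff σ s ↔ IsSectionOn σ sᶜ :=
  ⟨fun h => ⟨h.continuousOn, h.proj_eq⟩, fun h => ⟨h.continuousOn, h.proj_eq⟩⟩

namespace IsSectionOn

variable {s t A L L' : Set X}

theorem mono (h : IsSectionOn σ s) (hts : t ⊆ s) : IsSectionOn σ t :=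
  ⟨h.continuousOn.mono hts, fun x hx => h.proj_eq x (hts hx)⟩

theorem congr (h : IsSectionOn σ s) (he : EqOn τ σ s) : IsSectionOn τ s :=
  ⟨h.continuousOn.congr he, fun x hx => by rw [he hx, h.proj_eq x hx]⟩

theorem glue (hL : IsClosed L) (hL' : IsClosed L') (hA : A ⊆ L ∪ L') (hτ : IsSectionOn τ (L ∩ A))
    (hσ : IsSectionOn σ (L' ∩ A)) (h : ∀ x ∈ A, x ∈ L → x ∈ L' → τ x = σ x)
    [∀ x, Decidable (x ∈ L)] : IsSectionOn (fun x => if x ∈ L then τ x else σ x) A := by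
  have h1 : EqOn (fun x => if x ∈ L then τ x else σ x) τ (L ∩ A) := fun x hx => if_pos hx.1
  have h2 : EqOn (fun x => if x ∈ L then τ x else σ x) σ (L' ∩ A) := fun x hx => by
    beta_reduce
    split_ifs with hxL
    · exact h x hx.2 hxL hx.1
    · rfl
  refine ⟨ContinuousOn.of_isClosed_cover hL hL' hA (hτ.congr h1).continuousOn
    (hσ.congr h2).continuousOn, fun x hx => ?_⟩
  rcases hA hx with hx' | hx'
  · exact (hτ.congr h1).proj_eq x ⟨hx', hx⟩
  · exact (hσ.congr h2).proj_eq x ⟨hx', hx⟩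

theorem exists_vec (h : IsSectionOn σ s) (c : OrbifoldChart X) {A : Set ℂ} (hA : A ⊆ ball 0 2)
    (hAs : MapsTo c A s) (hc : c.order = 1 ∨ 0 ∉ A) : ∃ v : ℂ → Circle,
      ContinuousOn v A ∧ ∀ z ∈ A, σ (c z) = rayAt c z (v z) :=
  SphereTangent.exists_vec c hA hc (h.continuousOn.comp (c.continuousOn.mono hA) hAs)
    fun _ hz => h.proj_eq _ (hAs hz)

end IsSectionOn

namespace OrbifoldChart

theorem isClosed_image_closedBall (c : OrbifoldChart X) {r : ℝ} (hr : r < 2) :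
    IsClosed (c '' closedBall 0 r) :=
  ((isCompact_closedBall _ _).image_of_continuousOn
    (c.continuousOn.mono (closedBall_subset_ball hr))).isClosed

theorem isOpen_image_ball (c : OrbifoldChart X) {r : ℝ} (hr : r ≤ 2) : IsOpen (c '' ball 0 r) :=
  c.isOpen_image_of_isOpen isOpen_ball (ball_subset_ball hr)

theorem norm_eq_of_apply_eq (c : OrbifoldChart X) {z w : ℂ} (hz : z ∈ ball (0 : ℂ) 2)
    (hw : w ∈ ball (0 : ℂ) 2) (h : c z = c w) : ‖w‖ = ‖z‖ := by
  obtain ⟨ξ, hξ, rfl⟩ := (c.fibres z hz w hw).1 h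
  rw [norm_mul, norm_eq_one_of_pow hξ, one_mul]

theorem apply_mem_image_ball_iff (c : OrbifoldChart X) {z : ℂ} (hz : z ∈ ball (0 : ℂ) 2) {r : ℝ}
    (hr : r ≤ 2) : c z ∈ c '' ball 0 r ↔ ‖z‖ < r := by
  constructor
  · rintro ⟨w, hw, h⟩
    rw [← c.norm_eq_of_apply_eq hz (ball_subset_ball hr hw) h.symm]
    simpa using hw
  · intro h
    exact mem_image_of_mem _ (by simpa using h)

theorem apply_mem_image_closedBall_iff (c : OrbifoldChart X) {z : ℂ} (hz : z ∈ ball (0 : ℂ) 2)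
    {r : ℝ} (hr : r < 2) : c z ∈ c '' closedBall 0 r ↔ ‖z‖ ≤ r := by
  constructor
  · rintro ⟨w, hw, h⟩
    rw [← c.norm_eq_of_apply_eq hz (closedBall_subset_ball hr hw) h.symm]
    simpa using hw
  · intro h
    exact mem_image_of_mem _ (by simpa using h)

open Classical in
/-- The section over the domain of a chart given by vectors in the chart. -/
def vecSection {X : Type*} [TopologicalSpace X] [DiffeologicalSpace X] (c : OrbifoldChart X)
    (v : ℂ → Circle) (x : X) : SphereTangent X :=
  if h : ∃ z ∈ ball (0 : ℂ) 2, c z = x then rayAt c h.choose (v h.choose) else rayAt c 0 1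

theorem vecSection_apply (c : OrbifoldChart X) {v : ℂ → Circle} {z : ℂ} (hz : z ∈ ball (0 : ℂ) 2)
    (hv : ∀ ξ : ℂ, ξ ^ c.order = 1 → (v (ξ * z) : ℂ) = ξ * v z) :
    c.vecSection v (c z) = rayAt c z (v z) := by
  have h : ∃ w ∈ ball (0 : ℂ) 2, c w = c z := ⟨z, hz, rfl⟩
  rw [vecSection, dif_pos h]
  obtain ⟨ξ, hξ, h1⟩ := (c.fibres z hz _ h.choose_spec.1).1 h.choose_spec.2.symm
  refine ((rayAt_eq_iff_same hz h.choose_spec.1).2 ⟨ξ, hξ, h1, ?_⟩).symm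
  rw [← hv ξ hξ, ← h1]

theorem isSectionOn_vecSection (c : OrbifoldChart X) {v : ℂ → Circle} {A : Set ℂ}
    (hA : A ⊆ ball 0 2) (hinv : ∀ z ∈ A, ∀ ξ : ℂ, ξ ^ c.order = 1 → ξ * z ∈ A)
    (hvc : ContinuousOn v A) (hv : ∀ z ∈ A, ∀ ξ : ℂ, ξ ^ c.order = 1 → (v (ξ * z) : ℂ) = ξ * v z) :
    IsSectionOn (c.vecSection v) (c '' A) := by
  refine ⟨c.continuousOn_image hA hinv ?_, ?_⟩
  · exact (continuousOn_rayAt_comp continuousOn_id hA hvc).congr fun z hz =>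
      c.vecSection_apply (hA hz) (hv z hz)
  · rintro _ ⟨z, hz, rfl⟩
    rw [c.vecSection_apply (hA hz) (hv z hz), proj_rayAt (hA hz)]

/-- For each of finitely many charts only finitely many radii meet `P`. -/
theorem exists_radius (s : Finset (OrbifoldChart X)) (P : Finset X) {ρ : ℝ} (hρ : ρ < 2) :
    ∃ r, ρ < r ∧ r < 2 ∧ ∀ c ∈ s, ∀ z ∈ sphere (0 : ℂ) r, c z ∉ P := by
  have hfin : (⋃ c ∈ s, norm '' (ball (0 : ℂ) 2 ∩ c ⁻¹' P)).Finite :=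
    s.finite_toSet.biUnion fun c _ => (c.finite_preimage P).image _
  obtain ⟨r, hr, hrs⟩ := ((Ioo_infinite hρ).sdiff hfin).nonempty
  refine ⟨r, hr.1, hr.2, fun c hc z hz hzP => hrs ?_⟩
  rw [mem_sphere_zero_iff_norm] at hz
  exact mem_biUnion hc ⟨z, ⟨by simpa [hz] using hr.2, hzP⟩, hz⟩

end OrbifoldChart

theorem dir_rot {ξ : ℂ} (hξ : ‖ξ‖ = 1) (z : ℂ) (hz : z ≠ 0) : (dir (ξ * z) : ℂ) = ξ * dir z := by
  have hξ0 : ξ ≠ 0 := by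
    rintro rfl
    simp at hξ
  rw [dir_mul hξ0 hz, Circle.coe_mul, coe_dir hξ0, hξ]
  simp

theorem mul_dir_mem_sphere {r : ℝ} (hr : 0 < r) (z : ℂ) : (r : ℂ) * dir z ∈ sphere (0 : ℂ) r := by
  simp [abs_of_pos hr, Circle.norm_coe]

theorem continuousOn_mul_dir (r : ℝ) : ContinuousOn (fun z => (r : ℂ) * (dir z : ℂ)) {0}ᶜ :=
  continuousOn_const.mul (continuous_subtype_val.comp_continuousOn continuousOn_dir)

theorem mul_dir_of_mem_sphere {r : ℝ} {z : ℂ} (hz : z ∈ sphere (0 : ℂ) r) :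
    (r : ℂ) * dir z = z := by
  rw [mem_sphere_zero_iff_norm] at hz
  rw [← hz, norm_mul_dir]

/-- The section is replaced inside a disc by the extension of its boundary values that is constant
along rays in the chart. The only possible singularity is the centre, with an index determined by
the boundary circle. -/
theorem IsSectionOn.conic {A : Set X} {r : ℝ} (c : OrbifoldChart X) (hr : 0 < r) (hr2 : r < 2)
    (hσ : IsSectionOn σ A) (hA : c '' sphere 0 r ⊆ A) : ∃ (τ : X → SphereTangent X)
      (v : ℂ → Circle), IsSectionOn τ ((A \ c '' ball 0 r ∪ c '' closedBall 0 r) \ {c.center}) ∧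
        (∀ x ∉ c '' ball 0 r, τ x = σ x) ∧ ContinuousOn v (sphere 0 r) ∧
        (∀ z ∈ sphere 0 r, σ (c z) = rayAt c z (v z)) ∧
        ∀ z ∈ closedBall 0 r, z ≠ 0 → τ (c z) = rayAt c z (v (r * dir z)) := by
  classical
  have hs2 : sphere (0 : ℂ) r ⊆ ball 0 2 := sphere_subset_closedBall.trans (closedBall_subset_ball hr2)
  have hc2 : closedBall (0 : ℂ) r ⊆ ball 0 2 := closedBall_subset_ball hr2
  obtain ⟨v, hv, hσv⟩ := hσ.exists_vec c hs2 (image_subset_iff.1 hA)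
    (Or.inr fun h => by simp [hr.ne] at h)
  -- Points of one orbit carry the same value of σ, so the vectors of σ are equivariant, as is
  -- needed for `vecSection`.
  have hrot : ∀ z ∈ sphere (0 : ℂ) r, ∀ ξ : ℂ, ξ ^ c.order = 1 → (v (ξ * z) : ℂ) = ξ * v z := by
    intro z hz ξ hξ
    have hz2 := hs2 hz
    have hξz : ξ * z ∈ sphere (0 : ℂ) r := by
      rw [mem_sphere_zero_iff_norm] at hz ⊢
      rw [norm_mul, OrbifoldChart.norm_eq_one_of_pow hξ, one_mul, hz]
    have hz0 : z ≠ 0 := by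
      rintro rfl
      simp [hr.ne] at hz
    obtain ⟨η, -, h1, h2⟩ := (rayAt_eq_iff_same hz2 (hs2 hξz)).1
      ((hσv z hz).symm.trans ((congrArg σ (c.apply_rot hξ hz2).symm).trans (hσv _ hξz)))
    rw [h2, mul_right_cancel₀ hz0 h1]
  let u : ℂ → Circle := fun z => v (r * dir z)
  have hu : ∀ z ∈ closedBall (0 : ℂ) r \ {0}, ∀ ξ : ℂ, ξ ^ c.order = 1 →
      (u (ξ * z) : ℂ) = ξ * u z := by
    rintro z ⟨-, hz0⟩ ξ hξ
    rw [← hrot _ (mul_dir_mem_sphere hr z) ξ hξ]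
    change (v (r * dir (ξ * z)) : ℂ) = _
    rw [dir_rot (OrbifoldChart.norm_eq_one_of_pow hξ) z hz0, mul_left_comm]
  have huc : ContinuousOn u (closedBall (0 : ℂ) r \ {0}) :=
    hv.comp ((continuousOn_mul_dir r).mono fun z hz => hz.2) fun z _ => mul_dir_mem_sphere hr z
  have hval : ∀ z ∈ closedBall (0 : ℂ) r, z ≠ 0 → c.vecSection u (c z) = rayAt c z (u z) :=
    fun z hz hz0 => c.vecSection_apply (hc2 hz) (hu z ⟨hz, hz0⟩)
  have hsec := c.isSectionOn_vecSection (sdiff_subset.trans hc2) (v := u)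
    (A := closedBall (0 : ℂ) r \ {0}) (by
      rintro z ⟨hz, hz0⟩ ξ hξ
      have h1 := OrbifoldChart.norm_eq_one_of_pow hξ
      refine ⟨by simpa [h1] using hz, mul_ne_zero ?_ hz0⟩
      rintro rfl
      simp at h1) huc hu
  have hne : ∀ z ∈ sphere (0 : ℂ) r, z ≠ 0 := by
    rintro z hz rfl
    simp [hr.ne] at hz
  have hagree : ∀ x, x ∈ c '' closedBall 0 r → x ∉ c '' ball 0 r → c.vecSection u x = σ x := by
    rintro _ ⟨z, hz, rfl⟩ hxb
    have hzs : z ∈ sphere (0 : ℂ) r := by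
      rw [c.apply_mem_image_ball_iff (hc2 hz) hr2.le, not_lt] at hxb
      rw [mem_sphere_zero_iff_norm]
      exact le_antisymm (by simpa using hz) hxb
    rw [hval z hz (hne z hzs), hσv z hzs]
    simp only [u, mul_dir_of_mem_sphere hzs]
  refine ⟨fun x => if x ∈ c '' closedBall 0 r then c.vecSection u x else σ x, v,
    IsSectionOn.glue (c.isClosed_image_closedBall hr2) (c.isOpen_image_ball hr2.le).isClosed_compl
    (fun x _ => ?_) (hsec.mono ?_) (hσ.mono ?_) (fun x _ => hagree x), ?_, hv, hσv, ?_⟩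
  · by_cases hx : x ∈ c '' ball 0 r
    · exact Or.inl (image_mono ball_subset_closedBall hx)
    · exact Or.inr hx
  · rintro _ ⟨⟨z, hz, rfl⟩, -, hz0⟩
    exact ⟨z, ⟨hz, fun h => hz0 (by rw [h]; rfl)⟩, rfl⟩
  · rintro x ⟨hxb, hx | hx, -⟩
    · exact hx.1
    · obtain ⟨z, hz, rfl⟩ := hx
      refine hA ⟨z, ?_, rfl⟩
      rw [mem_compl_iff, c.apply_mem_image_ball_iff (hc2 hz) hr2.le, not_lt] at hxb
      rw [mem_sphere_zero_iff_norm]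
      exact le_antisymm (by simpa using hz) hxb
  · intro x hx
    beta_reduce
    split_ifs with h
    · exact hagree x h hx
    · rfl
  · intro z hz hz0
    beta_reduce
    rw [if_pos (mem_image_of_mem _ hz), hval z hz hz0]

/-- The degree along a circle determines the index of the conic extension. -/
theorem exists_degree_sphere {v : ℂ → Circle} {r : ℝ} (hr : 0 < r)
    (hv : ContinuousOn v (sphere 0 r)) : ∃ (K : ℤ) (g : Circle → ℝ), Continuous g ∧
      (∀ w : Circle, v (r * w) = w ^ K * Circle.exp (g w)) ∧
      HasDegAt (fun z => v (r * dir z)) 0 K := by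
  have hc : Continuous fun w : Circle => v (r * w) := by
    refine hv.comp_continuous (by fun_prop) fun w => ?_
    simp [abs_of_pos hr, Circle.norm_coe]
  obtain ⟨K, g, hg, h⟩ := Circle.exists_degree _ hc
  refine ⟨K, g, hg, h, 1, one_pos, fun z => g (dir z),
    hg.comp_continuousOn (continuousOn_dir.mono fun z hz => hz.2), fun z _ => ?_⟩
  beta_reduce
  rw [h, sub_zero, zpow_neg, mul_right_comm, mul_inv_cancel, one_mul]

end

section

/-! ### The sum of the indices does not depend on the section -/

open SphereTangent OrbifoldChart

variable {X : Type*} [TopologicalSpace X] [DiffeologicalSpace X] [IsTwoOrbifold X]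
  {o : OrbifoldOrientation X} {c : OrbifoldChart X} {σ τ : X → SphereTangent X} {p : X} {q : ℚ}

-- An added point is regular and the section is continuous there, so its index is zero.
open Classical in
theorem sum_idx_of_subset (ho : o.HasPositiveCharts) {P P' : Finset X} (hP : singularSet X ⊆ P)
    (hPP : P ⊆ P') (hσ : IsSectionOff σ P) : ∑ p ∈ P', idx o σ p = ∑ p ∈ P, idx o σ p := by
  refine (Finset.sum_subset hPP fun p _ hp => ?_).symm
  exact (hasIdx_zero ho hσ (P.finite_toSet.isClosed.isOpen_compl.mem_nhds hp)
    fun h => hp (hP h)).idx_eq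

/-- Sections that agree outside of the discs of the charts in `s` have the same sum of indices. -/
def DeterminesSum {X : Type*} [TopologicalSpace X] [DiffeologicalSpace X]
    (o : OrbifoldOrientation X) (s : Finset (OrbifoldChart X)) : Prop :=
  ∀ (ρ : ℝ) (P : Finset X) (σ τ : X → SphereTangent X), 0 < ρ → ρ < 2 → singularSet X ⊆ P →
    (∀ c ∈ s, c.center ∈ P) → IsSectionOff σ P → IsSectionOff τ P →
    (∀ x ∉ P, (∀ c ∈ s, x ∉ c '' ball 0 ρ) → σ x = τ x) →
    ∑ p ∈ P, idx o σ p = ∑ p ∈ P, idx o τ p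

theorem determinesSum_empty (ho : o.HasPositiveCharts) : DeterminesSum o ∅ := by
  intro ρ P σ τ _ _ _ _ _ hτ h
  refine Finset.sum_congr rfl fun p _ => ((hτ.hasIdx ho p).congr ?_).idx_eq
  rw [eventually_nhdsWithin_iff]
  have h1 : ((P : Set X) \ {p})ᶜ ∈ nhds p :=
    (P.finite_toSet.sdiff.isClosed.isOpen_compl).mem_nhds (by simp)
  filter_upwards [h1] with x hx hxp
  exact h x (fun h2 => hx ⟨h2, hxp⟩) (by simp)

/-- The section `υ` interpolates: it differs from `σ` only in the disc of `c` and from `τ` only in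
the discs of `s`. The first comparison is `sum_idx_eq_of_disc`, the second is the assumption on `s`.
-/
theorem DeterminesSum.step (ho : o.HasPositiveCharts) {s : Finset (OrbifoldChart X)}
    (hs : DeterminesSum o s) (hc : o.IsPositive c) {P P' : Finset X} (hP : singularSet X ⊆ P)
    (hsP : ∀ c ∈ s, c.center ∈ P) (hcP : c.center ∈ P) (hPP : P ⊆ P') (hσ : IsSectionOff σ P)
    (hτ : IsSectionOff τ P) {ρ : ℝ} (hρ : 0 < ρ) (hρ2 : ρ < 2) {υ : X → SphereTangent X}
    (hυ : IsSectionOff υ P') (h1 : ∀ x ∉ P', x ∉ c '' ball 0 ρ → υ x = σ x)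
    (h2 : ∀ x ∉ P', (∀ c ∈ s, x ∉ c '' ball 0 ρ) → υ x = τ x) :
    ∑ p ∈ P, idx o σ p = ∑ p ∈ P, idx o τ p := by
  have hPP' : (P : Set X) ⊆ P' := by exact_mod_cast hPP
  rw [← sum_idx_of_subset ho hP hPP hσ, ← sum_idx_of_subset ho hP hPP hτ,
    ← sum_idx_eq_of_disc ho hc (hPP hcP) hυ (hσ.mono hPP') hρ2 h1]
  exact hs ρ P' υ τ hρ hρ2 (hP.trans hPP') (fun c hc => hPP (hsP c hc)) hυ (hτ.mono hPP') h2

-- If the new disc is disjoint from the others, the interpolating section is `τ` inside of it and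
-- `σ` outside. This serves the cone points, where no extension in the plane is available.
open Classical in
theorem DeterminesSum.insert_disjoint (ho : o.HasPositiveCharts) {s : Finset (OrbifoldChart X)}
    (hs : DeterminesSum o s) (hc : o.IsPositive c)
    (hdis : ∀ a ∈ s, Disjoint c.image a.image) : DeterminesSum o (insert c s) := by
  intro ρ P σ τ hρ hρ2 hP hcen hσ hτ h
  obtain ⟨r, hr, hr2⟩ := exists_between hρ2
  have hagree : ∀ x ∉ P, x ∈ c '' closedBall 0 r → x ∉ c '' ball 0 r → τ x = σ x := by
    intro x hxP hx hxb
    refine (h x hxP fun a ha => ?_).symm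
    rcases Finset.mem_insert.1 ha with rfl | ha
    · exact fun h => hxb (image_mono (ball_subset_ball hr.le) h)
    · exact fun h => disjoint_left.1 (hdis a ha) (image_mono (closedBall_subset_ball hr2) hx)
        (image_mono (ball_subset_ball hρ2.le) h)
  refine hs.step ho hc hP (fun a ha => hcen a (Finset.mem_insert_of_mem ha))
    (hcen c (Finset.mem_insert_self _ _)) subset_rfl hσ hτ (hρ.trans hr) hr2
    (υ := fun x => if x ∈ c '' closedBall 0 r then τ x else σ x) ?_ ?_ ?_
  · rw [isSectionOff_iff] at hσ hτ ⊢
    refine IsSectionOn.glue (c.isClosed_image_closedBall hr2)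
      (c.isOpen_image_ball hr2.le).isClosed_compl (fun x _ => ?_) (hτ.mono inter_subset_right)
      (hσ.mono inter_subset_right) hagree
    by_cases hx : x ∈ c '' ball 0 r
    · exact Or.inl (image_mono ball_subset_closedBall hx)
    · exact Or.inr hx
  · intro x hxP hx
    split_ifs with h'
    · exact hagree x hxP h' hx
    · rfl
  · intro x hxP hx
    split_ifs with h'
    · rfl
    · refine h x hxP fun a ha => ?_
      rcases Finset.mem_insert.1 ha with rfl | ha
      · exact fun h => h' (image_mono (ball_subset_closedBall.trans (closedBall_subset_closedBall hr.le)) h)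
      · exact fun h => hx a ha (image_mono (ball_subset_ball hr.le) h)

-- A regular disc may overlap the others. In it the interpolating section has to be `σ` on the
-- boundary circle and `τ` off the other discs, and is otherwise arbitrary up to new punctures. The
-- extension theorem in the plane provides it.
open Classical in
theorem DeterminesSum.insert_of_order (ho : o.HasPositiveCharts) {s : Finset (OrbifoldChart X)}
    (hs : DeterminesSum o s) (hc : o.IsPositive c) (hc1 : c.order = 1) :
    DeterminesSum o (insert c s) := by
  intro ρ P σ τ hρ hρ2 hP hcen hσ hτ h
  obtain ⟨r, hr, hr2, hrP⟩ := exists_radius (insert c s) P hρ2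
  have hsb : sphere (0 : ℂ) r ⊆ ball 0 2 :=
    sphere_subset_closedBall.trans (closedBall_subset_ball hr2)
  have hcb : closedBall (0 : ℂ) r ⊆ ball 0 2 := closedBall_subset_ball hr2
  obtain ⟨v, hv, hσv⟩ := hσ.exists_vec c (Or.inl hc1)
  obtain ⟨u, hu, hτu⟩ := hτ.exists_vec c (Or.inl hc1)
  let Q := (c.finite_preimage P).toFinset
  have hQ : ∀ z, z ∈ Q ↔ z ∈ ball (0 : ℂ) 2 ∧ c z ∈ P := fun z => by simp [Q]
  -- The part of the disc that is outside of the other discs, where the new section has to be `τ`.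
  let C₁ : Set ℂ := closedBall 0 r ∩ c ⁻¹' (⋂ a ∈ s, (a '' ball 0 r)ᶜ)
  have hC₁ : IsClosed C₁ :=
    (c.continuousOn.mono hcb).preimage_isClosed_of_isClosed isClosed_closedBall
      (isClosed_biInter fun a _ => (a.isOpen_image_ball hr2.le).isClosed_compl)
  let C : Set ℂ := C₁ ∪ sphere 0 r
  have hC : IsClosed C := hC₁.union isClosed_sphere
  have hCb : C ⊆ closedBall 0 r := union_subset inter_subset_left sphere_subset_closedBall
  -- the two sections agree over the part of the circle outside of the other discs
  have hagree : ∀ z ∈ sphere (0 : ℂ) r, z ∈ C₁ → σ (c z) = τ (c z) := by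
    intro z hz hz1
    refine h _ (hrP c (Finset.mem_insert_self _ _) z hz) fun a ha => ?_
    rcases Finset.mem_insert.1 ha with rfl | ha
    · rw [a.apply_mem_image_ball_iff (hsb hz) hρ2.le, not_lt, mem_sphere_zero_iff_norm.1 hz]
      exact hr.le
    · intro h1
      exact mem_iInter₂.1 hz1.2 a ha (image_mono (ball_subset_ball hr.le) h1)
  -- The prescribed vectors: those of `σ` on the circle and those of `τ` on `C₁`, which agree on the
  -- overlap.
  let f : ℂ → Circle := fun z => if z ∈ sphere (0 : ℂ) r then v z else u z
  have hfs : ∀ z ∈ sphere (0 : ℂ) r, σ (c z) = rayAt c z (f z) := fun z hz => by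
    simp only [f, if_pos hz]
    exact hσv z ⟨hsb hz, fun h => hrP c (Finset.mem_insert_self _ _) z hz h⟩
  have hf1 : ∀ z ∈ C₁, c z ∉ P → τ (c z) = rayAt c z (f z) := fun z hz hzP => by
    by_cases hzs : z ∈ sphere (0 : ℂ) r
    · rw [← hagree z hzs hz, hfs z hzs]
    · simp only [f, if_neg hzs]
      exact hτu z ⟨hcb hz.1, hzP⟩
  have hfu : ∀ z ∈ C₁, c z ∉ P → f z = u z := fun z hz hzP => by
    refine rayAt_injective (hcb hz.1) (c := c) (Or.inl hc1) ?_
    rw [← hf1 z hz hzP, hτu z ⟨hcb hz.1, hzP⟩]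
  have hfc : ContinuousOn f (C \ Q) := by
    refine ContinuousOn.of_isClosed_cover hC₁ (isClosed_sphere (x := (0 : ℂ)) (ε := r))
      sdiff_subset ?_ ?_
    · refine (hu.mono ?_).congr ?_
      · rintro z ⟨hz, -, hzQ⟩
        exact ⟨hcb hz.1, fun h => hzQ ((hQ z).2 ⟨hcb hz.1, h⟩)⟩
      · rintro z ⟨hz, -, hzQ⟩
        exact hfu z hz fun h => hzQ ((hQ z).2 ⟨hcb hz.1, h⟩)
    · refine (hv.mono ?_).congr ?_
      · rintro z ⟨hz, -, hzQ⟩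
        exact ⟨hsb hz, fun h => hzQ ((hQ z).2 ⟨hsb hz, h⟩)⟩
      · rintro z ⟨hz, -⟩
        exact if_pos hz
  -- The radius was chosen so that no boundary circle of a disc meets `P`. Hence the punctures in
  -- `C` are interior points, as the extension theorem requires.
  obtain ⟨Q', G, hQQ', hG, hGf⟩ := exists_extension_with_punctures hC r Q (by
    intro p hp hpC
    obtain ⟨hp2, hpP⟩ := (hQ p).1 hp
    have hps : p ∉ sphere (0 : ℂ) r := fun h => hrP c (Finset.mem_insert_self _ _) p h hpP
    have hp1 : p ∈ C₁ := hpC.resolve_right hps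
    have ho : IsOpen (ball (0 : ℂ) r ∩ c ⁻¹' (⋂ a ∈ s, (a '' closedBall 0 r)ᶜ)) :=
      (c.continuousOn.mono (ball_subset_ball hr2.le)).isOpen_inter_preimage isOpen_ball
        (isOpen_biInter_finset fun a _ => (a.isClosed_image_closedBall hr2).isOpen_compl)
    refine mem_interior.2 ⟨_, ?_, ho, ?_, ?_⟩
    · rintro z ⟨hz, hz'⟩
      refine Or.inl ⟨ball_subset_closedBall hz, mem_iInter₂.2 fun a ha h1 => ?_⟩
      exact mem_iInter₂.1 hz' a ha (image_mono ball_subset_closedBall h1)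
    · have h1 := hp1.1
      rw [mem_closedBall_zero_iff] at h1
      rw [mem_sphere_zero_iff_norm] at hps
      exact mem_ball_zero_iff.2 (lt_of_le_of_ne h1 hps)
    · refine mem_iInter₂.2 fun a ha => ?_
      rintro ⟨w, hw, hwp⟩
      rcases (mem_closedBall_zero_iff.1 hw).lt_or_eq with h1 | h1
      · exact mem_iInter₂.1 hp1.2 a ha ⟨w, mem_ball_zero_iff.2 h1, hwp⟩
      · exact hrP a (Finset.mem_insert_of_mem ha) w (mem_sphere_zero_iff_norm.2 h1) (hwp ▸ hpP)) hfc
  let P' : Finset X := P ∪ Q'.image c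
  have hPP' : P ⊆ P' := Finset.subset_union_left
  have hval : ∀ z ∈ ball (0 : ℂ) 2, c.vecSection G (c z) = rayAt c z (G z) := fun z hz =>
    c.vecSection_apply hz fun ξ hξ => by rw [show ξ = 1 by simpa [hc1] using hξ, one_mul, one_mul]
  have hGs : ∀ x, x ∈ c '' closedBall 0 r → x ∉ c '' ball 0 r → c.vecSection G x = σ x := by
    rintro _ ⟨z, hz, rfl⟩ hxb
    have hzs : z ∈ sphere (0 : ℂ) r := by
      rw [c.apply_mem_image_ball_iff (hcb hz) hr2.le, not_lt] at hxb
      rw [mem_sphere_zero_iff_norm]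
      exact le_antisymm (by simpa using hz) hxb
    rw [hval z (hcb hz), hGf (Or.inr hzs), hfs z hzs]
  have hcs : ∀ a ∈ s, a.center ∈ P := fun a ha => hcen a (Finset.mem_insert_of_mem ha)
  refine hs.step ho hc hP hcs
    (hcen c (Finset.mem_insert_self _ _)) hPP' hσ hτ (hρ.trans hr) hr2
    (υ := fun x => if x ∈ c '' closedBall 0 r then c.vecSection G x else σ x) ?_ ?_ ?_
  · have hσ' := isSectionOff_iff.1 hσ
    rw [isSectionOff_iff]
    refine IsSectionOn.glue (c.isClosed_image_closedBall hr2)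
      (c.isOpen_image_ball hr2.le).isClosed_compl (fun x _ => ?_)
      ((c.isSectionOn_vecSection (A := closedBall 0 r \ c ⁻¹' P') (sdiff_subset.trans hcb) ?_
        (hG.mono ?_) ?_).mono ?_) (hσ'.mono ?_) fun x _ => hGs x
    · by_cases hx : x ∈ c '' ball 0 r
      · exact Or.inl (image_mono ball_subset_closedBall hx)
      · exact Or.inr hx
    · intro z hz ξ hξ
      rwa [show ξ = 1 by simpa [hc1] using hξ, one_mul]
    · rintro z ⟨hz, hzP⟩
      exact ⟨hz, fun h1 => hzP (Finset.mem_union_right _ (Finset.mem_image_of_mem _ h1))⟩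
    · intro z _ ξ hξ
      rw [show ξ = 1 by simpa [hc1] using hξ, one_mul, one_mul]
    · rintro _ ⟨⟨z, hz, rfl⟩, hzP⟩
      exact ⟨z, ⟨hz, hzP⟩, rfl⟩
    · rintro x ⟨-, hx⟩ h1
      exact hx (hPP' h1)
  · intro x _ hx
    split_ifs with h'
    · exact hGs x h' hx
    · rfl
  · intro x hxP hx
    have hxP1 : x ∉ P := fun h1 => hxP (hPP' h1)
    split_ifs with h'
    · obtain ⟨z, hz, rfl⟩ := h'
      have hz1 : z ∈ C₁ := ⟨hz, mem_iInter₂.2 hx⟩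
      rw [hval z (hcb hz), hGf (Or.inl hz1), hf1 z hz1 hxP1]
    · refine h x hxP1 fun a ha => ?_
      rcases Finset.mem_insert.1 ha with rfl | ha
      · exact fun h => h' (image_mono (ball_subset_closedBall.trans (closedBall_subset_closedBall hr.le)) h)
      · exact fun h => hx a ha (image_mono (ball_subset_ball hr.le) h)

/-- A compact oriented orbifold is covered by disjoint discs around its singular points and
regular discs. -/
theorem OrbifoldOrientation.HasPositiveCharts.exists_cover [CompactSpace X]
    (ho : o.HasPositiveCharts) (hfin : (singularSet X).Finite) :
    ∃ s t : Finset (OrbifoldChart X), (∀ c ∈ s, o.IsPositive c) ∧ (∀ c ∈ t, o.IsPositive c) ∧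
      (∀ c ∈ s, c.center ∈ singularSet X) ∧ (∀ c ∈ t, c.order = 1) ∧
      (∀ a ∈ s, ∀ b ∈ s, a ≠ b → Disjoint a.image b.image) ∧
      (∀ x ∈ singularSet X, ∃ c ∈ s, c.center = x) ∧
      ∀ x, ∃ c, (c ∈ s ∨ c ∈ t) ∧ x ∈ c '' ball 0 1 := by
  classical
  obtain ⟨V, hV, hdis⟩ := hfin.t2_separation
  have hex : ∀ x : X, ∃ c, o.IsPositive c ∧ c.center = x ∧ c.image ⊆ V x := fun x =>
    ho.exists_chart ((hV x).2.mem_nhds (hV x).1)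
  choose D hD hDx hDV using hex
  have hmem : ∀ x, x ∈ D x '' ball 0 1 := fun x => ⟨0, by simp, hDx x⟩
  obtain ⟨T, hT⟩ := isCompact_univ.elim_finite_subcover (fun x => D x '' ball 0 1)
    (fun x => (D x).isOpen_image_ball (by norm_num)) fun x _ => mem_iUnion.2 ⟨x, hmem x⟩
  refine ⟨hfin.toFinset.image D, (T.filter (· ∉ singularSet X)).image D, ?_, ?_, ?_, ?_, ?_, ?_, ?_⟩
  · simp only [Finset.mem_image]
    rintro _ ⟨x, -, rfl⟩
    exact hD x
  · simp only [Finset.mem_image]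
    rintro _ ⟨x, -, rfl⟩
    exact hD x
  · simp only [Finset.mem_image, Finite.mem_toFinset]
    rintro _ ⟨x, hx, rfl⟩
    rwa [hDx]
  · simp only [Finset.mem_image, Finset.mem_filter]
    rintro _ ⟨x, ⟨-, hx⟩, rfl⟩
    exact (D x).order_eq_one (by rwa [hDx])
  · simp only [Finset.mem_image, Finite.mem_toFinset]
    rintro _ ⟨x, hx, rfl⟩ _ ⟨y, hy, rfl⟩ hxy
    exact (hdis hx hy fun h => hxy (by rw [h])).mono (hDV x) (hDV y)
  · intro x hx
    exact ⟨D x, Finset.mem_image_of_mem _ (hfin.mem_toFinset.2 hx), hDx x⟩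
  · intro x
    obtain ⟨y, hyT, hy⟩ := mem_iUnion₂.1 (hT (mem_univ x))
    refine ⟨D y, ?_, hy⟩
    by_cases h : y ∈ singularSet X
    · exact Or.inl (Finset.mem_image_of_mem _ (hfin.mem_toFinset.2 h))
    · exact Or.inr (Finset.mem_image_of_mem _ (Finset.mem_filter.2 ⟨hyT, h⟩))

/-- The sum of the indices of a section does not depend on the section. -/
theorem sum_idx_eq [CompactSpace X] (ho : o.HasPositiveCharts) {P : Finset X}
    (hP : singularSet X ⊆ P) (hσ : IsSectionOff σ P) (hτ : IsSectionOff τ P) :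
    ∑ p ∈ P, idx o σ p = ∑ p ∈ P, idx o τ p := by
  classical
  obtain ⟨s, t, hs, ht, -, ht1, hdis, -, hcov⟩ := ho.exists_cover (P.finite_toSet.subset hP)
  -- The cone discs come first, as they are disjoint from each other; the regular discs are added
  -- afterwards in any position.
  have key : DeterminesSum o (t ∪ s) := by
    have h1 : ∀ s' ⊆ s, DeterminesSum o s' := by
      intro s' hs'
      induction s' using Finset.induction_on with
      | empty => exact determinesSum_empty ho
      | insert a s' ha ih =>
        have h2 := Finset.insert_subset_iff.1 hs'
        exact (ih h2.2).insert_disjoint ho (hs a h2.1) fun b hb =>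
          hdis a h2.1 b (h2.2 hb) fun h => ha (h ▸ hb)
    have h2 : ∀ t' ⊆ t, DeterminesSum o (t' ∪ s) := by
      intro t' ht'
      induction t' using Finset.induction_on with
      | empty => simpa using h1 s subset_rfl
      | insert a t' ha ih =>
        have h3 := Finset.insert_subset_iff.1 ht'
        rw [Finset.insert_union]
        exact (ih h3.2).insert_of_order ho (ht a h3.1) (ht1 a h3.1)
    exact h2 t subset_rfl
  let P' := P ∪ (t ∪ s).image center
  have hPP' : P ⊆ P' := Finset.subset_union_left
  have hPP'' : (P : Set X) ⊆ P' := by exact_mod_cast hPP'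
  rw [← sum_idx_of_subset ho hP hPP' hσ, ← sum_idx_of_subset ho hP hPP' hτ]
  -- The unit discs cover `X`, so nothing has to be checked about agreement outside of them.
  refine key 1 P' σ τ one_pos (by norm_num) (hP.trans hPP'')
    (fun c hc => Finset.mem_union_right _ (Finset.mem_image_of_mem _ hc)) (hσ.mono hPP'')
    (hτ.mono hPP'') fun x _ hx => ?_
  obtain ⟨c, hc, hxc⟩ := hcov x
  exact (hx c (Finset.mem_union.2 hc.symm) hxc).elim

end

section

/-! ### Existence of sections -/

open SphereTangent OrbifoldChart

variable {X : Type*} [TopologicalSpace X] [DiffeologicalSpace X] [IsTwoOrbifold X]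
  {o : OrbifoldOrientation X} {c : OrbifoldChart X} {σ τ : X → SphereTangent X} {p : X} {q : ℚ}

/-- The radial field is invariant under rotations and so defines a section around any centre, also a
singular one. -/
theorem isSectionOn_radial (c : OrbifoldChart X) :
    IsSectionOn (c.vecSection dir) (c.image \ {c.center}) := by
  have h1 := c.isSectionOn_vecSection (v := dir) (A := ball (0 : ℂ) 2 \ {0}) sdiff_subset (by
    rintro z ⟨hz, hz0⟩ ξ hξ
    refine ⟨rot_mem hξ hz, mul_ne_zero ?_ hz0⟩
    rintro rfl
    simp [c.order_pos.ne'] at hξ) (continuousOn_dir.mono fun z hz => hz.2)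
    fun z hz ξ hξ => dir_rot (norm_eq_one_of_pow hξ) z hz.2
  refine h1.mono ?_
  rintro _ ⟨⟨z, hz, rfl⟩, hz0⟩
  exact ⟨z, ⟨hz, fun h => hz0 (by rw [h]; rfl)⟩, rfl⟩

open Classical in
theorem exists_section_discs {s : Finset (OrbifoldChart X)}
    (hdis : ∀ a ∈ s, ∀ b ∈ s, a ≠ b → Disjoint a.image b.image) : ∃ σ : X → SphereTangent X,
      IsSectionOn σ ((⋃ c ∈ s, c.image) \ s.image center) := by
  by_cases hX : IsEmpty X
  · exact ⟨fun x => (hX.false x).elim, fun x => (hX.false x).elim, fun x => (hX.false x).elim⟩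
  obtain ⟨x₀⟩ := not_isEmpty_iff.1 hX
  obtain ⟨c₀, -⟩ := IsTwoOrbifold.exists_chart x₀
  let σ : X → SphereTangent X := fun x =>
    if h : ∃ c ∈ s, x ∈ c.image then h.choose.vecSection dir x else rayAt c₀ 0 1
  have hσ : ∀ c ∈ s, ∀ x ∈ c.image, σ x = c.vecSection dir x := by
    intro c hc x hx
    have h : ∃ c ∈ s, x ∈ c.image := ⟨c, hc, hx⟩
    simp only [σ, dif_pos h]
    by_contra hne
    exact disjoint_left.1 (hdis _ h.choose_spec.1 c hc fun h => hne (by rw [h])) h.choose_spec.2 hx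
  have hne : ∀ c ∈ s, ∀ x ∉ s.image center, x ≠ c.center := fun c hc x hx h =>
    hx (h ▸ Finset.mem_image_of_mem _ hc)
  refine ⟨σ, fun x hx => ?_, fun x hx => ?_⟩
  · obtain ⟨c, hc, hxc⟩ := mem_iUnion₂.1 hx.1
    have h1 : c.image \ {c.center} ∈ nhds x :=
      (c.isOpen_image.sdiff isClosed_singleton).mem_nhds ⟨hxc, hne c hc x hx.2⟩
    refine ContinuousAt.continuousWithinAt ?_
    refine ((isSectionOn_radial c).continuousOn.continuousAt h1).congr ?_
    filter_upwards [h1] with y hy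
    exact (hσ c hc y hy.1).symm
  · obtain ⟨c, hc, hxc⟩ := mem_iUnion₂.1 hx.1
    rw [hσ c hc x hxc]
    exact (isSectionOn_radial c).proj_eq x ⟨hxc, hne c hc x hx.2⟩

-- On the part of a circle that lies in `L` the vectors of the section are extended to the whole
-- disc with finitely many punctures. Inside the disc the old section is given up, so only its
-- values on the circle matter.
open Classical in
theorem IsSectionOn.extend_disc {L : Set X} {P : Finset X} (hL : IsClosed L)
    (hσ : IsSectionOn σ (L \ P)) (hc1 : c.order = 1) :
    ∃ (L' : Set X) (P' : Finset X) (τ : X → SphereTangent X), IsClosed L' ∧ L ⊆ L' ∧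
      c '' ball 0 1 ⊆ L' ∧ IsSectionOn τ (L' \ P') := by
  obtain ⟨r, hr, hr2, hrP⟩ := exists_radius {c} P (by norm_num : (1 : ℝ) < 2)
  replace hrP := hrP c (Finset.mem_singleton_self _)
  have hcb : closedBall (0 : ℂ) r ⊆ ball 0 2 := closedBall_subset_ball hr2
  have hsb : sphere (0 : ℂ) r ⊆ ball 0 2 := sphere_subset_closedBall.trans hcb
  let A : Set ℂ := sphere 0 r ∩ c ⁻¹' L
  have hA : IsClosed A := (c.continuousOn.mono hsb).preimage_isClosed_of_isClosed isClosed_sphere hL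
  obtain ⟨v, hv, hσv⟩ := hσ.exists_vec c (A := A) (inter_subset_left.trans hsb)
    (fun z hz => ⟨hz.2, hrP z hz.1⟩) (Or.inl hc1)
  obtain ⟨Q, G, hG, hGv⟩ := exists_extension_finite_punctures hA r hv
  have hval : ∀ z ∈ ball (0 : ℂ) 2, c.vecSection G (c z) = rayAt c z (G z) := fun z hz =>
    c.vecSection_apply hz fun ξ hξ => by rw [show ξ = 1 by simpa [hc1] using hξ, one_mul, one_mul]
  have hLb : IsClosed (L \ c '' ball 0 r) := hL.sdiff (c.isOpen_image_ball hr2.le)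
  refine ⟨c '' closedBall 0 r ∪ L, P ∪ Q.image c, fun x => if x ∈ c '' closedBall 0 r then
    c.vecSection G x else σ x, (c.isClosed_image_closedBall hr2).union hL, subset_union_right,
    (image_mono (ball_subset_closedBall.trans (closedBall_subset_closedBall hr.le))).trans
      subset_union_left,
    IsSectionOn.glue (c.isClosed_image_closedBall hr2) hLb ?_
      ((c.isSectionOn_vecSection (A := closedBall 0 r \ Q) (sdiff_subset.trans hcb) ?_ hG ?_).mono ?_)
      (hσ.mono ?_) ?_⟩
  · rintro x ⟨hx | hx, -⟩
    · exact Or.inl hx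
    · by_cases h : x ∈ c '' ball 0 r
      · exact Or.inl (image_mono ball_subset_closedBall h)
      · exact Or.inr ⟨hx, h⟩
  · intro z hz ξ hξ
    rwa [show ξ = 1 by simpa [hc1] using hξ, one_mul]
  · intro z _ ξ hξ
    rw [show ξ = 1 by simpa [hc1] using hξ, one_mul, one_mul]
  · rintro _ ⟨⟨z, hz, rfl⟩, -, hzP⟩
    exact ⟨z, ⟨hz, fun h => hzP (Finset.mem_union_right _ (Finset.mem_image_of_mem _ h))⟩, rfl⟩
  · rintro x ⟨hx, -, hxP⟩
    exact ⟨hx.1, fun h => hxP (Finset.mem_union_left _ h)⟩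
  · rintro _ _ ⟨z, hz, rfl⟩ ⟨hzL, hzb⟩
    have hzs : z ∈ sphere (0 : ℂ) r := by
      rw [c.apply_mem_image_ball_iff (hcb hz) hr2.le, not_lt] at hzb
      rw [mem_sphere_zero_iff_norm]
      exact le_antisymm (by simpa using hz) hzb
    rw [hval z (hcb hz), hGv ⟨hzs, hzL⟩, hσv z ⟨hzs, hzL⟩]

/-- Radial fields near the cone points are extended over the regular discs of a finite cover, one at
a time. -/
theorem exists_section_finite [CompactSpace X] (ho : o.HasPositiveCharts)
    (hfin : (singularSet X).Finite) : ∃ (P : Finset X) (σ : X → SphereTangent X),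
      IsSectionOff σ P := by
  classical
  obtain ⟨s, t, -, -, -, ht1, hdis, -, hcov⟩ := ho.exists_cover hfin
  have key : ∀ t' ⊆ t, ∃ (L : Set X) (P : Finset X) (σ : X → SphereTangent X), IsClosed L ∧
      (∀ c, c ∈ s ∨ c ∈ t' → c '' ball 0 1 ⊆ L) ∧ IsSectionOn σ (L \ P) := by
    intro t' ht'
    induction t' using Finset.induction_on with
    | empty =>
      obtain ⟨σ, hσ⟩ := exists_section_discs hdis
      refine ⟨⋃ c ∈ s, c '' closedBall 0 1, s.image center, σ, ?_, ?_, hσ.mono ?_⟩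
      · exact isClosed_biUnion_finset fun c _ => c.isClosed_image_closedBall (by norm_num)
      · rintro c (hc | hc)
        · exact (image_mono ball_subset_closedBall).trans
            (subset_biUnion_of_mem (u := fun c : OrbifoldChart X => c '' closedBall (0 : ℂ) 1) hc)
        · simp at hc
      · refine sdiff_subset_sdiff_left (iUnion₂_mono fun c _ => ?_)
        exact image_mono (closedBall_subset_ball (by norm_num))
    | insert a t' ha ih =>
      have h3 := Finset.insert_subset_iff.1 ht'
      obtain ⟨L, P, σ, hL, hLc, hσ⟩ := ih h3.2
      obtain ⟨L', P', τ, hL', hLL, hLa, hτ⟩ := hσ.extend_disc hL (ht1 a h3.1)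
      refine ⟨L', P', τ, hL', ?_, hτ⟩
      rintro c (hc | hc)
      · exact (hLc c (Or.inl hc)).trans hLL
      · rcases Finset.mem_insert.1 hc with rfl | hc
        · exact hLa
        · exact (hLc c (Or.inr hc)).trans hLL
  obtain ⟨L, P, σ, -, hL, hσ⟩ := key t subset_rfl
  refine ⟨P, σ, isSectionOff_iff.2 (hσ.mono fun x hx => ⟨?_, hx⟩)⟩
  obtain ⟨c, hc, hx'⟩ := hcov x
  exact hL c hc hx'

/-- Singularities of a section in a disc may be moved to its centre. -/
theorem IsSectionOff.move (c : OrbifoldChart X) {s : Set X} (hs : s.Finite) {x : X}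
    (hx : x ∈ c.image) (hσ : IsSectionOff σ (insert x s)) :
    ∃ τ : X → SphereTangent X, IsSectionOff τ (insert c.center s) := by
  classical
  obtain ⟨z, hz, rfl⟩ := hx
  -- A circle around the centre that encloses `z` and avoids all singularities; the conic extension
  -- from it has the centre as its only singularity inside.
  obtain ⟨r, hr, hr2, hrP⟩ := exists_radius {c} (hs.insert (c z)).toFinset (mem_ball_zero_iff.1 hz)
  replace hrP : ∀ w ∈ sphere (0 : ℂ) r, c w ∉ insert (c z) s := fun w hw h =>
    hrP c (Finset.mem_singleton_self _) w hw ((hs.insert (c z)).mem_toFinset.2 h)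
  obtain ⟨τ, v, hτ, -⟩ := (isSectionOff_iff.1 hσ).conic c ((norm_nonneg z).trans_lt hr) hr2
    (by
      rintro _ ⟨w, hw, rfl⟩
      exact hrP w hw)
  refine ⟨τ, isSectionOff_iff.2 (hτ.mono fun y hy => ⟨?_, fun h => hy (Or.inl h)⟩)⟩
  by_cases hyb : y ∈ c '' ball 0 r
  · exact Or.inr (image_mono ball_subset_closedBall hyb)
  · refine Or.inl ⟨?_, hyb⟩
    rintro (rfl | h)
    · exact hyb ((c.apply_mem_image_ball_iff hz hr2.le).2 hr)
    · exact hy (Or.inr h)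

/-- On a connected orbifold there is a section with a single regular singularity at a given
point. -/
theorem exists_section [CompactSpace X] [PreconnectedSpace X] (ho : o.HasPositiveCharts)
    (hfin : (singularSet X).Finite) (x₀ : X) : ∃ σ : X → SphereTangent X,
      IsSectionOff σ (insert x₀ (singularSet X)) := by
  classical
  let G : Finset X → Prop := fun Q => ∃ σ : X → SphereTangent X,
    IsSectionOff σ ((singularSet X) ∪ Q)
  have hGmono : ∀ {Q Q'}, Q ⊆ Q' → G Q → G Q' := fun {Q Q'} h ⟨σ, hσ⟩ =>
    ⟨σ, hσ.mono (union_subset_union_right _ (by exact_mod_cast h))⟩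
  have hmove : ∀ (c : OrbifoldChart X) (Q : Finset X) (x : X), x ∈ c.image → G (insert x Q) →
      G (insert c.center Q) := by
    rintro c Q x hx ⟨σ, hσ⟩
    rw [Finset.coe_insert, union_insert] at hσ
    obtain ⟨τ, hτ⟩ := hσ.move c (hfin.union Q.finite_toSet) hx
    refine ⟨τ, ?_⟩
    rwa [Finset.coe_insert, union_insert]
  -- The points from which a singularity can be moved to `x₀`. The set contains `x₀` and is shown to
  -- be open and closed.
  let A : Set X := {x | ∀ Q, G (insert x Q) → G (insert x₀ Q)}
  have hA1 : IsOpen A := by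
    rw [isOpen_iff_mem_nhds]
    intro y hy
    obtain ⟨c, hc, rfl, -⟩ := ho.exists_chart (x := y) Filter.univ_mem
    filter_upwards [c.isOpen_image.mem_nhds ⟨0, by simp, rfl⟩] with x hx Q hQ
    exact hy Q (hmove c Q x hx hQ)
  have hA2 : IsOpen Aᶜ := by
    rw [isOpen_iff_mem_nhds]
    intro y hy
    have hyr : y ∉ singularSet X := fun h => hy fun Q ⟨σ, hσ⟩ => by
      refine hGmono (Finset.subset_insert _ _) ⟨σ, ?_⟩
      rwa [Finset.coe_insert, union_insert, insert_eq_of_mem (mem_union_left _ h)] at hσ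
    obtain ⟨c, hc, rfl, -⟩ := ho.exists_chart (x := y) Filter.univ_mem
    have hc1 := c.order_eq_one hyr
    filter_upwards [(c.isOpen_image_ball (r := 1 / 2) (by norm_num)).mem_nhds ⟨0, by simp, rfl⟩]
    rintro _ ⟨z, hz, rfl⟩ hx
    refine hy fun Q hQ => hx Q ?_
    rw [mem_ball_zero_iff] at hz
    have hsub : ball z (2 * (1 / 2)) ⊆ ball (0 : ℂ) 2 := fun w hw => by
      rw [mem_ball_iff_norm] at hw
      rw [mem_ball_zero_iff]
      calc ‖w‖ = ‖z + (w - z)‖ := by congr 1; ring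
        _ ≤ ‖z‖ + ‖w - z‖ := norm_add_le _ _
        _ < 2 := by linarith
    -- Motion goes to the centre of a chart, so a chart centred at the nearby point is used. Its
    -- disc has radius 1 in the coordinate of `c` and contains 0, at -2z in its own coordinate.
    have h1 := hmove (c.sub z (1 / 2) (by norm_num) hsub ((c.injOn_of_order_eq_one hc1).mono hsub))
      Q c.center ?_ hQ
    · convert h1 using 2
      change c z = c (z + _ * 0)
      rw [mul_zero, add_zero]
    · refine ⟨-(2 * z), ?_, ?_⟩
      · rw [mem_ball_zero_iff, norm_neg, norm_mul]
        norm_num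
        linarith
      · change c (z + ((1 / 2 : ℝ) : ℂ) * -(2 * z)) = c 0
        congr 1
        push_cast
        ring
  have hAu : A = univ := IsClopen.eq_univ ⟨⟨hA2⟩, hA1⟩ ⟨x₀, fun Q h => h⟩
  -- The singularities are moved to `x₀` one by one and merge there.
  have hred : ∀ Q, G (insert x₀ Q) → G {x₀} := by
    intro Q
    induction Q using Finset.induction_on with
    | empty => exact id
    | insert a Q _ ih =>
      intro h
      have ha : a ∈ A := hAu ▸ mem_univ a
      refine ih ?_
      have h1 := ha (insert x₀ Q) (by rwa [Finset.insert_comm])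
      rwa [Finset.insert_idem] at h1
  obtain ⟨P, σ, hσ⟩ := exists_section_finite ho hfin
  obtain ⟨τ, hτ⟩ := hred P ⟨σ, hσ.mono (by
    rw [Finset.coe_insert]
    exact (subset_insert _ _).trans subset_union_right)⟩
  exact ⟨τ, by simpa using hτ⟩

end

section

/-! ### The Euler characteristic as the sum of the indices of a section -/

open SphereTangent OrbifoldChart

universe u

section

variable {X : Type u} [TopologicalSpace X] [DiffeologicalSpace X] [IsTwoOrbifold X]
  {o : OrbifoldOrientation X} {c : OrbifoldChart X} {σ τ : X → SphereTangent X} {p : X} {q : ℚ}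

theorem OrbifoldChart.openDisc_subset_closedDisc (c : OrbifoldChart X) :
    c.openDisc ⊆ c.closedDisc := image_mono ball_subset_closedBall

theorem OrbifoldChart.center_mem_openDisc (c : OrbifoldChart X) : c.center ∈ c.openDisc :=
  ⟨0, by simp, rfl⟩

/-- The section of Euler data extends to the complement of the centres of the discs. -/
theorem EulerData.exists_section
    (d : EulerData o (SphereTangent.proj (B := X)) (IsPositiveFibre o)) :
    ∃ τ : X → SphereTangent X, IsSectionOff τ (range fun i => (d.disc i).center) ∧
      ∀ i, HasIdx o τ (d.disc i).center (d.index i) := by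
  classical
  -- The discs are filled in one at a time; `s` contains those that have been filled.
  have key : ∀ s : Finset (Fin (d.n + 1)), ∃ τ : X → SphereTangent X,
      IsSectionOn τ {x | (∀ i ∉ s, x ∉ (d.disc i).openDisc) ∧ ∀ i ∈ s, x ≠ (d.disc i).center} ∧
      (∀ x, (∀ i, x ∉ (d.disc i).openDisc) → τ x = d.σ x) ∧
      ∀ i ∈ s, HasIdx o τ (d.disc i).center (d.index i) := by
    intro s
    induction s using Finset.induction_on with
    | empty =>
      refine ⟨d.σ, ⟨d.continuousOn.mono ?_, fun x hx => d.isSection x ?_⟩, fun _ _ => rfl, by simp⟩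
      · intro x hx h
        obtain ⟨i, hi⟩ := mem_iUnion.1 h
        exact hx.1 i (by simp) hi
      · intro h
        obtain ⟨i, hi⟩ := mem_iUnion.1 h
        exact hx.1 i (by simp) hi
    | insert a s ha ih =>
      obtain ⟨τ, hτ, hτσ, hidx⟩ := ih
      have hsb : sphere (0 : ℂ) 1 ⊆ ball 0 2 :=
        sphere_subset_closedBall.trans (closedBall_subset_ball (by norm_num))
      have hoff : ∀ z ∈ sphere (0 : ℂ) 1, ∀ i, d.disc a z ∉ (d.disc i).openDisc := by
        intro z hz i hi
        rcases eq_or_ne a i with rfl | hai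
        · have := ((d.disc a).apply_mem_image_ball_iff (hsb hz) (by norm_num)).1 hi
          rw [mem_sphere_zero_iff_norm.1 hz] at this
          exact lt_irrefl _ this
        · exact disjoint_left.1 (d.disjoint a i hai) ⟨z, sphere_subset_closedBall hz, rfl⟩
            ((d.disc i).openDisc_subset_closedDisc hi)
      obtain ⟨τ', v, hτ', hoff', hv, hτv, hcone⟩ := hτ.conic (d.disc a) one_pos (by norm_num) (by
        rintro _ ⟨z, hz, rfl⟩
        exact ⟨fun i _ => hoff z hz i, fun i _ h =>
          hoff z hz i (h ▸ (d.disc i).center_mem_openDisc)⟩)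
      obtain ⟨K, g, hg, hK, hdeg⟩ := exists_degree_sphere one_pos hv
      have hw : ∀ w : Circle, (w : ℂ) ∈ sphere (0 : ℂ) 1 := fun w => by simp [Circle.norm_coe]
      have hind : d.index a = K / (d.disc a).order :=
        index_eq_of_isLocalIndex (d.positive a) hg
          (fun w => by rw [← hτσ _ (hoff w (hw w)), hτv w (hw w)])
          (fun w => by rw [← hK w, Complex.ofReal_one, one_mul]) (d.isLocalIndex a)
      refine ⟨τ', hτ'.mono ?_, fun x hx => (hoff' x (hx a)).trans (hτσ x hx), fun i hi => ?_⟩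
      · rintro x ⟨hx1, hx2⟩
        refine ⟨?_, hx2 a (Finset.mem_insert_self _ _)⟩
        by_cases hxa : x ∈ (d.disc a).openDisc
        · exact Or.inr ((d.disc a).openDisc_subset_closedDisc hxa)
        · refine Or.inl ⟨⟨fun i hi => ?_, fun i hi => hx2 i (Finset.mem_insert_of_mem hi)⟩, hxa⟩
          rcases eq_or_ne i a with rfl | hia
          · exact hxa
          · exact hx1 i (by simp [hia, hi])
      · rcases Finset.mem_insert.1 hi with rfl | hi
        · rw [hind]
          exact ⟨d.disc i, _, K, d.positive i, rfl, rfl, hdeg, 1, one_pos, fun z hz =>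
            hcone z (ball_subset_closedBall hz.1) hz.2⟩
        · refine (hidx i hi).congr (Filter.Eventually.filter_mono nhdsWithin_le_nhds ?_)
          have hia : i ≠ a := fun h => ha (h ▸ hi)
          have h1 : (d.disc i).center ∉ (d.disc a).closedDisc :=
            disjoint_left.1 (d.disjoint i a hia)
              ((d.disc i).openDisc_subset_closedDisc (d.disc i).center_mem_openDisc)
          filter_upwards [((d.disc a).isClosed_image_closedBall
            (by norm_num : (1 : ℝ) < 2)).isOpen_compl.mem_nhds h1] with x hx
          exact hoff' x fun h => hx ((d.disc a).openDisc_subset_closedDisc h)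
  obtain ⟨τ, hτ, -, hidx⟩ := key Finset.univ
  refine ⟨τ, isSectionOff_iff.2 (hτ.mono fun x hx => ⟨fun i hi => (hi (Finset.mem_univ i)).elim,
    fun i _ h => hx ⟨i, h.symm⟩⟩), fun i => hidx i (Finset.mem_univ i)⟩

/-- The section of the Euler data, extended over its discs, and `σ` are compared on the union of
their singular sets. -/
theorem EulerData.sum_index_eq [CompactSpace X] (ho : o.HasPositiveCharts)
    (d : EulerData o (SphereTangent.proj (B := X)) (IsPositiveFibre o)) {P : Finset X}
    (hP : singularSet X ⊆ P) (hσ : IsSectionOff σ P) : ∑ i, d.index i = ∑ p ∈ P, idx o σ p := by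
  classical
  obtain ⟨τ, hτ, hidx⟩ := d.exists_section
  let P₀ : Finset X := Finset.univ.image fun i => (d.disc i).center
  have hinj : Function.Injective fun i => (d.disc i).center := by
    intro i j hij
    by_contra hne
    exact disjoint_left.1 (d.disjoint i j hne)
      ((d.disc i).openDisc_subset_closedDisc (d.disc i).center_mem_openDisc)
      (by
        rw [show (d.disc i).center = (d.disc j).center from hij]
        exact (d.disc j).openDisc_subset_closedDisc (d.disc j).center_mem_openDisc)
  have hP₀ : singularSet X ⊆ P₀ := by
    rw [← d.singular]
    rintro _ ⟨k, rfl⟩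
    simp [P₀]
  have hτ' : IsSectionOff τ P₀ := hτ.mono (by simp [P₀])
  have h1 : ∑ i, d.index i = ∑ p ∈ P₀, idx o τ p := by
    rw [Finset.sum_image fun i _ j _ h => hinj h]
    exact Finset.sum_congr rfl fun i _ => (hidx i).idx_eq.symm
  have hl : P₀ ⊆ P ∪ P₀ := Finset.subset_union_right
  have hr : P ⊆ P ∪ P₀ := Finset.subset_union_left
  have hl' : (P₀ : Set X) ⊆ (P ∪ P₀ : Finset X) := by exact_mod_cast hl
  have hr' : (P : Set X) ⊆ (P ∪ P₀ : Finset X) := by exact_mod_cast hr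
  rw [h1, ← sum_idx_of_subset ho hP₀ hl hτ', ← sum_idx_of_subset ho hP hr hσ]
  exact sum_idx_eq ho (hP.trans hr') (hτ'.mono hl') (hσ.mono hr')

/-- Separating the finitely many singularities by disjoint positive charts gives the discs, and
`isLocalIndex_of_degree` gives the coefficients. -/
theorem nonempty_eulerData (ho : o.HasPositiveCharts) (hfin : (singularSet X).Finite) {x₀ : X}
    (hx₀ : x₀ ∉ singularSet X) (hσ : IsSectionOff σ (insert x₀ (singularSet X))) :
    Nonempty (EulerData o (SphereTangent.proj (B := X)) (IsPositiveFibre o)) := by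
  classical
  obtain ⟨V, hV, hdis⟩ := (hfin.insert x₀).t2_separation
  have hex : ∀ x : X, ∃ c, o.IsPositive c ∧ c.center = x ∧ c.image ⊆ V x := fun x =>
    ho.exists_chart ((hV x).2.mem_nhds (hV x).1)
  choose D hD hDx hDV using hex
  let e : Fin hfin.toFinset.card ≃ hfin.toFinset := hfin.toFinset.equivFin.symm
  let y : Fin (hfin.toFinset.card + 1) → X := Fin.cons x₀ fun k => (e k : X)
  have hye : ∀ k, (e k : X) ∈ singularSet X := fun k => hfin.mem_toFinset.1 (e k).2
  have hyinj : Function.Injective y := by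
    refine Fin.cons_injective_iff.2 ⟨?_, Subtype.val_injective.comp e.injective⟩
    rintro ⟨k, hk⟩
    exact hx₀ (hk ▸ hye k)
  have hymem : ∀ i, y i ∈ insert x₀ (singularSet X) := fun i => by
    refine Fin.cases (Or.inl rfl) (fun k => Or.inr (hye k)) i
  have hysurj : ∀ x ∈ insert x₀ (singularSet X), ∃ i, y i = x := by
    rintro x (rfl | hx)
    · exact ⟨0, rfl⟩
    · refine ⟨(e.symm ⟨x, hfin.mem_toFinset.2 hx⟩).succ, ?_⟩
      simp [y]
  have hdisj : ∀ i j, i ≠ j → Disjoint (D (y i)).image (D (y j)).image := fun i j hij =>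
    (hdis (hymem i) (hymem j) fun h => hij (hyinj h)).mono (hDV _) (hDV _)
  have hcl : ∀ c : OrbifoldChart X, c.closedDisc ⊆ c.image := fun c =>
    image_mono (closedBall_subset_ball (by norm_num))
  have hyD : ∀ i, y i ∈ (D (y i)).openDisc := fun i => ⟨0, by simp, hDx (y i)⟩
  have hsec := isSectionOff_iff.1 hσ
  have hsb : sphere (0 : ℂ) 1 ⊆ ball 0 2 :=
    sphere_subset_closedBall.trans (closedBall_subset_ball (by norm_num))
  have hcompl : (⋃ i, (D (y i)).openDisc)ᶜ ⊆ (insert x₀ (singularSet X))ᶜ := by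
    intro x hx hx'
    obtain ⟨i, hi⟩ := hysurj x hx'
    refine hx (mem_iUnion.2 ⟨i, ?_⟩)
    rw [← hi]
    exact hyD i
  have hloc : ∀ i, ∃ q, IsLocalIndex (SphereTangent.proj (B := X)) (IsPositiveFibre o)
      (D (y i)) σ q := by
    intro i
    obtain ⟨v, hv, hσv⟩ := hsec.exists_vec (D (y i)) hsb (fun z hz hmem => by
      obtain ⟨j, hj⟩ := hysurj _ hmem
      have hzD := (D (y i)).mem_image (hsb hz)
      rcases eq_or_ne j i with rfl | hji
      · refine (D (y j)).apply_ne_center (hsb hz) ?_ ((hDx (y j)).trans hj).symm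
        rintro rfl
        simp at hz
      · refine disjoint_left.1 (hdisj j i hji) ?_ hzD
        rw [← hj]
        exact hcl _ ((D (y j)).openDisc_subset_closedDisc (hyD j))) (Or.inr (by simp))
    obtain ⟨K, g, hg, hK, -⟩ := exists_degree_sphere one_pos hv
    exact ⟨_, isLocalIndex_of_degree (hD _) hg (fun w => hσv w (by simp [Circle.norm_coe]))
      fun w => by rw [← hK w, Complex.ofReal_one, one_mul]⟩
  choose q hq using hloc
  exact ⟨{
    n := hfin.toFinset.card
    disc := fun i => D (y i)
    positive := fun i => hD _
    regular := by rw [hDx]; exact hx₀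
    singular := by
      ext x
      simp only [mem_range, hDx]
      constructor
      · rintro ⟨k, rfl⟩
        exact hye k
      · intro hx
        exact ⟨e.symm ⟨x, hfin.mem_toFinset.2 hx⟩, by simp [y]⟩
    disjoint := fun i j hij => (hdisj i j hij).mono (hcl _) (hcl _)
    σ := σ
    continuousOn := hσ.continuousOn.mono hcompl
    isSection := fun x hx => hσ.proj_eq x (hcompl hx)
    index := q
    isLocalIndex := hq }⟩

/-- The Euler characteristic is the sum of the indices of any section with finitely many
singularities. -/
theorem hasEulerCharacteristic_sum_idx [CompactSpace X] [PreconnectedSpace X]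
    (ho : o.HasPositiveCharts) {x₀ : X} (hx₀ : x₀ ∉ singularSet X) {P : Finset X}
    (hP : singularSet X ⊆ P) (hσ : IsSectionOff σ P) :
    HasEulerCharacteristic o (∑ p ∈ P, idx o σ p) := by
  have hfin := P.finite_toSet.subset hP
  obtain ⟨τ, hτ⟩ := exists_section ho hfin x₀
  exact ⟨nonempty_eulerData ho hfin hx₀ hτ, fun d => d.sum_index_eq ho hP hσ⟩

end

end

section

/-! ### Transport along diffeomorphisms -/

open SphereTangent OrbifoldChart

section Transport

variable {X Y : Type*} [TopologicalSpace X] [DiffeologicalSpace X] [IsTwoOrbifold X]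
  [TopologicalSpace Y] [DiffeologicalSpace Y] [IsTwoOrbifold Y]
  {F : X → Y} {G : Y → X} {U : Set X} {V : Set Y}

/-- `F` is a diffeomorphism from the open set `U` onto the open set `V` with inverse `G`. -/
structure IsDiffeoOn {X Y : Type*} [TopologicalSpace X] [DiffeologicalSpace X]
    [TopologicalSpace Y] [DiffeologicalSpace Y] (F : X → Y) (G : Y → X) (U : Set X) (V : Set Y) :
    Prop where
  isOpen_left : IsOpen U
  isOpen_right : IsOpen V
  mapsTo : MapsTo F U V
  mapsTo_inv : MapsTo G V U
  invOn : InvOn G F U V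
  smooth : DSmoothOn F U
  smooth_inv : DSmoothOn G V

/-- The image of a chart under a diffeomorphism. -/
def OrbifoldChart.map (e : OrbifoldChart X) (hD : IsDiffeoOn F G U V) (he : e.image ⊆ U) :
    OrbifoldChart Y where
  toFun z := F (e z)
  order := e.order
  order_pos := e.order_pos
  isOpen_image := by
    have h1 := (hD.smooth_inv.continuousOn hD.isOpen_right).isOpen_inter_preimage
      hD.isOpen_right e.isOpen_image
    convert h1 using 1
    ext y
    constructor
    · rintro ⟨z, hz, rfl⟩
      have h2 := he (e.mem_image hz)
      exact ⟨hD.mapsTo h2, z, hz, (hD.invOn.1 h2).symm⟩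
    · rintro ⟨hy, z, hz, hzy⟩
      exact ⟨z, hz, (congrArg F hzy).trans (hD.invOn.2 hy)⟩
  fibres z hz w hw := by
    rw [← e.fibres z hz w hw]
    exact (hD.invOn.1.injOn).eq_iff (he (e.mem_image hz)) (he (e.mem_image hw))
  smooth n p hp hm := hD.smooth n _ (e.smooth n p hp hm) fun t => he (e.mem_image (hm t))
  lift n q hq hm t := by
    have hmem : ∀ t, q t ∈ V ∧ G (q t) ∈ e.image := fun t => by
      obtain ⟨z, hz, h⟩ := hm t
      have h2 := he (e.mem_image hz)
      rw [← h]
      exact ⟨hD.mapsTo h2, z, hz, (hD.invOn.1 h2).symm⟩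
    obtain ⟨N, p, hN, htN, hp, h⟩ := e.lift n (G ∘ q) (hD.smooth_inv n q hq fun t => (hmem t).1)
      (fun t => (hmem t).2) t
    refine ⟨N, p, hN, htN, hp, fun s hs => ⟨(h s hs).1, ?_⟩⟩
    rw [(h s hs).2]
    exact hD.invOn.2 (hmem s).1

@[simp] theorem OrbifoldChart.map_apply (e : OrbifoldChart X) (hD : IsDiffeoOn F G U V) (he)
    (z : ℂ) : e.map hD he z = F (e z) := rfl

theorem IsChartLift.map {a b : OrbifoldChart X} {h : ℂ → ℂ} {z : ℂ} (hh : IsChartLift a b h z)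
    (hD : IsDiffeoOn F G U V) (ha hb) : IsChartLift (a.map hD ha) (b.map hD hb) h z := by
  obtain ⟨N, hN, hz, hN2, hs, hh⟩ := hh
  exact ⟨N, hN, hz, hN2, hs, fun w hw => ⟨(hh w hw).1, congrArg F (hh w hw).2⟩⟩

/-- Rays are transported chart by chart; this is consistent because lifts between charts in `U`
remain lifts between the image charts. -/
theorem IsDiffeoOn.exists_push (hD : IsDiffeoOn F G U V) [Nonempty Y] :
    ∃ Φ : SphereTangent X → SphereTangent Y, ∀ (e : OrbifoldChart X) (he : e.image ⊆ U),
      ∀ z ∈ ball (0 : ℂ) 2, ∀ v, Φ (rayAt e z v) = rayAt (e.map hD he) z v := by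
  classical
  obtain ⟨c₀, -⟩ := IsTwoOrbifold.exists_chart (Classical.arbitrary Y)
  let R : SphereTangent X → SphereTangent Y → Prop := fun ξ η =>
    ∃ (e : OrbifoldChart X) (he : e.image ⊆ U) (z : ℂ) (v : Circle), z ∈ ball (0 : ℂ) 2 ∧
      ξ = rayAt e z v ∧ η = rayAt (e.map hD he) z v
  let Φ : SphereTangent X → SphereTangent Y := fun ξ =>
    if h : ∃ η, R ξ η then h.choose else rayAt c₀ 0 1
  refine ⟨Φ, fun e he z hz v => ?_⟩
  have h : ∃ η, R (rayAt e z v) η := ⟨_, e, he, z, v, hz, rfl, rfl⟩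
  have h1 : Φ (rayAt e z v) = h.choose := dif_pos h
  obtain ⟨a, ha, w, u, hw, h2, h3⟩ := h.choose_spec
  rw [h1, h3]
  obtain ⟨k, hk, hk1, hk2⟩ := (rayAt_eq_iff hw hz).1 h2.symm
  exact (rayAt_eq_iff hw hz).2 ⟨k, hk.map hD ha he, hk1, hk2⟩

/-- The assumption concerns atlas charts only. For an atlas chart `a` near the point, the
representative of `F` from `a` to `b` factors through `e`, and the signs of the factors are
compared. -/
theorem IsDiffeoOn.isPositive_map (hD : IsDiffeoOn F G U V) {oX : OrbifoldOrientation X}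
    {oY : OrbifoldOrientation Y} (hU : ∀ x ∈ U, x ∉ singularSet X)
    (hor : ∀ a ∈ oX.atlas, ∀ b ∈ oY.atlas, ∀ h z, a z ∈ U → IsLocalRep F a b h z →
      0 < (fderiv ℝ h z).det) {e : OrbifoldChart X} (he : e.image ⊆ U) (hpos : oX.IsPositive e) :
    oY.IsPositive (e.map hD he) := by
  intro b hb k z hk
  have hk := hk.isChartLift
  have hU1 := he (e.mem_image hk.mem_right)
  obtain ⟨a, ha, u, hu, hau⟩ := oX.covers _ (hU _ hU1)
  obtain ⟨h, hh, hhu⟩ := IsChartLift.exists_of_eq a e hu hk.mem_right hau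
  obtain ⟨l, hl, hlk⟩ := hk.exists_leftInverse
  have hdet : 0 < (fderiv ℝ (l ∘ h) u).det := by
    refine hor a ha b hb _ u (hau ▸ hU1) ⟨?_, ?_⟩
    · obtain ⟨N, hN, hz, hN2, hs, hh'⟩ := hh
      obtain ⟨M, hM, hw, -, ht, hl'⟩ := hl
      refine ⟨N ∩ h ⁻¹' M, hs.continuousOn.isOpen_inter_preimage hN hM, ⟨hz, by rwa [mem_preimage, hhu]⟩,
        inter_subset_left.trans hN2, ht.comp (hs.mono inter_subset_left) fun _ hw => hw.2, ?_⟩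
      rintro w ⟨hw, hw'⟩
      exact ⟨(hl' _ hw').1, (hl' _ hw').2.trans (congrArg F (hh' w hw).2)⟩
    · rw [det_fderiv_comp (hhu ▸ hl.differentiableAt) hh.differentiableAt, hhu]
      exact mul_ne_zero hl.isTransition.2 hh.isTransition.2
  rw [det_fderiv_comp (hhu ▸ hl.differentiableAt) hh.differentiableAt, hhu] at hdet
  have h1 := hpos a ha h u hh.isTransition
  have h2 : (fderiv ℝ (l ∘ k) z).det = 1 := det_fderiv_id_eventually hlk
  rw [det_fderiv_comp hl.differentiableAt hk.differentiableAt] at h2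
  exact (pos_iff_pos_of_mul_pos (h2 ▸ one_pos)).1 ((pos_iff_pos_of_mul_pos hdet).2 h1)

variable {oX : OrbifoldOrientation X} {oY : OrbifoldOrientation Y} {σ : X → SphereTangent X}

/-- The image of a section under a diffeomorphism. -/
theorem IsDiffeoOn.exists_section (hD : IsDiffeoOn F G U V) [Nonempty Y]
    (ho : oX.HasPositiveCharts) (hU : ∀ x ∈ U, x ∉ singularSet X)
    (hor : ∀ a ∈ oX.atlas, ∀ b ∈ oY.atlas, ∀ h z, a z ∈ U → IsLocalRep F a b h z →
      0 < (fderiv ℝ h z).det) {P : Finset X} (hσ : IsSectionOff σ P) :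
    ∃ τ : Y → SphereTangent Y, IsSectionOn τ (V \ F '' (U ∩ P)) ∧
      (∀ x ∈ U, HasIdx oY τ (F x) (idx oX σ x)) ∧
      ∀ (e : OrbifoldChart X) (he : e.image ⊆ U), ∀ z ∈ ball (0 : ℂ) 2, ∀ v,
        σ (e z) = rayAt e z v → τ (F (e z)) = rayAt (e.map hD he) z v := by
  obtain ⟨Φ, hΦ⟩ := hD.exists_push
  let τ : Y → SphereTangent Y := fun y => Φ (σ (G y))
  have hτ : ∀ (e : OrbifoldChart X) (he : e.image ⊆ U), ∀ z ∈ ball (0 : ℂ) 2, ∀ v,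
      σ (e z) = rayAt e z v → τ (F (e z)) = rayAt (e.map hD he) z v := by
    intro e he z hz v h
    simp only [τ]
    rw [hD.invOn.1 (he (e.mem_image hz)), h, hΦ e he z hz]
  have hpunct : ∀ x ∈ U, ∃ (e : OrbifoldChart X) (he : e.image ⊆ U) (v : ℂ → Circle),
      oX.IsPositive e ∧ e.center = x ∧ e.order = 1 ∧ ContinuousOn v (ball 0 2 \ e ⁻¹' P) ∧
      ∀ z ∈ ball (0 : ℂ) 2 \ e ⁻¹' P, σ (e z) = rayAt e z (v z) := by
    intro x hx
    obtain ⟨e, he, rfl, heU⟩ := ho.exists_chart (hD.isOpen_left.mem_nhds hx)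
    obtain ⟨v, hv, hσv⟩ := hσ.exists_vec e (Or.inl (e.order_eq_one (hU _ hx)))
    exact ⟨e, heU, v, he, rfl, e.order_eq_one (hU _ hx), hv, hσv⟩
  refine ⟨τ, ⟨?_, ?_⟩, ?_, hτ⟩
  · intro y hy
    obtain ⟨e, he, v, -, hex, he1, hv, hσv⟩ := hpunct (G y) (hD.mapsTo_inv hy.1)
    let A : Set ℂ := ball 0 2 \ e ⁻¹' P
    have hA : IsOpen A := by
      have : A = ball 0 2 \ (ball (0 : ℂ) 2 ∩ e ⁻¹' P) := by rw [sdiff_self_inter]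
      rw [this]
      exact isOpen_ball.sdiff (e.finite_preimage P).isClosed
    have h1 : ContinuousOn τ ((e.map hD he) '' A) := by
      refine (e.map hD he).continuousOn_image sdiff_subset ?_ ?_
      · intro z hz ξ hξ
        rwa [show ξ = 1 by simpa [OrbifoldChart.map, he1] using hξ, one_mul]
      · exact (continuousOn_rayAt_comp continuousOn_id sdiff_subset hv).congr fun z hz =>
          hτ e he z hz.1 _ (hσv z hz)
    have h2 : y ∈ (e.map hD he) '' A := by
      refine ⟨0, ⟨by simp, fun h => hy.2 ⟨e 0, ⟨he (e.mem_image (by simp)), h⟩, ?_⟩⟩, ?_⟩ <;>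
      · change F e.center = y
        rw [hex, hD.invOn.2 hy.1]
    exact (h1.continuousAt (((e.map hD he).isOpen_image_of_isOpen hA sdiff_subset).mem_nhds
      h2)).continuousWithinAt
  · intro y hy
    obtain ⟨e, he, v, -, hex, he1, hv, hσv⟩ := hpunct (G y) (hD.mapsTo_inv hy.1)
    have h0 : F (e 0) = y := by
      change F e.center = y
      rw [hex, hD.invOn.2 hy.1]
    have h1 := hτ e he 0 (by simp) _ (hσv 0 ⟨by simp, fun h => hy.2 ⟨e 0, ⟨he (e.mem_image (by simp)), h⟩, h0⟩⟩)
    rw [h0] at h1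
    rw [h1, proj_rayAt (by simp)]
    exact h0
  · intro x hx
    obtain ⟨e, he, v, hpos, rfl, he1, hv, hσv⟩ := hpunct x hx
    obtain ⟨ε, hε, hsub⟩ := exists_ball_inter_subset_singleton (e.finite_preimage P) 0 (by simp)
    have hsub' : ball (0 : ℂ) ε \ {0} ⊆ ball 0 2 \ e ⁻¹' P := fun z hz =>
      ⟨(hsub hz).1, fun h => (hsub hz).2 ⟨(hsub hz).1, h⟩⟩
    obtain ⟨K, hK⟩ := exists_hasDegAt hε (hv.mono hsub')
    have h1 : HasIdx oX σ e.center (K / e.order) :=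
      ⟨e, v, K, hpos, rfl, rfl, ⟨ε, hε, hK⟩, ε, hε, fun z hz => hσv z (hsub' hz)⟩
    rw [h1.idx_eq]
    exact ⟨e.map hD he, v, K, hD.isPositive_map hU hor he hpos, rfl, rfl, ⟨ε, hε, hK⟩, ε, hε,
      fun z hz => hτ e he z (hsub' hz).1 _ (hσv z (hsub' hz))⟩

end Transport

/-! ### Conic extension over several discs -/

theorem IsSectionOn.conic_family {X ι : Type*} [TopologicalSpace X] [DiffeologicalSpace X]
    [IsTwoOrbifold X] [Finite ι] {σ : X → SphereTangent X} {A : Set X} {r : ℝ}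
    (D : ι → OrbifoldChart X) (hr : 0 < r) (hr2 : r < 2)
    (hdis : ∀ i j, i ≠ j → Disjoint (D i '' closedBall 0 r) (D j '' closedBall 0 r))
    (hσ : IsSectionOn σ A) (hA : ∀ i, D i '' sphere 0 r ⊆ A) : ∃ τ : X → SphereTangent X,
      IsSectionOn τ ((A \ (⋃ i, D i '' ball 0 r) ∪ ⋃ i, D i '' closedBall 0 r) \
        range fun i => (D i).center) ∧
      (∀ x, (∀ i, x ∉ D i '' ball 0 r) → τ x = σ x) ∧
      ∀ i, ∃ v : ℂ → Circle, ContinuousOn v (sphere 0 r) ∧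
        (∀ z ∈ sphere 0 r, σ (D i z) = rayAt (D i) z (v z)) ∧
        ∀ z ∈ closedBall 0 r, z ≠ 0 → τ (D i z) = rayAt (D i) z (v (r * dir z)) := by
  classical
  choose T v hT hTσ hv hσv hTv using fun i => hσ.conic (D i) hr hr2 (hA i)
  let τ : X → SphereTangent X := fun x =>
    if h : ∃ i, x ∈ D i '' closedBall 0 r then T h.choose x else σ x
  have hτ : ∀ i, ∀ x ∈ D i '' closedBall 0 r, τ x = T i x := by
    intro i x hx
    have h : ∃ i, x ∈ D i '' closedBall 0 r := ⟨i, hx⟩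
    have hi : h.choose = i := by
      by_contra hne
      exact disjoint_left.1 (hdis _ _ hne) h.choose_spec hx
    simp only [τ, dif_pos h]
    rw [hi]
  have hτ' : ∀ x, (∀ i, x ∉ D i '' closedBall 0 r) → τ x = σ x := fun x hx =>
    dif_neg fun ⟨i, hi⟩ => hx i hi
  have hoff : ∀ x, (∀ i, x ∉ D i '' ball 0 r) → τ x = σ x := fun x hx => by
    by_cases h : ∃ i, x ∈ D i '' closedBall 0 r
    · obtain ⟨i, hi⟩ := h
      rw [hτ i x hi, hTσ i x (hx i)]
    · exact hτ' x fun i hi => h ⟨i, hi⟩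
  have hcl : ∀ i, IsClosed (D i '' closedBall 0 r) := fun i => (D i).isClosed_image_closedBall hr2
  -- By disjointness, near each point the new section is either one of the conic extensions or `σ`
  -- itself.
  have hloc : ∀ x ∈ (A \ (⋃ i, D i '' ball 0 r) ∪ ⋃ i, D i '' closedBall 0 r) \
      range fun i => (D i).center, ∃ (υ : X → SphereTangent X) (N : Set X) (s : Set X),
        IsSectionOn υ s ∧ IsOpen N ∧ x ∈ N ∧ (∀ y ∈ N, τ y = υ y) ∧
        ((A \ (⋃ i, D i '' ball 0 r) ∪ ⋃ i, D i '' closedBall 0 r) \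
          range fun i => (D i).center) ∩ N ⊆ s := by
    intro x hx
    by_cases h : ∃ i, x ∈ D i '' closedBall 0 r
    · obtain ⟨i, hi⟩ := h
      refine ⟨T i, ⋂ j : {j // j ≠ i}, (D j '' closedBall 0 r)ᶜ, _, hT i,
        isOpen_iInter_of_finite fun j => (hcl j).isOpen_compl, ?_, ?_, ?_⟩
      · exact mem_iInter.2 fun j hj => disjoint_left.1 (hdis _ _ j.2) hj hi
      · intro y hy
        by_cases hyi : y ∈ D i '' closedBall 0 r
        · exact hτ i y hyi
        · rw [hTσ i y fun h => hyi (image_mono ball_subset_closedBall h)]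
          refine hτ' y fun j hj => ?_
          rcases eq_or_ne j i with rfl | hji
          · exact hyi hj
          · exact mem_iInter.1 hy ⟨j, hji⟩ hj
      · rintro y ⟨⟨hy | hy, hyc⟩, hyN⟩
        · exact ⟨Or.inl ⟨hy.1, fun h => hy.2 (mem_iUnion.2 ⟨i, h⟩)⟩, fun h => hyc ⟨i, h.symm⟩⟩
        · obtain ⟨j, hj⟩ := mem_iUnion.1 hy
          rcases eq_or_ne j i with rfl | hji
          · exact ⟨Or.inr hj, fun h => hyc ⟨j, h.symm⟩⟩
          · exact (mem_iInter.1 hyN ⟨j, hji⟩ hj).elim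
    · refine ⟨σ, ⋂ j, (D j '' closedBall 0 r)ᶜ, A, hσ,
        isOpen_iInter_of_finite fun j => (hcl j).isOpen_compl,
        mem_iInter.2 fun j hj => h ⟨j, hj⟩, fun y hy => hτ' y fun j hj => mem_iInter.1 hy j hj, ?_⟩
      rintro y ⟨⟨hy | hy, -⟩, hyN⟩
      · exact hy.1
      · obtain ⟨j, hj⟩ := mem_iUnion.1 hy
        exact (mem_iInter.1 hyN j hj).elim
  refine ⟨τ, ⟨fun x hx => ?_, fun x hx => ?_⟩, hoff, fun i => ⟨v i, hv i, hσv i, fun z hz h0 => ?_⟩⟩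
  · obtain ⟨υ, N, s, hυ, hN, hxN, he, hs⟩ := hloc x hx
    refine ((continuousWithinAt_inter (hN.mem_nhds hxN)).1 ?_)
    exact ((hυ.continuousOn.mono hs).congr fun y hy => he y hy.2) x ⟨hx, hxN⟩
  · obtain ⟨υ, N, s, hυ, hN, hxN, he, hs⟩ := hloc x hx
    rw [he x hxN, hυ.proj_eq x (hs ⟨hx, hxN⟩)]
  · rw [hτ i _ (mem_image_of_mem _ hz), hTv i z hz h0]

/-! ### The gluing map of the collars -/

/-- The gluing map `[z] ↦ z ^ m / |z| ^ (m - 1)`. -/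
def collarMap (m : ℕ) (z : ℂ) : ℂ := z ^ m / (‖z‖ : ℂ) ^ (m - 1)

theorem collarMap_mul {m : ℕ} (hm : 0 < m) {r : ℝ} (hr : 0 < r) (w : Circle) :
    collarMap m (r * w) = r * (w ^ m : Circle) := by
  have hr0 : (r : ℂ) ≠ 0 := by exact_mod_cast hr.ne'
  rw [collarMap, norm_mul, Circle.norm_coe, mul_one, Complex.norm_real, Real.norm_of_nonneg hr.le,
    mul_pow, Circle.coe_pow, div_eq_iff (pow_ne_zero _ hr0)]
  conv_lhs => rw [← Nat.sub_add_cancel hm, pow_succ]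
  rw [Nat.sub_add_cancel hm]
  ring

theorem norm_collarMap {m : ℕ} (hm : 0 < m) (z : ℂ) : ‖collarMap m z‖ = ‖z‖ := by
  rcases eq_or_ne z 0 with rfl | hz
  · simp [collarMap, hm.ne']
  · conv_lhs => rw [← norm_mul_dir z]
    rw [collarMap_mul hm (norm_pos_iff.2 hz), norm_mul, Circle.norm_coe]
    simp

theorem contDiffAt_collarMap (m : ℕ) {z : ℂ} (hz : z ≠ 0) : ContDiffAt ℝ ∞ (collarMap m) z := by
  have h1 : ContDiffAt ℝ ∞ (fun z : ℂ => (‖z‖ : ℂ)) z :=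
    Complex.ofRealCLM.contDiff.contDiffAt.comp z (contDiffAt_norm ℝ hz)
  have h2 : ContDiffAt ℝ ∞ (fun z : ℂ => z ^ m) z := contDiffAt_id.pow m
  have h3 : ContDiffAt ℝ ∞ (fun z : ℂ => (‖z‖ : ℂ) ^ (m - 1)) z := h1.pow _
  exact (h2.mul (h3.inv (pow_ne_zero _ (by simpa using hz)))).congr_of_eventuallyEq
    (Filter.Eventually.of_forall fun z => div_eq_mul_inv _ _)

/-- In the polar frames dir z, i dir z at `z` and (dir z)^m, i (dir z)^m at its image, the
differential of r w ↦ r w^m is diag(1, m). -/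
theorem fderiv_collarMap {m : ℕ} (hm : 0 < m) {z : ℂ} (hz : z ≠ 0) (f : ℂ) :
    fderiv ℝ (collarMap m) z (dir z * f) = (dir z : ℂ) ^ m * (f.re + Complex.I * (m * f.im)) := by
  have hd : HasFDerivAt (collarMap m) (fderiv ℝ (collarMap m) z) z :=
    ((contDiffAt_collarMap m hz).differentiableAt (by simp)).hasFDerivAt
  have hz0 : 0 < ‖z‖ := norm_pos_iff.2 hz
  have hzn : (‖z‖ : ℂ) ≠ 0 := by exact_mod_cast hz0.ne'
  -- the radial direction
  have h1 : fderiv ℝ (collarMap m) z (dir z) = (dir z : ℂ) ^ m := by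
    have hγ : HasDerivAt (fun t : ℝ => (t : ℂ) * dir z) (dir z) ‖z‖ := by
      simpa using (Complex.ofRealCLM.hasDerivAt (x := ‖z‖)).mul_const (dir z : ℂ)
    have h2 := HasFDerivAt.comp_hasDerivAt (x := ‖z‖) (f := fun t : ℝ => (t : ℂ) * dir z)
      (by rwa [norm_mul_dir] : HasFDerivAt (collarMap m) (fderiv ℝ (collarMap m) z) _) hγ
    have h3 : HasDerivAt (fun t : ℝ => (t : ℂ) * (dir z : ℂ) ^ m) ((dir z : ℂ) ^ m) ‖z‖ := by
      simpa using (Complex.ofRealCLM.hasDerivAt (x := ‖z‖)).mul_const ((dir z : ℂ) ^ m)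
    refine h2.unique (h3.congr_of_eventuallyEq ?_)
    filter_upwards [lt_mem_nhds hz0] with t ht
    simp only [Function.comp]
    rw [collarMap_mul hm ht, Circle.coe_pow]
  -- the tangential direction
  have h4 : fderiv ℝ (collarMap m) z (dir z * Complex.I) = (dir z : ℂ) ^ m * (Complex.I * m) := by
    have hexp : ∀ k : ℝ, HasDerivAt (fun t : ℝ => (Circle.exp (k * t) : ℂ)) (k * Complex.I) 0 := by
      intro k
      have h5 : HasDerivAt (fun t : ℝ => Complex.exp ((k * t : ℝ) * Complex.I))
          (Complex.exp ((k * (0 : ℝ) : ℝ) * Complex.I) * (((k * 1 : ℝ) : ℂ) * Complex.I)) 0 :=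
        (((hasDerivAt_id (0 : ℝ)).const_mul k).ofReal_comp.mul_const Complex.I).cexp
      simpa [Circle.coe_exp] using h5
    have hγ : HasDerivAt (fun t : ℝ => (‖z‖ : ℂ) * ((dir z * Circle.exp t : Circle) : ℂ))
        (‖z‖ * (dir z * Complex.I)) 0 := by
      have := ((hexp 1).const_mul ((dir z : ℂ))).const_mul (‖z‖ : ℂ)
      simpa using this
    have h2 := HasFDerivAt.comp_hasDerivAt (x := 0)
      (f := fun t : ℝ => (‖z‖ : ℂ) * ((dir z * Circle.exp t : Circle) : ℂ))
      (by simpa [norm_mul_dir] using hd :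
        HasFDerivAt (collarMap m) (fderiv ℝ (collarMap m) z) _) hγ
    have h3 : HasDerivAt (fun t : ℝ => (‖z‖ : ℂ) * ((dir z : ℂ) ^ m * (Circle.exp (m * t) : ℂ)))
        (‖z‖ * ((dir z : ℂ) ^ m * (m * Complex.I))) 0 :=
      ((hexp m).const_mul _).const_mul _
    have h6 := h2.unique (h3.congr_of_eventuallyEq (Filter.Eventually.of_forall fun t => by
      simp only [Function.comp]
      rw [collarMap_mul hm hz0, mul_pow, ← Circle.exp_nsmul, nsmul_eq_mul, Circle.coe_mul,
        Circle.coe_pow]))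
    rw [← Complex.real_smul, map_smul, Complex.real_smul] at h6
    rw [mul_left_cancel₀ hzn h6, mul_comm (m : ℂ)]
  have h7 : (dir z : ℂ) * f = f.re • (dir z : ℂ) + f.im • ((dir z : ℂ) * Complex.I) := by
    conv_lhs => rw [← Complex.re_add_im f]
    simp only [Complex.real_smul]
    ring
  rw [h7, map_add, map_smul, map_smul, h1, h4]
  simp only [Complex.real_smul]
  ring

/-- The map diag(1, m) has positive scalar product with the identity, re² + m im² > 0, so it turns a
vector by less than a right angle. The angle is `β`. -/
theorem exists_stretch {m : ℕ} (hm : 0 < m) : ∃ β : Circle → ℝ, Continuous β ∧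
    ∀ f : Circle, ((f : ℂ).re + Complex.I * (m * (f : ℂ).im) : ℂ) ≠ 0 ∧
      dir ((f : ℂ).re + Complex.I * (m * (f : ℂ).im)) = f * Circle.exp (β f) := by
  let s : Circle → ℂ := fun f => (f : ℂ).re + Complex.I * (m * (f : ℂ).im)
  have hs : Continuous s := by
    have : Continuous fun f : Circle => (f : ℂ) := continuous_subtype_val
    fun_prop
  have hm0 : (0 : ℝ) < m := by exact_mod_cast hm
  have hre : ∀ f : Circle, 0 < (s f / f).re := by
    intro f
    have h1 : (f : ℂ)⁻¹ = (starRingEnd ℂ) f := (Circle.coe_inv f).symm.trans (Circle.coe_inv_eq_conj f)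
    have h2 : (f : ℂ).re * (f : ℂ).re + (f : ℂ).im * (f : ℂ).im = 1 := by
      have := Circle.normSq_coe f
      rwa [Complex.normSq_apply] at this
    rw [div_eq_mul_inv, h1]
    simp only [s, Complex.mul_re, Complex.add_re, Complex.add_im, Complex.ofReal_re,
      Complex.ofReal_im, Complex.I_re, Complex.I_im, Complex.mul_im, Complex.natCast_re,
      Complex.natCast_im, Complex.conj_re, Complex.conj_im]
    have h3 : (1 : ℝ) ≤ m := by exact_mod_cast hm
    nlinarith [mul_self_nonneg (f : ℂ).re, mul_self_nonneg (f : ℂ).im]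
  have hne : ∀ f : Circle, s f ≠ 0 := fun f h0 => by
    have := hre f
    simp [h0] at this
  refine ⟨fun f => (s f / f).arg, ?_, fun f => ⟨hne f, ?_⟩⟩
  · rw [← continuousOn_univ]
    exact arg_continuousOn_re_pos (hs.div continuous_subtype_val fun f => f.coe_ne_zero).continuousOn
      fun f _ => hre f
  · change dir (s f) = f * dir (s f / f)
    have h1 := dir_mul (div_ne_zero (hne f) f.coe_ne_zero) f.coe_ne_zero
    rw [div_mul_cancel₀ _ f.coe_ne_zero, dir_coe] at h1
    rw [h1, mul_comm]

end

section

/-! ### The index shift at a glued disc -/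

open SphereTangent OrbifoldChart

variable {X Y : Type*} [TopologicalSpace X] [DiffeologicalSpace X] [IsTwoOrbifold X]
  [TopologicalSpace Y] [DiffeologicalSpace Y] [IsTwoOrbifold Y]
  {F : X → Y} {G : Y → X} {U : Set X} {V : Set Y} {c : OrbifoldChart X} {d : OrbifoldChart Y}
  {σ : X → SphereTangent X} {τ : Y → SphereTangent Y}
  {oX : OrbifoldOrientation X} {oY : OrbifoldOrientation Y}

/-- The rule `hτ` needs a chart inside `U`. A small chart `e` of order 1 around `z` is such a chart,
and the gluing map is a lift from its image chart to `d`. -/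
theorem IsDiffeoOn.push_collar (hD : IsDiffeoOn F G U V)
    (hU : ∀ z : ℂ, 1 < ‖z‖ → ‖z‖ < 2 → c z ∈ U)
    (hF : ∀ z : ℂ, 1 < ‖z‖ → ‖z‖ < 2 → F (c z) = d (collarMap c.order z))
    (hτ : ∀ (e : OrbifoldChart X) (he : e.image ⊆ U), ∀ z ∈ ball (0 : ℂ) 2, ∀ v,
      σ (e z) = rayAt e z v → τ (F (e z)) = rayAt (e.map hD he) z v)
    {z : ℂ} (h1 : 1 < ‖z‖) (h2 : ‖z‖ < 2) {v : Circle} (hv : σ (c z) = rayAt c z v) :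
    τ (F (c z)) = rayAt d (collarMap c.order z) (dir (fderiv ℝ (collarMap c.order) z v)) := by
  have hz0 : z ≠ 0 := norm_pos_iff.1 (one_pos.trans h1)
  obtain ⟨δ, hδ, hδ2, hinj⟩ := c.exists_injOn_ball (mem_ball_zero_iff.2 h2) hz0
  have hO : IsOpen {y : ℂ | 1 < ‖y‖ ∧ ‖y‖ < 2} :=
    (isOpen_lt continuous_const continuous_norm).inter (isOpen_lt continuous_norm continuous_const)
  obtain ⟨η, hη, hηO⟩ := Metric.isOpen_iff.1 hO z ⟨h1, h2⟩
  obtain ⟨s, hs, hsδ, hsη⟩ : ∃ s : ℝ, 0 < s ∧ 2 * s ≤ δ ∧ 2 * s ≤ η :=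
    ⟨min δ η / 2, by positivity, by linarith [min_le_left δ η], by linarith [min_le_right δ η]⟩
  have hann : ∀ y ∈ ball (0 : ℂ) 2, 1 < ‖z + s * y‖ ∧ ‖z + s * y‖ < 2 := fun y hy =>
    hηO (ball_subset_ball hsη (affine_mem hs hy))
  let e := c.sub z s hs ((ball_subset_ball hsδ).trans hδ2) (hinj.mono (ball_subset_ball hsδ))
  have hea : ∀ y ∈ ball (0 : ℂ) 2, z + s * y ∈ ball (0 : ℂ) 2 ∧ e y = c (z + s * y) :=
    c.sub_affine hs _ _
  have he : e.image ⊆ U := by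
    rintro _ ⟨y, hy, rfl⟩
    rw [(hea y hy).2]
    exact hU _ (hann y hy).1 (hann y hy).2
  have h0 : (0 : ℂ) ∈ ball (0 : ℂ) 2 := by simp
  have he0 : e 0 = c z := by rw [(hea 0 h0).2, mul_zero, add_zero]
  have hray : rayAt e 0 v = rayAt c z v := by
    have := rayAt_lift (isChartLift_affine hea h0) v
    rw [fderiv_affine] at this
    simpa [dir_ofReal_mul hs, dir_coe] using this
  have hl : IsChartLift (e.map hD he) d (fun y => collarMap c.order (z + s * y)) 0 := by
    refine ⟨ball 0 2, isOpen_ball, h0, subset_rfl, fun y hy => ?_, fun y hy => ⟨?_, ?_⟩⟩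
    · have hne : z + s * y ≠ 0 := norm_pos_iff.1 (one_pos.trans (hann y hy).1)
      refine ContDiffAt.contDiffWithinAt ?_
      exact ContDiffAt.comp y (contDiffAt_collarMap _ hne) (by fun_prop)
    · rw [mem_ball_zero_iff, norm_collarMap c.order_pos]
      exact (hann y hy).2
    · rw [OrbifoldChart.map_apply, (hea y hy).2, hF _ (hann y hy).1 (hann y hy).2]
  have hfd : fderiv ℝ (fun y : ℂ => collarMap c.order (z + s * y)) 0 v =
      s * fderiv ℝ (collarMap c.order) z v := by
    have h3 : DifferentiableAt ℝ (collarMap c.order) (z + s * 0) := by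
      rw [mul_zero, add_zero]
      exact (contDiffAt_collarMap _ hz0).differentiableAt (by simp)
    have h4 : fderiv ℝ (collarMap c.order ∘ fun y : ℂ => z + s * y) 0 = _ :=
      fderiv_comp 0 h3 (by fun_prop)
    rw [fderiv_affine, mul_zero, add_zero] at h4
    change fderiv ℝ (collarMap c.order ∘ fun y : ℂ => z + s * y) 0 v = _
    rw [h4]
    simp
  have h5 := hτ e he 0 h0 v (by rw [he0, hv, hray])
  rw [he0, rayAt_lift hl, hfd, dir_ofReal_mul hs, mul_zero, add_zero] at h5
  exact h5

/-- The index shift. With K the degree of the vectors in `c` and L the degree of the transported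
vectors in `d`, the claim is m L = m + K - 1. -/
theorem IsDiffeoOn.hasIdx_glued (hD : IsDiffeoOn F G U V)
    (hU : ∀ z : ℂ, 1 < ‖z‖ → ‖z‖ < 2 → c z ∈ U)
    (hF : ∀ z : ℂ, 1 < ‖z‖ → ‖z‖ < 2 → F (c z) = d (collarMap c.order z))
    (hτ : ∀ (e : OrbifoldChart X) (he : e.image ⊆ U), ∀ z ∈ ball (0 : ℂ) 2, ∀ v,
      σ (e z) = rayAt e z v → τ (F (e z)) = rayAt (e.map hD he) z v)
    (hc : oX.IsPositive c) (hd : oY.IsPositive d) (hd1 : d.order = 1) {P : Set X}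
    (hσ : IsSectionOff σ P) (hcP : c.center ∈ P) {r ρ : ℝ} (hr : 1 < r) (hrρ : r < ρ) (hρ : ρ < 2)
    (hreg : ∀ z ∈ ball (0 : ℂ) ρ, z ≠ 0 → c z ∉ P) {τ' : Y → SphereTangent Y} {u : ℂ → Circle}
    (hu : ContinuousOn u (sphere 0 r)) (hτu : ∀ z ∈ sphere (0 : ℂ) r, τ (d z) = rayAt d z (u z))
    (hτ' : ∀ z ∈ closedBall (0 : ℂ) r, z ≠ 0 → τ' (d z) = rayAt d z (u (r * dir z))) :
    HasIdx oY τ' d.center (idx oX σ c.center + 1 - 1 / c.order) := by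
  have hr0 : 0 < r := one_pos.trans hr
  have hm : (c.order : ℚ) ≠ 0 := by exact_mod_cast c.order_pos.ne'
  obtain ⟨v, hv, hσv⟩ := hσ.exists_vec c (Or.inr hcP)
  have hsub : ball (0 : ℂ) ρ \ {0} ⊆ ball 0 2 \ c ⁻¹' P := fun z hz =>
    ⟨ball_subset_ball hρ.le hz.1, hreg z hz.1 hz.2⟩
  have hρ0 : 0 < ρ := hr0.trans hrρ
  obtain ⟨K, g, hg, hvg⟩ := exists_expOn_punctured hρ0 (hv.mono hsub)
  have hidx : HasIdx oX σ c.center (K / c.order) :=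
    ⟨c, v, K, hc, rfl, rfl, ⟨ρ, hρ0, g, hg, fun z hz => by simpa using hvg z hz⟩, ρ, hρ0,
      fun z hz => hσv z (hsub hz)⟩
  obtain ⟨L, h, hh, huh, hdeg⟩ := exists_degree_sphere hr0 hu
  obtain ⟨β, hβ, hβs⟩ := exists_stretch c.order_pos
  have hmem : ∀ w : Circle, (r : ℂ) * w ∈ sphere (0 : ℂ) r := fun w => by
    rw [mem_sphere_zero_iff_norm, norm_mul, Circle.norm_coe, mul_one, Complex.norm_real,
      Real.norm_of_nonneg hr0.le]
  have hsph : sphere (0 : ℂ) r ⊆ ball 0 ρ \ {0} := sphere_subset_punctured hr0 hrρ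
  have hcont : Continuous fun w : Circle => (r : ℂ) * w := by fun_prop
  -- The direction of the section relative to the radial direction. It has degree K - 1 and is only
  -- stretched by the gluing map.
  let f : Circle → Circle := fun w => v (r * w) * w⁻¹
  have hf : Continuous f :=
    ((hv.mono (hsph.trans hsub)).comp_continuous hcont hmem).mul continuous_inv
  have hg' : Continuous fun w : Circle => g (r * w) :=
    (hg.mono hsph).comp_continuous hcont hmem
  have key : ∀ w : Circle, u (r * (w ^ c.order : Circle)) =
      w ^ c.order * (f w * Circle.exp (β (f w))) := by
    intro w
    have hw2 : ‖(r : ℂ) * w‖ = r := by simpa using hmem w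
    have hdw : dir ((r : ℂ) * w) = w := dir_ofReal_mul_coe hr0 w
    have hne : (r : ℂ) * w ≠ 0 := (hsph (hmem w)).2
    have h1 := hD.push_collar hU hF hτ (z := r * w) (by rwa [hw2]) (by rw [hw2]; linarith)
      (hσv _ (hsub (hsph (hmem w))))
    rw [hF _ (by rwa [hw2]) (by rw [hw2]; linarith), collarMap_mul c.order_pos hr0,
      hτu _ (hmem _)] at h1
    have h2 := rayAt_injective (ball_subset_ball hρ.le (hsph (hmem _)).1) (Or.inl hd1) h1
    rw [h2]
    have h3 : (v (r * w) : ℂ) = dir ((r : ℂ) * w) * (f w : ℂ) := by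
      rw [hdw, ← Circle.coe_mul]
      congr 1
      simp only [f]
      generalize v (r * w) = y
      rw [mul_comm y, mul_inv_cancel_left]
    rw [h3, fderiv_collarMap c.order_pos hne, hdw, ← Circle.coe_pow,
      dir_coe_mul _ _ (hβs (f w)).1, (hβs (f w)).2]
  -- Both sides are degrees in `w`: the left one of `u` at r w^m, the right one of w^m · f(w).
  have hL : (c.order : ℤ) * L = c.order + K - 1 := by
    refine Circle.degree_unique (g := fun w => h (w ^ c.order))
      (h := fun w => g (r * w) + β (f w)) (hh.comp (continuous_pow _))
      (hg'.add (hβ.comp hf)) fun w => ?_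
    have h1 := key w
    have h2 := hvg _ (hsph (hmem w))
    rw [huh] at h1
    simp only [dir_ofReal_mul_coe hr0] at h2
    have h3 : f w = w ^ K * Circle.exp (g (r * w)) * w⁻¹ := by
      simp only [f]
      rw [← h2, zpow_neg]
      congr 1
      rw [mul_comm (v _), mul_inv_cancel_left]
    rw [zpow_mul, zpow_natCast, h1, Circle.exp_add, zpow_sub_one, zpow_add, zpow_natCast, h3]
    apply Circle.ext
    simp only [Circle.coe_mul, Circle.coe_inv]
    ring
  refine ⟨d, _, L, hd, rfl, ?_, hdeg, r, hr0, fun z hz => hτ' z (ball_subset_closedBall hz.1) hz.2⟩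
  rw [hidx.idx_eq, hd1]
  have : (c.order : ℚ) * L = c.order + K - 1 := by exact_mod_cast hL
  field_simp
  push_cast
  linarith

end

section

/-! ### The underlying surface -/

open SphereTangent OrbifoldChart

theorem OrbifoldChart.isPreconnected_image {X : Type*} [TopologicalSpace X] [DiffeologicalSpace X]
    [IsTwoOrbifold X] (c : OrbifoldChart X) : IsPreconnected c.image :=
  (convex_ball (0 : ℂ) 2).isPreconnected.image _ c.continuousOn

theorem OrbifoldChart.notMem_iUnion_closedDisc {X ι : Type*} [TopologicalSpace X]
    [DiffeologicalSpace X] [IsTwoOrbifold X] {c : ι → OrbifoldChart X}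
    (hc : ∀ i j, i ≠ j → Disjoint (c i).image (c j).image) {k : ι} {z : ℂ} (h1 : 1 < ‖z‖)
    (h2 : ‖z‖ < 2) : c k z ∉ ⋃ i, (c i).closedDisc := by
  intro h
  obtain ⟨i, hi⟩ := mem_iUnion.1 h
  have hz : z ∈ ball (0 : ℂ) 2 := mem_ball_zero_iff.2 h2
  rcases eq_or_ne i k with rfl | hik
  · exact h1.not_ge (((c i).apply_mem_image_closedBall_iff hz one_lt_two).1 hi)
  · exact disjoint_left.1 (hc i k hik) (image_mono (closedBall_subset_ball one_lt_two) hi)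
      ((c k).mem_image hz)

theorem OrbifoldChart.center_injective {X ι : Type*} [TopologicalSpace X] [DiffeologicalSpace X]
    {c : ι → OrbifoldChart X} (hc : ∀ i j, i ≠ j → Disjoint (c i).image (c j).image) :
    Function.Injective fun i => (c i).center := fun i j h => by
  by_contra hij
  refine disjoint_left.1 (hc i j hij) ⟨0, by simp, rfl⟩ ⟨0, by simp, ?_⟩
  exact h.symm

/-! ### Comparison of the orbifold with the glued surface. -/

section Gluing

variable {B S : Type*} [TopologicalSpace B] [DiffeologicalSpace B] [IsTwoOrbifold B]
  [TopologicalSpace S] [DiffeologicalSpace S] [IsTwoOrbifold S]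
  {oB : OrbifoldOrientation B} {oS : OrbifoldOrientation S} {n : ℕ}
  {c : Fin n → OrbifoldChart B} {d : Fin n → OrbifoldChart S} {F : B → S} {G : S → B}

/-- The data of `IsUnderlyingSurface`. -/
structure IsGluing {B S : Type*} [TopologicalSpace B] [DiffeologicalSpace B] [TopologicalSpace S]
    [DiffeologicalSpace S] (oB : OrbifoldOrientation B) (oS : OrbifoldOrientation S) {n : ℕ}
    (c : Fin n → OrbifoldChart B) (d : Fin n → OrbifoldChart S) (F : B → S) (G : S → B) :
    Prop where
  pos_left : ∀ k, oB.IsPositive (c k)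
  pos_right : ∀ k, oS.IsPositive (d k)
  order_right : ∀ k, (d k).order = 1
  range_center : range (fun k => (c k).center) = singularSet B
  pairwise_left : ∀ i j, i ≠ j → Disjoint (c i).image (c j).image
  pairwise_right : ∀ i j, i ≠ j → Disjoint (d i).image (d j).image
  isDiffeoOn : IsDiffeoOn F G (⋃ k, (c k).closedDisc)ᶜ (⋃ k, (d k).closedDisc)ᶜ
  det_pos : ∀ a ∈ oB.atlas, ∀ b ∈ oS.atlas, ∀ h z, a z ∈ (⋃ k, (c k).closedDisc)ᶜ →
    IsLocalRep F a b h z → 0 < (fderiv ℝ h z).det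
  collar : ∀ k (z : ℂ), 1 < ‖z‖ → ‖z‖ < 2 → F (c k z) = d k (collarMap (c k).order z)

theorem IsUnderlyingSurface.exists_isGluing (h : IsUnderlyingSurface oB oS) :
    ∃ (n : ℕ) (c : Fin n → OrbifoldChart B) (d : Fin n → OrbifoldChart S) (F : B → S) (G : S → B),
      IsGluing oB oS c d F G := by
  obtain ⟨n, c, d, F, G, h1, h2, h3, h4, h5, h6, h7, h8, h9, h10, h11, h12⟩ := h
  exact ⟨n, c, d, F, G, h1, fun k => (h2 k).1, fun k => (h2 k).2, h3, h4, h5,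
    ⟨(isClosed_iUnion_of_finite fun k =>
        (c k).isClosed_image_closedBall one_lt_two).isOpen_compl,
      (isClosed_iUnion_of_finite fun k =>
        (d k).isClosed_image_closedBall one_lt_two).isOpen_compl, h6, h7, h8, h9, h10⟩, h11, h12⟩

namespace IsGluing

theorem apply_mem_left (hg : IsGluing oB oS c d F G) (k : Fin n) {z : ℂ} (h1 : 1 < ‖z‖)
    (h2 : ‖z‖ < 2) : c k z ∈ (⋃ k, (c k).closedDisc)ᶜ :=
  notMem_iUnion_closedDisc hg.pairwise_left h1 h2

theorem apply_mem_right (hg : IsGluing oB oS c d F G) (k : Fin n) {z : ℂ} (h1 : 1 < ‖z‖)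
    (h2 : ‖z‖ < 2) : d k z ∈ (⋃ k, (d k).closedDisc)ᶜ :=
  notMem_iUnion_closedDisc hg.pairwise_right h1 h2

theorem notMem_singularSet (hg : IsGluing oB oS c d F G) :
    ∀ x ∈ (⋃ k, (c k).closedDisc)ᶜ, x ∉ singularSet B := by
  intro x hx h
  rw [← hg.range_center] at h
  obtain ⟨k, rfl⟩ := h
  exact hx (mem_iUnion.2 ⟨k, 0, by simp, rfl⟩)

theorem hasPositiveCharts (hg : IsGluing oB oS c d F G) : oB.HasPositiveCharts := by
  intro x hx
  rw [← hg.range_center] at hx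
  obtain ⟨k, rfl⟩ := hx
  exact ⟨c k, hg.pos_left k, rfl⟩

theorem one_lt_norm {X : Type*} [TopologicalSpace X] [DiffeologicalSpace X]
    {c : Fin n → OrbifoldChart X} {k : Fin n} {z : ℂ} (h : c k z ∈ (⋃ k, (c k).closedDisc)ᶜ) :
    1 < ‖z‖ := by
  by_contra hz
  exact h (mem_iUnion.2 ⟨k, z, mem_closedBall_zero_iff.2 (not_lt.1 hz), rfl⟩)

/-- On each circle the gluing map is w ↦ w^m, and an m-th root is a preimage. -/
theorem exists_collar (hg : IsGluing oB oS c d F G) (k : Fin n) {z : ℂ} (h1 : 1 < ‖z‖)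
    (h2 : ‖z‖ < 2) : ∃ z', ‖z'‖ = ‖z‖ ∧ F (c k z') = d k z := by
  have hz : 0 < ‖z‖ := one_pos.trans h1
  have hm : ((c k).order : ℝ) ≠ 0 := by exact_mod_cast (c k).order_pos.ne'
  let w : Circle := Circle.exp (z.arg / (c k).order)
  have hw : w ^ (c k).order = dir z := by
    rw [← Circle.exp_nsmul, nsmul_eq_mul, mul_div_cancel₀ _ hm]
    rfl
  have hn : ‖(‖z‖ : ℂ) * w‖ = ‖z‖ := by
    rw [norm_mul, Circle.norm_coe, mul_one, Complex.norm_real, norm_norm]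
  refine ⟨‖z‖ * w, hn, ?_⟩
  rw [hg.collar k _ (by rwa [hn]) (by rwa [hn]), collarMap_mul (c k).order_pos hz, hw,
    norm_mul_dir]

theorem map_notMem_image_ball (hg : IsGluing oB oS c d F G) {x : B}
    (hx : x ∈ (⋃ k, (c k).closedDisc)ᶜ) {k : Fin n} {r : ℝ} (hr : r ≤ 2)
    (h : x ∉ c k '' ball 0 r) : F x ∉ d k '' ball 0 r := by
  rintro ⟨z, hz, hzx⟩
  have hzr := mem_ball_zero_iff.1 hz
  have h1 : 1 < ‖z‖ := one_lt_norm (c := d) (k := k) (by rw [hzx]; exact hg.isDiffeoOn.mapsTo hx)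
  obtain ⟨y, hy, hFy⟩ := hg.exists_collar k h1 (hzr.trans_le hr)
  have hyx : c k y = x := hg.isDiffeoOn.invOn.1.injOn
    (hg.apply_mem_left k (by rwa [hy]) (by rw [hy]; exact hzr.trans_le hr)) hx (hFy.trans hzx)
  exact h ⟨y, mem_ball_zero_iff.2 (by rwa [hy]), hyx⟩

theorem compactSpace [CompactSpace B] (hg : IsGluing oB oS c d F G) : CompactSpace S := by
  -- `S` is the union of the image of this compact set and of the closed discs of radius 3/2 in the
  -- charts `d k`.
  let K : Set B := (⋃ k, c k '' ball 0 (3 / 2))ᶜ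
  have hK : IsCompact K := IsClosed.isCompact (isOpen_iUnion fun k =>
    (c k).isOpen_image_ball (by norm_num)).isClosed_compl
  have hKU : K ⊆ (⋃ k, (c k).closedDisc)ᶜ := compl_subset_compl.2 (iUnion_mono fun k =>
    image_mono (closedBall_subset_ball (by norm_num)))
  have hFK : IsCompact (F '' K) :=
    hK.image_of_continuousOn ((hg.isDiffeoOn.smooth.continuousOn hg.isDiffeoOn.isOpen_left).mono hKU)
  have hd : IsCompact (⋃ k, d k '' closedBall 0 (3 / 2)) := isCompact_iUnion fun k =>
    (isCompact_closedBall _ _).image_of_continuousOn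
      ((d k).continuousOn.mono (closedBall_subset_ball (by norm_num)))
  refine ⟨(hFK.union hd).of_isClosed_subset isClosed_univ fun y _ => ?_⟩
  by_cases hy : ∃ k, y ∈ d k '' closedBall 0 (3 / 2)
  · exact Or.inr (mem_iUnion.2 hy)
  · have hyV : y ∈ (⋃ k, (d k).closedDisc)ᶜ := fun h => by
      obtain ⟨k, hk⟩ := mem_iUnion.1 h
      exact hy ⟨k, image_mono (closedBall_subset_closedBall (by norm_num)) hk⟩
    have hyU := hg.isDiffeoOn.mapsTo_inv hyV
    refine Or.inl ⟨G y, fun h => ?_, hg.isDiffeoOn.invOn.2 hyV⟩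
    obtain ⟨k, z, hz, hzy⟩ := mem_iUnion.1 h
    have hz' := mem_ball_zero_iff.1 hz
    have h1 : 1 < ‖z‖ := one_lt_norm (c := c) (k := k) (by rwa [hzy])
    refine hy ⟨k, collarMap (c k).order z, ?_, ?_⟩
    · rw [mem_closedBall_zero_iff, norm_collarMap (c k).order_pos]
      exact hz'.le
    · rw [← hg.collar k z h1 (by linarith), hzy, hg.isDiffeoOn.invOn.2 hyV]

theorem map_mem_image (hg : IsGluing oB oS c d F G) {x : B} (hx : x ∈ (⋃ k, (c k).closedDisc)ᶜ)
    {k : Fin n} (hk : x ∈ (c k).image) : F x ∈ (d k).image := by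
  obtain ⟨z, hz, rfl⟩ := hk
  have hz' := mem_ball_zero_iff.1 hz
  rw [hg.collar k z (one_lt_norm hx) hz']
  exact (d k).mem_image (mem_ball_zero_iff.2 (by rwa [norm_collarMap (c k).order_pos]))

theorem preconnectedSpace [PreconnectedSpace B] (hg : IsGluing oB oS c d F G) :
    PreconnectedSpace S := by
  -- A clopen set of `S` contains or misses each connected disc `(d k).image`. Replacing these discs
  -- by those of `B` gives a clopen set of `B`, which is empty or everything.
  let O : Set S → Set B := fun T =>
    ((⋃ k, (c k).closedDisc)ᶜ ∩ F ⁻¹' T) ∪ ⋃ k : {k // (d k).center ∈ T}, (c k).image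
  have hcen : ∀ k, (d k).center ∈ (d k).image := fun k => ⟨0, by simp, rfl⟩
  have hsub : ∀ T : Set S, IsClopen T → ∀ k, (d k).center ∈ T → (d k).image ⊆ T := fun T hT k hk =>
    (d k).isPreconnected_image.subset_isClopen hT ⟨_, hcen k, hk⟩
  have hFO : ∀ T : Set S, IsClopen T → ∀ x ∈ (⋃ k, (c k).closedDisc)ᶜ, x ∈ O T → F x ∈ T := by
    rintro T hT x hx (h | h)
    · exact h.2
    · obtain ⟨k, hk⟩ := mem_iUnion.1 h
      exact hsub T hT k k.2 (hg.map_mem_image hx hk)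
  have hopen : ∀ T : Set S, IsClopen T → IsOpen (O T) := fun T hT =>
    ((hg.isDiffeoOn.smooth.continuousOn hg.isDiffeoOn.isOpen_left).isOpen_inter_preimage
      hg.isDiffeoOn.isOpen_left hT.isOpen).union (isOpen_iUnion fun k => (c k).isOpen_image)
  have hcompl : ∀ T : Set S, IsClopen T → (O T)ᶜ = O Tᶜ := by
    intro T hT
    refine (IsCompl.compl_eq ⟨disjoint_left.2 fun x h1 h2 => ?_, ?_⟩)
    · by_cases hx : x ∈ (⋃ k, (c k).closedDisc)ᶜ
      · exact hFO _ hT.compl x hx h2 (hFO T hT x hx h1)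
      · obtain ⟨k, hk⟩ := mem_iUnion.1 ((h1.resolve_left fun h => hx h.1))
        obtain ⟨j, hj⟩ := mem_iUnion.1 ((h2.resolve_left fun h => hx h.1))
        have hkj : (k : Fin n) ≠ j := fun h => j.2 (h ▸ k.2)
        exact disjoint_left.1 (hg.pairwise_left _ _ hkj) hk hj
    · refine codisjoint_iff_le_sup.2 fun x _ => ?_
      by_cases hx : x ∈ ⋃ k, (c k).closedDisc
      · obtain ⟨k, hk⟩ := mem_iUnion.1 hx
        have hk' : x ∈ (c k).image := image_mono (closedBall_subset_ball one_lt_two) hk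
        by_cases h : (d k).center ∈ T
        · exact Or.inl (Or.inr (mem_iUnion.2 ⟨⟨k, h⟩, hk'⟩))
        · exact Or.inr (Or.inr (mem_iUnion.2 ⟨⟨k, h⟩, hk'⟩))
      · by_cases h : F x ∈ T
        · exact Or.inl (Or.inl ⟨hx, h⟩)
        · exact Or.inr (Or.inl ⟨hx, h⟩)
  have huniv : ∀ T : Set S, IsClopen T → O T = univ → T = univ := by
    intro T hT hO
    refine eq_univ_of_forall fun y => ?_
    by_cases hy : y ∈ ⋃ k, (d k).closedDisc
    · obtain ⟨k, hk⟩ := mem_iUnion.1 hy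
      have h1 : (1 : ℝ) < ‖(3 / 2 : ℂ)‖ := by norm_num
      have h2 : ‖(3 / 2 : ℂ)‖ < (2 : ℝ) := by norm_num
      have hx := hg.apply_mem_left k h1 h2
      exact (d k).isPreconnected_image.subset_isClopen hT
        ⟨_, hg.map_mem_image hx ((c k).mem_image (mem_ball_zero_iff.2 h2)),
          hFO T hT _ hx (hO ▸ mem_univ _)⟩ (image_mono (closedBall_subset_ball one_lt_two) hk)
    · have := hFO T hT (G y) (hg.isDiffeoOn.mapsTo_inv hy) (hO ▸ mem_univ _)
      rwa [hg.isDiffeoOn.invOn.2 hy] at this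
  refine preconnectedSpace_iff_clopen.2 fun T hT => ?_
  have hOT : IsClopen (O T) := ⟨⟨by rw [hcompl T hT]; exact hopen _ hT.compl⟩, hopen T hT⟩
  rcases isClopen_iff.1 hOT with h | h
  · left
    have := huniv _ hT.compl (by rw [← hcompl T hT, h, compl_empty])
    rwa [compl_univ_iff] at this
  · exact Or.inr (huniv T hT h)

/-- The base point stays off the discs of radius 7/4, so that it does not interfere with the conic
extension at radius 3/2. It may be taken in a collar if there is one. -/
theorem exists_base [Nonempty B] (hg : IsGluing oB oS c d F G) :
    ∃ x₀ ∈ (⋃ k, (c k).closedDisc)ᶜ, ∀ k, x₀ ∉ c k '' ball 0 (7 / 4) := by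
  rcases isEmpty_or_nonempty (Fin n) with h | ⟨⟨i⟩⟩
  · exact ⟨Classical.arbitrary B, by simp, fun k => h.elim k⟩
  · have h1 : (1 : ℝ) < ‖(7 / 4 : ℂ)‖ := by norm_num
    have h2 : ‖(7 / 4 : ℂ)‖ < (2 : ℝ) := by norm_num
    refine ⟨c i (7 / 4 : ℂ), hg.apply_mem_left i h1 h2, fun k hk => ?_⟩
    rcases eq_or_ne k i with rfl | hki
    · have := ((c k).apply_mem_image_ball_iff (mem_ball_zero_iff.2 h2) (by norm_num)).1 hk
      norm_num at this
    · exact disjoint_left.1 (hg.pairwise_left k i hki) (image_mono (ball_subset_ball (by norm_num)) hk)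
        ((c i).mem_image (mem_ball_zero_iff.2 h2))

theorem exists_eulerCharacteristic [CompactSpace B] [ConnectedSpace B]
    (hg : IsGluing oB oS c d F G) (hS : singularSet S = ∅) :
    ∃ χB χS : ℚ, HasEulerCharacteristic oB χB ∧ HasEulerCharacteristic oS χS ∧
      χB = χS + ∑ k, (-1 + 1 / ((c k).order : ℚ)) := by
  classical
  have := hg.compactSpace
  have := hg.preconnectedSpace
  have hoS : oS.HasPositiveCharts := fun x hx => by simp [hS] at hx
  have hD := hg.isDiffeoOn
  obtain ⟨x₀, hx₀, hx₀c⟩ := hg.exists_base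
  have : Nonempty S := ⟨F x₀⟩
  let P : Finset B := insert x₀ (Finset.univ.image fun k => (c k).center)
  let Q : Finset S := insert (F x₀) (Finset.univ.image fun k => (d k).center)
  have hP : (P : Set B) = insert x₀ (singularSet B) := by
    simp [P, ← hg.range_center]
  have hx₀P : x₀ ∉ Finset.univ.image fun k => (c k).center := by
    intro h
    obtain ⟨k, -, hk⟩ := Finset.mem_image.1 h
    exact hx₀c k ⟨0, by simp, hk⟩
  have hFx₀ : ∀ k, F x₀ ∉ d k '' ball 0 (7 / 4) := fun k =>
    hg.map_notMem_image_ball hx₀ (by norm_num) (hx₀c k)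
  have hx₀Q : F x₀ ∉ Finset.univ.image fun k => (d k).center := by
    intro h
    obtain ⟨k, -, hk⟩ := Finset.mem_image.1 h
    exact hFx₀ k ⟨0, by simp, hk⟩
  obtain ⟨σ, hσ⟩ := _root_.exists_section hg.hasPositiveCharts
    (hg.range_center ▸ finite_range _) x₀
  rw [← hP] at hσ
  obtain ⟨τ₀, hτ₀, hidx₀, hpush⟩ := hD.exists_section hg.hasPositiveCharts hg.notMem_singularSet
    hg.det_pos hσ
  have hsphere : ∀ k, d k '' sphere 0 (3 / 2) ⊆
      (⋃ k, (d k).closedDisc)ᶜ \ F '' ((⋃ k, (c k).closedDisc)ᶜ ∩ P) := by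
    rintro k _ ⟨z, hz, rfl⟩
    have hz' := mem_sphere_zero_iff_norm.1 hz
    refine ⟨hg.apply_mem_right k (by rw [hz']; norm_num) (by rw [hz']; norm_num), ?_⟩
    rintro ⟨x, ⟨hxU, hxP⟩, hx⟩
    rw [hP] at hxP
    rcases hxP with rfl | hxP
    · exact hFx₀ k ⟨z, mem_ball_zero_iff.2 (by rw [hz']; norm_num), hx.symm⟩
    · exact hg.notMem_singularSet x hxU hxP
  -- The radius 3/2 lies inside the collars, where the transported section is known through the
  -- gluing map.
  obtain ⟨τ, hτ, hτeq, hτd⟩ := hτ₀.conic_family d (r := 3 / 2) (by norm_num) (by norm_num)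
    (fun i j hij => (hg.pairwise_right i j hij).mono
      (image_mono (closedBall_subset_ball (by norm_num)))
      (image_mono (closedBall_subset_ball (by norm_num)))) hsphere
  have hτQ : IsSectionOff τ Q := by
    refine isSectionOff_iff.2 (hτ.mono fun y hy => ?_)
    have hy : y ≠ F x₀ ∧ ∀ k, (d k).center ≠ y := by simpa [Q] using hy
    refine ⟨?_, fun ⟨k, hk⟩ => hy.2 k hk⟩
    by_cases h : ∃ k, y ∈ d k '' closedBall 0 (3 / 2)
    · exact Or.inr (mem_iUnion.2 h)
    · refine Or.inl ⟨⟨fun hyk => ?_, ?_⟩, fun hyk => ?_⟩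
      · obtain ⟨k, hk⟩ := mem_iUnion.1 hyk
        exact h ⟨k, image_mono (closedBall_subset_closedBall (by norm_num)) hk⟩
      · rintro ⟨x, ⟨hxU, hxP⟩, rfl⟩
        rw [hP] at hxP
        rcases hxP with rfl | hxP
        · exact hy.1 rfl
        · exact hg.notMem_singularSet x hxU hxP
      · obtain ⟨k, hk⟩ := mem_iUnion.1 hyk
        exact h ⟨k, image_mono ball_subset_closedBall hk⟩
  have hidx : idx oS τ (F x₀) = idx oB σ x₀ := by
    refine ((hidx₀ x₀ hx₀).congr ?_).idx_eq
    have hN : (⋃ k, d k '' closedBall 0 (3 / 2))ᶜ ∈ nhds (F x₀) := by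
      refine (isClosed_iUnion_of_finite fun k =>
        (d k).isClosed_image_closedBall (by norm_num)).isOpen_compl.mem_nhds fun h => ?_
      obtain ⟨k, hk⟩ := mem_iUnion.1 h
      exact hFx₀ k (image_mono (closedBall_subset_ball (by norm_num)) hk)
    filter_upwards [nhdsWithin_le_nhds hN] with y hy
    exact hτeq y fun k hk => hy (mem_iUnion.2 ⟨k, image_mono ball_subset_closedBall hk⟩)
  have hidxd : ∀ k, idx oS τ (d k).center = idx oB σ (c k).center + 1 - 1 / (c k).order := by
    intro k
    obtain ⟨u, hu, hτu, hτ'⟩ := hτd k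
    refine (hD.hasIdx_glued (fun z => hg.apply_mem_left k) (hg.collar k) hpush (hg.pos_left k)
      (hg.pos_right k) (hg.order_right k) hσ ?_ (by norm_num) (ρ := 7 / 4) (by norm_num)
      (by norm_num) (fun z hz h0 h => ?_) hu hτu hτ').idx_eq
    · rw [hP, ← hg.range_center]
      exact Or.inr ⟨k, rfl⟩
    · rw [hP] at h
      rcases h with h | h
      · exact hx₀c k ⟨z, hz, h⟩
      · exact (c k).notMem_singularSet (ball_subset_ball (by norm_num) hz) h0 h
  refine ⟨_, _, hasEulerCharacteristic_sum_idx hg.hasPositiveCharts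
    (hg.notMem_singularSet x₀ hx₀) (by rw [hP]; exact subset_insert _ _) hσ,
    hasEulerCharacteristic_sum_idx hoS (x₀ := F x₀) (by simp [hS]) (by simp [hS]) hτQ, ?_⟩
  rw [Finset.sum_insert hx₀P, Finset.sum_insert hx₀Q,
    Finset.sum_image (center_injective hg.pairwise_left).injOn,
    Finset.sum_image (center_injective hg.pairwise_right).injOn, hidx, add_assoc,
    ← Finset.sum_add_distrib]
  congr 1
  refine Finset.sum_congr rfl fun k _ => ?_
  rw [hidxd k]
  ring

end IsGluing

end Gluing

theorem mainTheorem9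
    {B : Type*} [TopologicalSpace B] [DiffeologicalSpace B] [IsTwoOrbifold B]
    [CompactSpace B] [ConnectedSpace B] (oB : OrbifoldOrientation B)
    {n : ℕ} (x : Fin n → B) (hx : Function.Injective x) (hsing : Set.range x = singularSet B)
    (m : Fin n → ℕ) (hm : ∀ k, HasOrder (x k) (m k))
    {S : Type*} [TopologicalSpace S] [DiffeologicalSpace S] [IsTwoOrbifold S]
    (hS : singularSet S = ∅) (oS : OrbifoldOrientation S) (hBS : IsUnderlyingSurface oB oS) :
    ∃ χB χS : ℚ, HasEulerCharacteristic oB χB ∧ HasEulerCharacteristic oS χS ∧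
      χB = χS + ∑ k, (-1 + 1 / (m k : ℚ)) := by
  obtain ⟨n', c, d, F, G, hg⟩ := hBS.exists_isGluing
  obtain ⟨χB, χS, hB, hS', h⟩ := hg.exists_eulerCharacteristic hS
  refine ⟨χB, χS, hB, hS', ?_⟩
  have hr : range (fun k => (c k).center) = range x := hg.range_center.trans hsing.symm
  have hex : ∀ j, ∃ k, x k = (c j).center := fun j => by
    obtain ⟨k, hk⟩ : (c j).center ∈ range x := hr ▸ mem_range_self j
    exact ⟨k, hk⟩
  -- `φ` matches the enumeration of the cone points by the gluing charts with the given one.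
  choose φ hφ using hex
  have hbij : Function.Bijective φ := by
    refine ⟨fun i j hij => center_injective hg.pairwise_left ?_, fun k => ?_⟩
    · change (c i).center = (c j).center
      rw [← hφ, ← hφ, hij]
    · obtain ⟨j, hj⟩ : x k ∈ range fun k => (c k).center := hr ▸ mem_range_self k
      exact ⟨j, hx ((hφ j).trans hj)⟩
  have hord : ∀ j, (c j).order = m (φ j) := fun j => by
    obtain ⟨e, he, hem⟩ := hm (φ j)
    rw [← hem]
    exact order_eq_of_center_eq ((hφ j).symm.trans he.symm)
  rw [h]
  congr 1
  exact Fintype.sum_bijective φ hbij _ _ fun j => by rw [hord]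

end

end
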